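/- **Theorem (no radiation on $\Delta\subset\mathscr J$, case $\Lambda=0$).** *Setting.* Let $M$ be a smooth 4-manifold with a smooth Lorentzian metric $g$ of signature $(-,+,+,+)$, and let $\Omega$ be a smooth function on $M$ with $d\Omega\neq0$ on $\mathscr J:=\{\Omega=0\}$. Assume that the physical metric $\hat g=\Omega^{-2}g$ on $\hat M=\{\Omega>0\}$ satisfies Einstein's equations with $\Lambda=0$, with an energy–momentum tensor $\hat T_{\alpha\beta}$ such that $\Omega^{-2}\hat T_{\alpha\beta}$ extends smoothly to $\mathscr J$ (for instance vacuum near $\mathscr J$). Put $N_\alpha=\partial_\alpha\Omega$. Let $C$ be the Weyl tensor of $g$, let $d_{\alpha\beta\gamma}{}^{\delta}=\Omega^{-1}C_{\alpha\beta\gamma}{}^{\delta}$ be the rescaled Weyl tensor, taken on $\mathscr J$ as the limit from $\hat M$, and let $$\mathcal D_{\alpha\beta\gamma\delta}=d_{\alpha\mu\gamma}{}^{\nu}d_{\delta\nu\beta}{}^{\mu}+d_{\alpha\mu\delta}{}^{\nu}d_{\gamma\nu\beta}{}^{\mu}-\tfrac18 g_{\alpha\beta}g_{\gamma\delta}d_{\rho\sigma\mu\nu}d^{\rho\sigma\mu\nu},\qquad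 \Pi^\alpha(\vec N)=-N^\mu N^\nu N^\rho\,\mathcal D^{\alpha}{}_{\mu\nu\rho}.$$ *News.* Let $\omega>0$ be a smooth function such that the gauge $(\tilde g,\tilde\Omega)=(\omega^2g,\omega\Omega)$ is divergence-free, that is, $\tilde\nabla_\alpha\tilde N^\alpha=0$ on $\mathscr J$ with $\tilde N_\alpha=\partial_\alpha\tilde\Omega$. In such a gauge the Levi-Civita connection of $\tilde g$ restricts to a connection $D$ on $\mathscr J$. Let $\rho_{ab}$ be a Geroch tensor on $\mathscr J$, that is, a smooth symmetric tensor with $\rho_{ab}\tilde N^b=0$, $q^{ab}\rho_{ab}=\mathcal R$ and $D_{[a}\rho_{b]c}=0$, where $q$ is the degenerate metric induced by $\tilde g$ on $\mathscr J$ and $\mathcal R$ is the scalar curvature of the corresponding 2-metric. The News tensor is $\mathcal N_{ab}=S_{ab}-\rho_{ab}$, where $S_{ab}$ is the pull-back to $\mathscr J$ of $\tilde R_{\alpha\beta}-\frac16\tilde R\,\tilde g_{\alpha\beta}$. *The portion $\Delta$.* Let $\Delta\subset\mathscr J$ be relatively open and a union of cuts, that is, every point of $\Delta$ lies on a smoothly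 embedded spacelike 2-sphere contained in $\Delta$. (By uniformisation, each cut may be taken to be parametrised conformally by the round sphere.) *Conclusion.* 1. On $\mathscr J$ the normal $N^\alpha$ is non-zero, null and tangent to $\mathscr J$, and every causal vector tangent to $\mathscr J$ is a multiple of it. So $\mathscr J$ is null and $N^\alpha$ is, up to scale, its unique selected observer. 2. The rescaled Weyl tensor $d$ extends continuously from $\hat M$ to $\Delta$. 3. The News tensor vanishes on $\Delta$ if and only if the asymptotic radiant super-momentum vanishes there: $$\mathcal N_{ab}=0\ \text{ on }\Delta\quad\Longleftrightarrow\quad \Pi^\alpha(\vec N)=0\ \text{ on }\Delta .$$ -/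

import Mathlib

open Set Filter Topology
open scoped Manifold ContDiff

noncomputable section

namespace NullInfinity

/-! ### Tensor calculus in a coordinate domain of `ℝ⁴` -/

/-- The coordinate space of a four-dimensional spacetime. -/
abbrev Coord : Type := EuclideanSpace ℝ (Fin 4)

/-- The `i`-th coordinate vector of `ℝ⁴`. -/
def basisVec (i : Fin 4) : Coord := EuclideanSpace.single i (1 : ℝ)

/-- The partial derivative `∂ᵢ f` at `y`. -/
def pd (i : Fin 4) (f : Coord → ℝ) (y : Coord) : ℝ := fderiv ℝ f y (basisVec i)

/-- A (0,2) tensor field in coordinates. -/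
abbrev MatField : Type := Coord → Matrix (Fin 4) (Fin 4) ℝ

/-- Christoffel symbol `Γᵏᵢⱼ` of the metric `G`. -/
def christoffel (G : MatField) (k i j : Fin 4) (y : Coord) : ℝ :=
  (1 / 2) * ∑ l, (G y)⁻¹ k l *
    (pd i (fun z => G z l j) y + pd j (fun z => G z l i) y - pd l (fun z => G z i j) y)

/-- `Rˡₖᵢⱼ`, the components of `R(∂ᵢ, ∂ⱼ) ∂ₖ = Rˡₖᵢⱼ ∂ₗ`. -/
def riemannUp (G : MatField) (l k i j : Fin 4) (y : Coord) : ℝ :=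
  pd i (christoffel G l j k) y - pd j (christoffel G l i k) y
    + ∑ m, (christoffel G l i m y * christoffel G m j k y
      - christoffel G l j m y * christoffel G m i k y)

/-- `R_{lkij} = g_{lm} Rᵐₖᵢⱼ`. -/
def riemann (G : MatField) (l k i j : Fin 4) (y : Coord) : ℝ :=
  ∑ m, G y l m * riemannUp G m k i j y

/-- Ricci tensor `R_{kj} = Rⁱₖᵢⱼ`. -/
def ricci (G : MatField) (k j : Fin 4) (y : Coord) : ℝ :=
  ∑ i, riemannUp G i k i j y

/-- Scalar curvature. -/
def scalarCurv (G : MatField) (y : Coord) : ℝ :=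
  ∑ i, ∑ j, (G y)⁻¹ i j * ricci G i j y

/-- Einstein tensor `R_{ij} - R g_{ij} / 2`. -/
def einstein (G : MatField) (i j : Fin 4) (y : Coord) : ℝ :=
  ricci G i j y - (1 / 2) * scalarCurv G y * G y i j

/-- Schouten tensor, normalised as `S_{ij} = R_{ij} - R g_{ij} / 6`. -/
def schouten (G : MatField) (i j : Fin 4) (y : Coord) : ℝ :=
  ricci G i j y - (1 / 6) * scalarCurv G y * G y i j

/-- Weyl tensor with all indices lowered, `C_{lkij}`. -/
def weyl (G : MatField) (l k i j : Fin 4) (y : Coord) : ℝ :=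
  riemann G l k i j y
    - (1 / 2) * (G y l i * schouten G k j y - G y l j * schouten G k i y
      + G y k j * schouten G l i y - G y k i * schouten G l j y)

/-- The covariant Hessian `∇ᵢ∇ⱼ f`. -/
def hessian (G : MatField) (f : Coord → ℝ) (i j : Fin 4) (y : Coord) : ℝ :=
  pd i (pd j f) y - ∑ k, christoffel G k i j y * pd k f y

/-- The covariant derivative `∇ᵢ ρⱼₖ` of a (0,2) tensor field. -/
def covDeriv (G P : MatField) (i j k : Fin 4) (y : Coord) : ℝ :=
  pd i (fun z => P z j k) y
    - ∑ m, (christoffel G m i j y * P y m k + christoffel G m i k y * P y j m)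

/-- The value `B(X, Y)` of a bilinear form given by its components. -/
def bil (B : Fin 4 → Fin 4 → ℝ) (X Y : Fin 4 → ℝ) : ℝ := ∑ i, ∑ j, B i j * X i * Y j

/-- The gradient vector `Nⁱ = gⁱʲ ∂ⱼ f`. -/
def gradVec (G : MatField) (f : Coord → ℝ) (y : Coord) (i : Fin 4) : ℝ :=
  ∑ j, (G y)⁻¹ i j * pd j f y

/-- `X` is annihilated by `df` at `y`, i.e. it is tangent to the level set of `f`. -/
def IsTangent (f : Coord → ℝ) (y : Coord) (X : Fin 4 → ℝ) : Prop :=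
  ∑ i, X i * pd i f y = 0

/-- Raise the last index: `d_{αβγ}{}^δ`. -/
def raiseLast (h : Matrix (Fin 4) (Fin 4) ℝ) (d : Fin 4 → Fin 4 → Fin 4 → Fin 4 → ℝ)
    (α β γ δ : Fin 4) : ℝ := ∑ σ, h⁻¹ δ σ * d α β γ σ

/-- The full contraction `d_{ρσμν} d^{ρσμν}`. -/
def normSq (h : Matrix (Fin 4) (Fin 4) ℝ) (d : Fin 4 → Fin 4 → Fin 4 → Fin 4 → ℝ) : ℝ :=
  ∑ r, ∑ s, ∑ m, ∑ n, ∑ r', ∑ s', ∑ m', ∑ n',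
    h⁻¹ r r' * h⁻¹ s s' * h⁻¹ m m' * h⁻¹ n n' * d r s m n * d r' s' m' n'

/-- Bel–Robinson tensor of a Weyl-type tensor `d` with respect to the metric `h`:
`d_{αμγ}{}^ν d_{δνβ}{}^μ + d_{αμδ}{}^ν d_{γνβ}{}^μ - g_{αβ} g_{γδ} d_{ρσμν} d^{ρσμν} / 8`. -/
def belRobinson (h : Matrix (Fin 4) (Fin 4) ℝ) (d : Fin 4 → Fin 4 → Fin 4 → Fin 4 → ℝ)
    (α β γ δ : Fin 4) : ℝ :=
  (∑ μ, ∑ ν, raiseLast h d α μ γ ν * raiseLast h d δ ν β μ)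
    + (∑ μ, ∑ ν, raiseLast h d α μ δ ν * raiseLast h d γ ν β μ)
    - (1 / 8) * h α β * h γ δ * normSq h d

/-- The supermomentum `Π^α(u) = - u^μ u^ν u^ρ 𝒟^α_{μνρ}`. -/
def superMomentum (h : Matrix (Fin 4) (Fin 4) ℝ) (d : Fin 4 → Fin 4 → Fin 4 → Fin 4 → ℝ)
    (u : Fin 4 → ℝ) (α : Fin 4) : ℝ :=
  - ∑ σ, ∑ μ, ∑ ν, ∑ ρ, h⁻¹ α σ * belRobinson h d σ μ ν ρ * u μ * u ν * u ρ

/-! ### Fields on a spacetime manifold -/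

section Manifold

variable {M : Type*} [TopologicalSpace M] [ChartedSpace Coord M]

/-- A field of bilinear forms on the tangent spaces of `M`. -/
abbrev BilinField (M : Type*) [TopologicalSpace M] [ChartedSpace Coord M] : Type _ :=
  ∀ x : M, TangentSpace (𝓡 4) x →L[ℝ] TangentSpace (𝓡 4) x →L[ℝ] ℝ

/-- The coordinate vector `∂ᵢ` of the chart `e`, at the point with coordinates `y`. -/
def coordVec (e : OpenPartialHomeomorph M Coord) (y : Coord) (i : Fin 4) :
    TangentSpace (𝓡 4) (e.symm y) :=
  mfderiv 𝓘(ℝ, Coord) (𝓡 4) e.symm y (basisVec i)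

/-- Components of a field of bilinear forms in the chart `e`. -/
def comp (B : BilinField M) (e : OpenPartialHomeomorph M Coord) : MatField :=
  fun y => Matrix.of fun i j => B (e.symm y) (coordVec e y i) (coordVec e y j)

/-- The components in every chart of the atlas are smooth. -/
def IsSmoothField (B : BilinField M) : Prop :=
  ∀ e ∈ atlas Coord M, ∀ i j, ContDiffOn ℝ ∞ (fun y => comp B e y i j) e.target

/-- A smooth metric of signature `(-,+,+,+)`. -/
structure IsLorentzMetric (g : BilinField M) : Prop where
  smooth : IsSmoothField g
  signature : ∀ x : M, ∃ b : Module.Basis (Fin 4) ℝ (TangentSpace (𝓡 4) x),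
    ∀ i j, g x (b i) (b j) = Matrix.diagonal ![(-1 : ℝ), 1, 1, 1] i j

/-- The conformally rescaled metric `θ² g`. -/
def rescale (θ : M → ℝ) (g : BilinField M) : BilinField M := fun x => (θ x) ^ 2 • g x

/-- Infinity: the points at which `Ω` vanishes. -/
def scri (Ω : M → ℝ) : Set M := {x | Ω x = 0}

/-- Components of the physical metric `ĝ = Ω⁻² g`; meaningful where `Ω > 0`. -/
def physMetric (g : BilinField M) (Ω : M → ℝ) (e : OpenPartialHomeomorph M Coord) : MatField :=
  fun y => ((Ω (e.symm y)) ^ 2)⁻¹ • comp g e y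

/-- `(M, g, Ω)` is a smooth conformal completion of the physical spacetime
`({Ω > 0}, Ω⁻² g)`, a solution of Einstein's equations with cosmological constant `Λ` whose
energy–momentum tensor `κ T̂ = Ĝ + Λ ĝ` is such that `Ω⁻² T̂` extends smoothly to infinity
(in particular any solution that is vacuum near infinity qualifies). As `dΩ ≠ 0` where `Ω = 0`,
the zero set of `Ω` is a hypersurface and is the boundary of the physical spacetime in `M`. -/
structure IsConformalCompletion (Λ : ℝ) (g : BilinField M) (Ω : M → ℝ) : Prop where
  metric : IsLorentzMetric g
  smooth : ContMDiff (𝓡 4) 𝓘(ℝ, ℝ) ∞ Ω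
  regular : ∀ x ∈ scri Ω, mfderiv (𝓡 4) 𝓘(ℝ, ℝ) Ω x ≠ 0
  field_eq : ∀ e ∈ atlas Coord M, ∃ T : MatField,
    (∀ i j, ContDiffOn ℝ ∞ (fun y => T y i j) e.target) ∧
    ∀ y ∈ e.target, 0 < Ω (e.symm y) → ∀ i j,
      einstein (physMetric g Ω e) i j y + Λ * physMetric g Ω e y i j
        = (Ω (e.symm y)) ^ 2 * T y i j

/-- `Ω` in the chart `e`. -/
def inChart (Ω : M → ℝ) (e : OpenPartialHomeomorph M Coord) : Coord → ℝ := fun y => Ω (e.symm y)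

/-- The divergence-free gauge: `∇_α N^α = 0` at infinity, where `N = dΩ`. -/
def IsDivergenceFree (g : BilinField M) (Ω : M → ℝ) : Prop :=
  ∀ e ∈ atlas Coord M, ∀ y ∈ e.target, e.symm y ∈ scri Ω →
    ∑ i, ∑ j, (comp g e y)⁻¹ i j * hessian (comp g e) (inChart Ω e) i j y = 0

/-- `(θ² g, θ Ω)` is a divergence-free gauge of the completion `(g, Ω)`. -/
structure IsDivergenceFreeGauge (g : BilinField M) (Ω θ : M → ℝ) : Prop where
  smooth : ContMDiff (𝓡 4) 𝓘(ℝ, ℝ) ∞ θ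
  pos : ∀ x, 0 < θ x
  divFree : IsDivergenceFree (rescale θ g) (fun x => θ x * Ω x)

/-- Components `d_{αβγδ} = Ω⁻¹ C_{αβγδ}` of the rescaled Weyl tensor in the chart `e`, extended
to infinity as the limit from the physical spacetime `{Ω > 0}`. -/
def rescaledWeyl (g : BilinField M) (Ω : M → ℝ) (e : OpenPartialHomeomorph M Coord)
    (y : Coord) (α β γ δ : Fin 4) : ℝ :=
  extendFrom {z | z ∈ e.target ∧ 0 < Ω (e.symm z)}
    (fun z => (Ω (e.symm z))⁻¹ * weyl (comp g e) α β γ δ z) y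

/-- The normal `N^α = g^{αβ} ∂_β Ω` in the chart `e`. -/
def normal (g : BilinField M) (Ω : M → ℝ) (e : OpenPartialHomeomorph M Coord)
    (y : Coord) : Fin 4 → ℝ :=
  gradVec (comp g e) (inChart Ω e) y

/-- The asymptotic radiant supermomentum `Π^α(N)` in the chart `e`. -/
def radiantSuperMomentum (g : BilinField M) (Ω : M → ℝ) (e : OpenPartialHomeomorph M Coord)
    (y : Coord) (α : Fin 4) : ℝ :=
  superMomentum (comp g e y) (rescaledWeyl g Ω e y) (normal g Ω e y) α

/-- Geroch's tensor `ρ_{ab}` on infinity, for a divergence-free gauge `(g, Ω)`. In such a gauge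
`∇_α N_β = 0` at infinity, so the Levi-Civita connection of `g` restricts to a connection `D` on
infinity. With `q_{ab}` the induced degenerate metric, `ρ` is the symmetric tensor on infinity with
`ρ_{ab} N^b = 0`, `q^{ab} ρ_{ab} = 𝓡` and `D_{[a} ρ_{b]c} = 0`, where `𝓡` is the scalar curvature
of the two-dimensional metric `q`, i.e. twice the curvature of `D` on a `q`-orthonormal pair.
The field `ρ` is given on `M`; only its restriction to vectors tangent to infinity matters. -/
structure IsGerochTensor (g : BilinField M) (Ω : M → ℝ) (ρ : BilinField M) : Prop where
  smooth : IsSmoothField ρ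
  symm : ∀ e ∈ atlas Coord M, ∀ y ∈ e.target, e.symm y ∈ scri Ω → ∀ X Y : Fin 4 → ℝ,
    IsTangent (inChart Ω e) y X → IsTangent (inChart Ω e) y Y →
      bil (comp ρ e y) X Y = bil (comp ρ e y) Y X
  transverse : ∀ e ∈ atlas Coord M, ∀ y ∈ e.target, e.symm y ∈ scri Ω → ∀ X : Fin 4 → ℝ,
    IsTangent (inChart Ω e) y X → bil (comp ρ e y) X (normal g Ω e y) = 0
  trace : ∀ e ∈ atlas Coord M, ∀ y ∈ e.target, e.symm y ∈ scri Ω → ∀ X Y : Fin 4 → ℝ,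
    IsTangent (inChart Ω e) y X → IsTangent (inChart Ω e) y Y →
    bil (comp g e y) X X = 1 → bil (comp g e y) Y Y = 1 → bil (comp g e y) X Y = 0 →
      bil (comp ρ e y) X X + bil (comp ρ e y) Y Y
        = 2 * ∑ l, ∑ k, ∑ i, ∑ j, riemann (comp g e) l k i j y * X l * Y k * X i * Y j
  curlFree : ∀ e ∈ atlas Coord M, ∀ y ∈ e.target, e.symm y ∈ scri Ω → ∀ X Y Z : Fin 4 → ℝ,
    IsTangent (inChart Ω e) y X → IsTangent (inChart Ω e) y Y → IsTangent (inChart Ω e) y Z →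
      ∑ i, ∑ j, ∑ k, (covDeriv (comp g e) (comp ρ e) i j k y
        - covDeriv (comp g e) (comp ρ e) j i k y) * X i * Y j * Z k = 0

/-- The News tensor `N_{ab} = S_{ab} - ρ_{ab}` evaluated on two vectors, in the chart `e`. -/
def news (g : BilinField M) (ρ : BilinField M) (e : OpenPartialHomeomorph M Coord)
    (y : Coord) (X Y : Fin 4 → ℝ) : ℝ :=
  bil (fun i j => schouten (comp g e) i j y - comp ρ e y i j) X Y

/-- The News tensor vanishes on `Δ`, as a tensor on infinity. -/
def NewsVanishesOn (g : BilinField M) (Ω : M → ℝ) (ρ : BilinField M) (Δ : Set M) : Prop :=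
  ∀ e ∈ atlas Coord M, ∀ y ∈ e.target, e.symm y ∈ Δ → ∀ X Y : Fin 4 → ℝ,
    IsTangent (inChart Ω e) y X → IsTangent (inChart Ω e) y Y → news g ρ e y X Y = 0

/-- The unit two-sphere. -/
abbrev S2 : Type := Metric.sphere (0 : EuclideanSpace ℝ (Fin 3)) 1

/-- The differential at `p` of the inclusion of the unit sphere into `ℝ³`. -/
def sphereDiff (p : S2) (v : TangentSpace (𝓡 2) p) : EuclideanSpace ℝ (Fin 3) :=
  mfderiv (𝓡 2) 𝓘(ℝ, EuclideanSpace ℝ (Fin 3))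
    (fun q : S2 => (q : EuclideanSpace ℝ (Fin 3))) p v

/-- `s` is a (spacelike, spherical) cut of infinity: an embedded two-sphere in infinity,
parametrised conformally by the round sphere. By uniformisation, every embedded two-sphere on
which `g` is positive definite has such a parametrisation. -/
structure IsCut (g : BilinField M) (Ω : M → ℝ) (s : S2 → M) : Prop where
  smooth : ContMDiff (𝓡 2) (𝓡 4) ∞ s
  injective : Function.Injective s
  mem_scri : ∀ p, s p ∈ scri Ω
  conformal : ∀ p : S2, ∃ c : ℝ, 0 < c ∧ ∀ v w : TangentSpace (𝓡 2) p,
    g (s p) (mfderiv (𝓡 2) (𝓡 4) s p v) (mfderiv (𝓡 2) (𝓡 4) s p w)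
      = c * inner ℝ (sphereDiff p v) (sphereDiff p w)

/-- `Δ` is an open portion of infinity made of complete cuts. -/
structure IsOpenPortion (g : BilinField M) (Ω : M → ℝ) (Δ : Set M) : Prop where
  isOpen : ∃ U : Set M, IsOpen U ∧ Δ = U ∩ scri Ω
  cuts : ∀ x ∈ Δ, ∃ s : S2 → M, IsCut g Ω s ∧ x ∈ range s ∧ range s ⊆ Δ

end Manifold

end NullInfinity

end

set_option maxSynthPendingDepth 8

noncomputable section

namespace NullInfinity

section

/-! ### Multilinear forms on the coordinate space -/

/-- The `i`-th coordinate functional. -/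
def dx (i : Fin 4) : Coord →L[ℝ] ℝ := EuclideanSpace.proj i

@[simp] lemma dx_apply (i : Fin 4) (X : Coord) : dx i X = X i := rfl

@[simp] lemma basisVec_apply (i j : Fin 4) : basisVec i j = if j = i then 1 else 0 := by
  simp [basisVec]

lemma sum_smul_basisVec (X : Coord) : ∑ i, X i • basisVec i = X := by
  ext j
  simp [Finset.sum_apply]

lemma clm_eq_sum {F : Type*} [NormedAddCommGroup F] [NormedSpace ℝ F] (f : Coord →L[ℝ] F)
    (X : Coord) : f X = ∑ i, X i • f (basisVec i) := by
  conv_lhs => rw [← sum_smul_basisVec X]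
  simp

lemma clm_ext {F : Type*} [NormedAddCommGroup F] [NormedSpace ℝ F] {f f' : Coord →L[ℝ] F}
    (h : ∀ i, f (basisVec i) = f' (basisVec i)) : f = f' := by
  ext1 X
  rw [clm_eq_sum f, clm_eq_sum f']
  simp [h]

/-- The bilinear form with given components. -/
def bilin (B : Fin 4 → Fin 4 → ℝ) : Coord →L[ℝ] Coord →L[ℝ] ℝ :=
  ∑ i, ∑ j, B i j • (dx i).smulRight (dx j)

lemma bilin_apply (B : Fin 4 → Fin 4 → ℝ) (X Y : Coord) :
    bilin B X Y = ∑ i, ∑ j, B i j * X i * Y j := by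
  simp [bilin, mul_assoc]

lemma bilin_eq_bil (B : Fin 4 → Fin 4 → ℝ) (X Y : Coord) : bilin B X Y = bil B X Y :=
  bilin_apply B X Y

@[simp] lemma bilin_basisVec (B : Fin 4 → Fin 4 → ℝ) (i j : Fin 4) :
    bilin B (basisVec i) (basisVec j) = B i j := by
  simp [bilin_apply]

/-- The four-linear form with given components. -/
def quadrilin (a : Fin 4 → Fin 4 → Fin 4 → Fin 4 → ℝ) :
    Coord →L[ℝ] Coord →L[ℝ] Coord →L[ℝ] Coord →L[ℝ] ℝ :=
  ∑ l, ∑ k, ∑ i, ∑ j, a l k i j •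
    (dx l).smulRight ((dx k).smulRight ((dx i).smulRight (dx j)))

lemma quadrilin_apply (a : Fin 4 → Fin 4 → Fin 4 → Fin 4 → ℝ) (L K I J : Coord) :
    quadrilin a L K I J = ∑ l, ∑ k, ∑ i, ∑ j, a l k i j * L l * K k * I i * J j := by
  simp [quadrilin, mul_assoc]

@[simp] lemma quadrilin_basisVec (a : Fin 4 → Fin 4 → Fin 4 → Fin 4 → ℝ) (l k i j : Fin 4) :
    quadrilin a (basisVec l) (basisVec k) (basisVec i) (basisVec j) = a l k i j := by
  simp [quadrilin_apply]

lemma IsLinearMap.eq_sum_basisVec {f : Coord → ℝ} (hf : IsLinearMap ℝ f) (X : Coord) :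
    f X = ∑ i, X i * f (basisVec i) := by
  conv_lhs => rw [← sum_smul_basisVec X]
  change hf.mk' f (∑ i, X i • basisVec i) = _
  simp

/-- A function of two vectors that is linear in each is recovered from its components. -/
lemma bilin_eq {f : Coord → Coord → ℝ} (h1 : ∀ J, IsLinearMap ℝ fun I => f I J)
    (h2 : ∀ I, IsLinearMap ℝ (f I)) (I J : Coord) :
    bilin (fun i j => f (basisVec i) (basisVec j)) I J = f I J := by
  rw [bilin_apply, IsLinearMap.eq_sum_basisVec (h1 J) I]
  refine Finset.sum_congr rfl fun i _ => ?_
  rw [IsLinearMap.eq_sum_basisVec (h2 _) J, Finset.mul_sum]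
  refine Finset.sum_congr rfl fun j _ => ?_
  ring

/-- A function of four vectors that is linear in each is recovered from its components. -/
lemma quadrilin_eq {f : Coord → Coord → Coord → Coord → ℝ}
    (h1 : ∀ K I J, IsLinearMap ℝ fun L => f L K I J)
    (h2 : ∀ L I J, IsLinearMap ℝ fun K => f L K I J)
    (h3 : ∀ L K J, IsLinearMap ℝ fun I => f L K I J)
    (h4 : ∀ L K I, IsLinearMap ℝ fun J => f L K I J) (L K I J : Coord) :
    quadrilin (fun l k i j => f (basisVec l) (basisVec k) (basisVec i) (basisVec j)) L K I J
      = f L K I J := by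
  rw [quadrilin_apply, IsLinearMap.eq_sum_basisVec (h1 K I J) L]
  refine Finset.sum_congr rfl fun l _ => ?_
  rw [IsLinearMap.eq_sum_basisVec (h2 _ I J) K, Finset.mul_sum]
  refine Finset.sum_congr rfl fun k _ => ?_
  rw [IsLinearMap.eq_sum_basisVec (h3 _ _ J) I, Finset.mul_sum, Finset.mul_sum]
  refine Finset.sum_congr rfl fun i _ => ?_
  rw [IsLinearMap.eq_sum_basisVec (h4 _ _ _) J, Finset.mul_sum, Finset.mul_sum, Finset.mul_sum]
  refine Finset.sum_congr rfl fun j _ => ?_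
  ring

/-- Two functions of three vectors that are linear in each and agree on basis vectors agree. -/
lemma trilinear_ext {f f' : Coord → Coord → Coord → ℝ}
    (h1 : ∀ K I, IsLinearMap ℝ fun L => f L K I) (h2 : ∀ L I, IsLinearMap ℝ fun K => f L K I)
    (h3 : ∀ L K, IsLinearMap ℝ fun I => f L K I)
    (h1' : ∀ K I, IsLinearMap ℝ fun L => f' L K I) (h2' : ∀ L I, IsLinearMap ℝ fun K => f' L K I)
    (h3' : ∀ L K, IsLinearMap ℝ fun I => f' L K I)
    (h : ∀ i j k, f (basisVec i) (basisVec j) (basisVec k)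
      = f' (basisVec i) (basisVec j) (basisVec k)) (X Y Z : Coord) : f X Y Z = f' X Y Z := by
  rw [IsLinearMap.eq_sum_basisVec (h1 Y Z) X, IsLinearMap.eq_sum_basisVec (h1' Y Z) X]
  refine Finset.sum_congr rfl fun i _ => ?_
  rw [IsLinearMap.eq_sum_basisVec (h2 _ Z) Y, IsLinearMap.eq_sum_basisVec (h2' _ Z) Y]
  congr 1
  refine Finset.sum_congr rfl fun j _ => ?_
  rw [IsLinearMap.eq_sum_basisVec (h3 _ _) Z, IsLinearMap.eq_sum_basisVec (h3' _ _) Z]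
  simp [h]

lemma contDiffOn_bilin {U : Set Coord} {B : Coord → Fin 4 → Fin 4 → ℝ}
    (h : ∀ i j, ContDiffOn ℝ ∞ (fun y => B y i j) U) : ContDiffOn ℝ ∞ (fun y => bilin (B y)) U :=
  ContDiffOn.sum fun i _ => ContDiffOn.sum fun j _ => (h i j).smul contDiffOn_const

lemma contDiffOn_quadrilin {U : Set Coord} {a : Coord → Fin 4 → Fin 4 → Fin 4 → Fin 4 → ℝ}
    (h : ∀ l k i j, ContDiffOn ℝ ∞ (fun y => a y l k i j) U) :
    ContDiffOn ℝ ∞ (fun y => quadrilin (a y)) U :=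
  ContDiffOn.sum fun l _ => ContDiffOn.sum fun k _ => ContDiffOn.sum fun i _ =>
    ContDiffOn.sum fun j _ => (h l k i j).smul contDiffOn_const

/-- Differentiating a field of linear maps commutes with evaluation at a fixed vector. -/
lemma fderiv_clm_eval {E F G : Type*} [NormedAddCommGroup E] [NormedSpace ℝ E]
    [NormedAddCommGroup F] [NormedSpace ℝ F] [NormedAddCommGroup G] [NormedSpace ℝ G]
    {T : E → F →L[ℝ] G} {y : E} (hT : DifferentiableAt ℝ T y) (v : F) (W : E) :
    fderiv ℝ (fun z => T z v) y W = fderiv ℝ T y W v := by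
  rw [fderiv_clm_apply hT (differentiableAt_const v)]
  simp

lemma fderiv_clm_eval₂ {E F F' G : Type*} [NormedAddCommGroup E] [NormedSpace ℝ E]
    [NormedAddCommGroup F] [NormedSpace ℝ F] [NormedAddCommGroup F'] [NormedSpace ℝ F']
    [NormedAddCommGroup G] [NormedSpace ℝ G]
    {T : E → F →L[ℝ] F' →L[ℝ] G} {y : E} (hT : DifferentiableAt ℝ T y) (v : F) (v' : F') (W : E) :
    fderiv ℝ (fun z => T z v v') y W = fderiv ℝ T y W v v' := by
  rw [fderiv_clm_eval (hT.clm_apply (differentiableAt_const v)), fderiv_clm_eval hT]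

lemma smoothAt {F : Type*} [NormedAddCommGroup F] [NormedSpace ℝ F] {f : Coord → F}
    {U : Set Coord} (hU : IsOpen U) (hf : ContDiffOn ℝ ∞ f U) {y : Coord} (hy : y ∈ U) :
    ContDiffAt ℝ ∞ f y := hf.contDiffAt (hU.mem_nhds hy)

lemma diffAt {F : Type*} [NormedAddCommGroup F] [NormedSpace ℝ F] {f : Coord → F}
    {U : Set Coord} (hU : IsOpen U) (hf : ContDiffOn ℝ ∞ f U) {y : Coord} (hy : y ∈ U) :
    DifferentiableAt ℝ f y := (smoothAt hU hf hy).differentiableAt (by simp)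

lemma contDiffOn_fderiv {F : Type*} [NormedAddCommGroup F] [NormedSpace ℝ F] {f : Coord → F}
    {U : Set Coord} (hU : IsOpen U) (hf : ContDiffOn ℝ ∞ f U) :
    ContDiffOn ℝ ∞ (fderiv ℝ f) U := hf.fderiv_of_isOpen hU (by simp)

/-- Second derivatives commute. -/
lemma fderiv_fderiv_comm {F : Type*} [NormedAddCommGroup F] [NormedSpace ℝ F] {f : Coord → F}
    {U : Set Coord} (hU : IsOpen U) (hf : ContDiffOn ℝ ∞ f U) {y : Coord} (hy : y ∈ U)
    (X Y : Coord) : fderiv ℝ (fderiv ℝ f) y X Y = fderiv ℝ (fderiv ℝ f) y Y X :=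
  (((smoothAt hU hf hy).isSymmSndFDerivAt
    (by simpa using (WithTop.coe_le_coe.2 (le_top (a := (2 : ℕ∞)))))) X Y)

lemma contDiffOn_pd {f : Coord → ℝ} {U : Set Coord} (hU : IsOpen U) (hf : ContDiffOn ℝ ∞ f U)
    (i : Fin 4) : ContDiffOn ℝ ∞ (pd i f) U :=
  (contDiffOn_fderiv hU hf).clm_apply contDiffOn_const

/-- Two functions that agree on an open set have the same derivative there. -/
lemma fderiv_congr_on {F : Type*} [NormedAddCommGroup F] [NormedSpace ℝ F] {f f' : Coord → F}
    {U : Set Coord} (hU : IsOpen U) (h : ∀ z ∈ U, f z = f' z) {y : Coord} (hy : y ∈ U) :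
    fderiv ℝ f y = fderiv ℝ f' y :=
  Filter.EventuallyEq.fderiv_eq (Filter.eventuallyEq_of_mem (hU.mem_nhds hy) h)

end

section

/-! ### The Levi-Civita connection and its curvature on an open set of coordinates -/

/-- `G` is a smooth nondegenerate metric on the open set `U`. -/
structure MetricOn (G : MatField) (U : Set Coord) : Prop where
  isOpen : IsOpen U
  smooth : ∀ i j, ContDiffOn ℝ ∞ (fun y => G y i j) U
  symm : ∀ y ∈ U, ∀ i j, G y i j = G y j i
  det : ∀ y ∈ U, IsUnit (G y).det

/-- The metric as a field of bilinear forms. -/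
def met (G : MatField) (y : Coord) : Coord →L[ℝ] Coord →L[ℝ] ℝ :=
  bilin fun i j => G y i j

lemma met_apply (G : MatField) (y X Y : Coord) :
    met G y X Y = ∑ i, ∑ j, G y i j * X i * Y j := bilin_apply _ _ _

@[simp] lemma met_basisVec (G : MatField) (y : Coord) (i j : Fin 4) :
    met G y (basisVec i) (basisVec j) = G y i j := bilin_basisVec _ _ _

/-- The Christoffel symbols as a field of bilinear maps. -/
def gam (G : MatField) (y : Coord) : Coord →L[ℝ] Coord →L[ℝ] Coord :=
  ∑ k, ∑ i, ∑ j, christoffel G k i j y • (dx i).smulRight ((dx j).smulRight (basisVec k))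

/-- The composition `(X, Y) ↦ (Z ↦ Γ(X, Γ(Y, Z)))`. -/
def gamGam (A : Coord →L[ℝ] Coord →L[ℝ] Coord) : Coord →L[ℝ] Coord →L[ℝ] Coord →L[ℝ] Coord :=
  ((ContinuousLinearMap.compL ℝ Coord (Coord →L[ℝ] Coord) (Coord →L[ℝ] Coord)).flip A).comp
    ((ContinuousLinearMap.compL ℝ Coord Coord Coord).comp A)

/-- The curvature operator `R(X, Y) Z`. -/
def curv (G : MatField) (y : Coord) : Coord →L[ℝ] Coord →L[ℝ] Coord →L[ℝ] Coord :=
  fderiv ℝ (gam G) y - (fderiv ℝ (gam G) y).flip + gamGam (gam G y) - (gamGam (gam G y)).flip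

lemma curv_apply (G : MatField) (y X Y Z : Coord) :
    curv G y X Y Z = fderiv ℝ (gam G) y X Y Z - fderiv ℝ (gam G) y Y X Z
      + gam G y X (gam G y Y Z) - gam G y Y (gam G y X Z) := rfl

lemma gam_basisVec (G : MatField) (y : Coord) (i j k : Fin 4) :
    gam G y (basisVec i) (basisVec j) k = christoffel G k i j y := by
  simp [gam]

variable {G : MatField} {U : Set Coord} {y : Coord}

lemma MetricOn.contDiffOn_met (h : MetricOn G U) : ContDiffOn ℝ ∞ (met G) U :=
  contDiffOn_bilin h.smooth

lemma met_symm (h : MetricOn G U) (hy : y ∈ U) (X Y : Coord) : met G y X Y = met G y Y X := by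
  simp only [met_apply]
  rw [Finset.sum_comm]
  refine Finset.sum_congr rfl fun i _ => Finset.sum_congr rfl fun j _ => ?_
  rw [h.symm y hy]; ring

lemma contDiffOn_det (h : MetricOn G U) : ContDiffOn ℝ ∞ (fun y => (G y).det) U := by
  simp only [Matrix.det_apply]
  exact ContDiffOn.sum fun σ _ => (contDiffOn_prod fun i _ => h.smooth _ _).const_smul _

lemma contDiffOn_adjugate (h : MetricOn G U) (i j : Fin 4) :
    ContDiffOn ℝ ∞ (fun y => (G y).adjugate i j) U := by
  simp only [Matrix.adjugate_apply, Matrix.det_apply]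
  refine ContDiffOn.sum fun σ _ => (contDiffOn_prod fun k _ => ?_).const_smul _
  by_cases hk : σ k = j
  · simp only [Matrix.updateRow_apply, hk, if_true]; exact contDiffOn_const
  · simp only [Matrix.updateRow_apply, hk, if_false]; exact h.smooth _ _

lemma contDiffOn_inv (h : MetricOn G U) (i j : Fin 4) :
    ContDiffOn ℝ ∞ (fun y => (G y)⁻¹ i j) U := by
  have := ((contDiffOn_det h).inv fun y hy => (h.det y hy).ne_zero).mul (contDiffOn_adjugate h i j)
  refine this.congr fun y hy => ?_
  simp [Matrix.inv_def]

lemma contDiffOn_christoffel (h : MetricOn G U) (k i j : Fin 4) :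
    ContDiffOn ℝ ∞ (christoffel G k i j) U :=
  contDiffOn_const.mul (ContDiffOn.sum fun l _ => (contDiffOn_inv h k l).mul
    (((contDiffOn_pd h.isOpen (h.smooth l j) i).add (contDiffOn_pd h.isOpen (h.smooth l i) j)).sub
      (contDiffOn_pd h.isOpen (h.smooth i j) l)))

lemma contDiffOn_gam (h : MetricOn G U) : ContDiffOn ℝ ∞ (gam G) U :=
  ContDiffOn.sum fun k _ => ContDiffOn.sum fun i _ => ContDiffOn.sum fun j _ =>
    (contDiffOn_christoffel h k i j).smul contDiffOn_const

lemma christoffel_symm (h : MetricOn G U) (hy : y ∈ U) (k i j : Fin 4) :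
    christoffel G k i j y = christoffel G k j i y := by
  have : ∀ l, pd l (fun z => G z i j) y = pd l (fun z => G z j i) y := fun l => by
    unfold pd
    rw [fderiv_congr_on h.isOpen (fun z hz => h.symm z hz i j) hy]
  simp only [christoffel, this]
  congr 1
  refine Finset.sum_congr rfl fun l _ => ?_
  ring

lemma gam_symm (h : MetricOn G U) (hy : y ∈ U) (X Y : Coord) : gam G y X Y = gam G y Y X := by
  have : gam G y = (gam G y).flip := by
    refine clm_ext fun i => clm_ext fun j => ?_
    ext k
    simp only [ContinuousLinearMap.flip_apply, gam_basisVec]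
    exact christoffel_symm h hy k i j
  exact DFunLike.congr_fun (DFunLike.congr_fun this X) Y

lemma fderiv_met_basisVec (h : MetricOn G U) (hy : y ∈ U) (l i j : Fin 4) :
    fderiv ℝ (met G) y (basisVec l) (basisVec i) (basisVec j) = pd l (fun z => G z i j) y := by
  rw [← fderiv_clm_eval₂ (diffAt h.isOpen h.contDiffOn_met hy)]
  simp [pd]

lemma inv_mul_met (h : MetricOn G U) (hy : y ∈ U) (k m : Fin 4) :
    ∑ l, G y k l * (G y)⁻¹ l m = if k = m then 1 else 0 := by
  have := congrFun (congrFun (Matrix.mul_nonsing_inv (G y) (h.det y hy)) k) m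
  simpa [Matrix.mul_apply, Matrix.one_apply] using this

/-- Koszul's formula for coordinate fields. -/
lemma koszul (h : MetricOn G U) (hy : y ∈ U) (X Y Z : Coord) :
    2 * met G y (gam G y X Y) Z = fderiv ℝ (met G) y X Y Z + fderiv ℝ (met G) y Y X Z
      - fderiv ℝ (met G) y Z X Y := by
  refine trilinear_ext (f := fun X Y Z => 2 * met G y (gam G y X Y) Z)
    (f' := fun X Y Z => fderiv ℝ (met G) y X Y Z + fderiv ℝ (met G) y Y X Z
      - fderiv ℝ (met G) y Z X Y) ?_ ?_ ?_ ?_ ?_ ?_ ?_ X Y Z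
  iterate 6 (intro _ _; constructor <;> intros <;> simp <;> ring)
  intro i j k
  simp only [fderiv_met_basisVec h hy]
  rw [met_symm h hy]
  simp only [met_apply, gam_basisVec]
  rw [Finset.sum_eq_single k (by intro b _ hb; simp [hb]) (by simp)]
  simp only [christoffel, basisVec_apply, if_true, mul_one]
  have : ∀ x, G y k x * (1 / 2 * ∑ l, (G y)⁻¹ x l * (pd i (fun z => G z l j) y
      + pd j (fun z => G z l i) y - pd l (fun z => G z i j) y))
      = ∑ l, (1 / 2) * (G y k x * (G y)⁻¹ x l) * (pd i (fun z => G z l j) y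
      + pd j (fun z => G z l i) y - pd l (fun z => G z i j) y) := by
    intro x
    rw [Finset.mul_sum, Finset.mul_sum]
    exact Finset.sum_congr rfl fun l _ => by ring
  simp only [this]
  rw [Finset.sum_comm]
  simp only [← Finset.sum_mul, ← Finset.mul_sum, inv_mul_met h hy]
  have e : ∀ l a b, pd l (fun z => G z a b) y = pd l (fun z => G z b a) y := fun l a b => by
    unfold pd
    rw [fderiv_congr_on h.isOpen (fun z hz => h.symm z hz a b) hy]
  simp [e _ k]

/-- The Levi-Civita connection is metric. -/
lemma fderiv_met (h : MetricOn G U) (hy : y ∈ U) (X Y Z : Coord) :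
    fderiv ℝ (met G) y X Y Z = met G y (gam G y X Y) Z + met G y Y (gam G y X Z) := by
  have h1 := koszul h hy X Y Z
  have h2 := koszul h hy X Z Y
  have s : ∀ A B C, fderiv ℝ (met G) y A B C = fderiv ℝ (met G) y A C B := by
    intro A B C
    rw [← fderiv_clm_eval₂ (diffAt h.isOpen h.contDiffOn_met hy),
      ← fderiv_clm_eval₂ (diffAt h.isOpen h.contDiffOn_met hy),
      fderiv_congr_on h.isOpen (fun z hz => met_symm h hz B C) hy]
  rw [met_symm h hy Y]
  have := s X Y Z
  have := s Y X Z
  have := s Z X Y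
  linarith

lemma nondegenerate (h : MetricOn G U) (hy : y ∈ U) {X : Coord} (hX : ∀ Z, met G y X Z = 0) :
    X = 0 := by
  have : Matrix.vecMul X.ofLp (G y) = 0 := by
    funext j
    have := hX (basisVec j)
    simp only [met_apply] at this
    change ∑ i, X i * G y i j = 0
    rw [← this]
    refine Finset.sum_congr rfl fun i _ => ?_
    simp [mul_comm]
  have h2 : X.ofLp = 0 := by
    have := congrArg (fun v => Matrix.vecMul v (G y)⁻¹) this
    simpa [Matrix.vecMul_vecMul, Matrix.mul_nonsing_inv _ (h.det y hy)] using this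
  ext i
  simpa using congrFun h2 i

end

section

/-- The Ricci tensor as a field of bilinear forms. -/
def ric (G : MatField) (y : Coord) : Coord →L[ℝ] Coord →L[ℝ] ℝ := bilin fun k j => ricci G k j y

/-- The Schouten tensor as a field of bilinear forms. -/
def sch (G : MatField) (y : Coord) : Coord →L[ℝ] Coord →L[ℝ] ℝ :=
  bilin fun k j => schouten G k j y

/-- The Weyl tensor as a field of four-linear forms. -/
def wey (G : MatField) (y : Coord) : Coord →L[ℝ] Coord →L[ℝ] Coord →L[ℝ] Coord →L[ℝ] ℝ :=
  quadrilin fun l k i j => weyl G l k i j y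

/-- The metric trace of a bilinear form. -/
def trg (h : Matrix (Fin 4) (Fin 4) ℝ) (T : Coord → Coord → ℝ) : ℝ :=
  ∑ i, ∑ j, h⁻¹ i j * T (basisVec i) (basisVec j)

variable {G : MatField} {U : Set Coord} {y : Coord}

lemma fderiv_gam_basisVec (h : MetricOn G U) (hy : y ∈ U) (l i j k : Fin 4) :
    fderiv ℝ (gam G) y (basisVec l) (basisVec i) (basisVec j) k
      = pd l (christoffel G k i j) y := by
  rw [← fderiv_clm_eval₂ (diffAt h.isOpen (contDiffOn_gam h) hy)]
  have hd : DifferentiableAt ℝ (fun z => gam G z (basisVec i) (basisVec j)) y :=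
    ((diffAt h.isOpen (contDiffOn_gam h) hy).clm_apply (differentiableAt_const _)).clm_apply
      (differentiableAt_const _)
  have : pd l (christoffel G k i j) y
      = fderiv ℝ (fun z => dx k (gam G z (basisVec i) (basisVec j))) y (basisVec l) := by
    simp only [dx_apply, gam_basisVec]; rfl
  rw [this, show fderiv ℝ (fun z => dx k (gam G z (basisVec i) (basisVec j))) y = _ from
    ((dx k).hasFDerivAt.comp y hd.hasFDerivAt).fderiv]
  simp

lemma curv_basisVec (h : MetricOn G U) (hy : y ∈ U) (l k i j : Fin 4) :
    curv G y (basisVec i) (basisVec j) (basisVec k) l = riemannUp G l k i j y := by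
  have e : ∀ i (v : Coord), gam G y (basisVec i) v l = ∑ m, christoffel G l i m y * v m := by
    intro i v
    rw [clm_eq_sum (gam G y (basisVec i)) v]
    simp [gam_basisVec, mul_comm]
  rw [curv_apply]
  simp only [PiLp.add_apply, PiLp.sub_apply, fderiv_gam_basisVec h hy, e, gam_basisVec, riemannUp,
    Finset.sum_sub_distrib]
  ring

lemma met_curv_basisVec (h : MetricOn G U) (hy : y ∈ U) (l k i j : Fin 4) :
    met G y (basisVec l) (curv G y (basisVec i) (basisVec j) (basisVec k)) = riemann G l k i j y := by
  rw [met_apply, Finset.sum_eq_single l (by intro b _ hb; simp [hb]) (by simp)]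
  simp [riemann, curv_basisVec h hy]

lemma wey_apply (h : MetricOn G U) (hy : y ∈ U) (L K I J : Coord) :
    wey G y L K I J = met G y L (curv G y I J K)
      - (1 / 2) * (met G y L I * sch G y K J - met G y L J * sch G y K I
        + met G y K J * sch G y L I - met G y K I * sch G y L J) := by
  rw [← quadrilin_eq (f := fun L K I J => met G y L (curv G y I J K)
      - (1 / 2) * (met G y L I * sch G y K J - met G y L J * sch G y K I
        + met G y K J * sch G y L I - met G y K I * sch G y L J))]
  · simp only [wey, weyl, met_curv_basisVec h hy, met_basisVec, sch, bilin_basisVec]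
  all_goals intro _ _ _; constructor <;> intros <;> simp <;> ring

lemma ric_apply (h : MetricOn G U) (hy : y ∈ U) (K J : Coord) :
    ric G y K J = ∑ i, curv G y (basisVec i) J K i := by
  rw [← bilin_eq (f := fun K J => ∑ i, curv G y (basisVec i) J K i)]
  · simp only [ric, ricci, curv_basisVec h hy]
  all_goals
    intro _
    constructor <;> intros <;> simp [Finset.sum_add_distrib, Finset.mul_sum]

lemma sch_apply (G : MatField) (y K J : Coord) :
    sch G y K J = ric G y K J - (1 / 6) * scalarCurv G y * met G y K J := by
  simp only [sch, ric, met, bilin_apply, schouten, Finset.mul_sum, ← Finset.sum_sub_distrib]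
  refine Finset.sum_congr rfl fun i _ => Finset.sum_congr rfl fun j _ => ?_
  ring

lemma scalarCurv_eq (G : MatField) (y : Coord) :
    scalarCurv G y = trg (G y) fun X Y => ric G y X Y := by
  simp [scalarCurv, trg, ric]

lemma inv_symm (h : MetricOn G U) (hy : y ∈ U) (i j : Fin 4) : (G y)⁻¹ i j = (G y)⁻¹ j i := by
  have : (G y).transpose = G y := by
    ext i j; simp [Matrix.transpose_apply, h.symm y hy i j]
  conv_lhs => rw [← this, ← Matrix.transpose_nonsing_inv, Matrix.transpose_apply]

/-- Raising an index undoes lowering it. -/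
lemma sum_inv_met (h : MetricOn G U) (hy : y ∈ U) (j : Fin 4) (v : Coord) :
    ∑ i, (G y)⁻¹ i j * met G y (basisVec i) v = v j := by
  have e : ∀ i, met G y (basisVec i) v = ∑ k, G y i k * v k := by
    intro i
    rw [met_apply, Finset.sum_eq_single i (by intro b _ hb; simp [hb]) (by simp)]
    simp
  simp only [e, Finset.mul_sum]
  rw [Finset.sum_comm]
  have : ∀ k, ∑ i, (G y)⁻¹ i j * (G y i k * v k) = (if k = j then 1 else 0) * v k := by
    intro k
    rw [← inv_mul_met h hy k j, Finset.sum_mul]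
    refine Finset.sum_congr rfl fun i _ => ?_
    rw [h.symm y hy i k]; ring
  simp [this]

lemma trg_met_left (h : MetricOn G U) (hy : y ∈ U) (v : Coord) (q : Coord →L[ℝ] ℝ) :
    trg (G y) (fun X Y => met G y X v * q Y) = q v := by
  rw [trg, Finset.sum_comm, clm_eq_sum q v]
  refine Finset.sum_congr rfl fun j _ => ?_
  rw [← sum_inv_met h hy j v, Finset.sum_smul]
  refine Finset.sum_congr rfl fun i _ => ?_
  simp only [smul_eq_mul]; ring

lemma trg_comm (h : MetricOn G U) (hy : y ∈ U) (T : Coord → Coord → ℝ) :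
    trg (G y) T = trg (G y) fun X Y => T Y X := by
  rw [trg, Finset.sum_comm, trg]
  refine Finset.sum_congr rfl fun j _ => Finset.sum_congr rfl fun i _ => ?_
  rw [inv_symm h hy]

lemma trg_curv (h : MetricOn G U) (hy : y ∈ U) (K J : Coord) :
    trg (G y) (fun X Y => met G y X (curv G y Y J K)) = ric G y K J := by
  rw [ric_apply h hy, trg, Finset.sum_comm]
  exact Finset.sum_congr rfl fun j _ => sum_inv_met h hy j _

lemma trg_add (h : Matrix (Fin 4) (Fin 4) ℝ) (T T' : Coord → Coord → ℝ) :
    trg h (fun X Y => T X Y + T' X Y) = trg h T + trg h T' := by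
  simp [trg, mul_add, Finset.sum_add_distrib]

lemma trg_sub (h : Matrix (Fin 4) (Fin 4) ℝ) (T T' : Coord → Coord → ℝ) :
    trg h (fun X Y => T X Y - T' X Y) = trg h T - trg h T' := by
  simp [trg, mul_sub, Finset.sum_sub_distrib]

lemma trg_smul (h : Matrix (Fin 4) (Fin 4) ℝ) (c : ℝ) (T : Coord → Coord → ℝ) :
    trg h (fun X Y => c * T X Y) = c * trg h T := by
  simp only [trg, Finset.mul_sum]
  refine Finset.sum_congr rfl fun i _ => Finset.sum_congr rfl fun j _ => by ring

lemma trg_met (h : MetricOn G U) (hy : y ∈ U) : trg (G y) (fun X Y => met G y X Y) = 4 := by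
  rw [trg]
  have : ∀ i, ∑ j, (G y)⁻¹ i j * met G y (basisVec i) (basisVec j)
      = ∑ j, (G y)⁻¹ j i * met G y (basisVec j) (basisVec i) := by
    intro i
    refine Finset.sum_congr rfl fun j _ => ?_
    rw [inv_symm h hy, met_symm h hy]
  simp only [this, sum_inv_met h hy]
  simp

/-! ### Algebraic symmetries -/

lemma curv_antisymm (G : MatField) (y X Y Z : Coord) : curv G y X Y Z = - curv G y Y X Z := by
  simp only [curv_apply]; abel

lemma fderiv_gam_symm (h : MetricOn G U) (hy : y ∈ U) (W X Y : Coord) :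
    fderiv ℝ (gam G) y W X Y = fderiv ℝ (gam G) y W Y X := by
  rw [← fderiv_clm_eval₂ (diffAt h.isOpen (contDiffOn_gam h) hy),
    ← fderiv_clm_eval₂ (diffAt h.isOpen (contDiffOn_gam h) hy),
    fderiv_congr_on h.isOpen (fun z hz => gam_symm h hz X Y) hy]

lemma curv_cyclic (h : MetricOn G U) (hy : y ∈ U) (X Y Z : Coord) :
    curv G y X Y Z + curv G y Y Z X + curv G y Z X Y = 0 := by
  simp only [curv_apply]
  rw [fderiv_gam_symm h hy X Z Y, fderiv_gam_symm h hy Y X Z, fderiv_gam_symm h hy Z Y X,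
    gam_symm h hy Z Y, gam_symm h hy X Z, gam_symm h hy Y X]
  abel

lemma fderiv_fderiv_met (h : MetricOn G U) (hy : y ∈ U) (X Y Z W : Coord) :
    fderiv ℝ (fderiv ℝ (met G)) y X Y Z W
      = fderiv ℝ (met G) y X (gam G y Y Z) W + met G y (fderiv ℝ (gam G) y X Y Z) W
        + fderiv ℝ (met G) y X Z (gam G y Y W) + met G y Z (fderiv ℝ (gam G) y X Y W) := by
  have hm := diffAt h.isOpen h.contDiffOn_met hy
  have hg := diffAt h.isOpen (contDiffOn_gam h) hy
  have hm2 := diffAt h.isOpen (contDiffOn_fderiv h.isOpen h.contDiffOn_met) hy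
  have e1 : fderiv ℝ (fun z => fderiv ℝ (met G) z Y Z W) y X
      = fderiv ℝ (fderiv ℝ (met G)) y X Y Z W := by
    rw [fderiv_clm_eval₂ (T := fun z => fderiv ℝ (met G) z Y)
      (hm2.clm_apply (differentiableAt_const _)), fderiv_clm_eval hm2]
  have hg' : ∀ A B, HasFDerivAt (fun z => gam G z A B)
      (((fderiv ℝ (gam G) y).flip A).flip B) y := by
    intro A B
    have := (hg.hasFDerivAt.clm_apply (hasFDerivAt_const A y)).clm_apply (hasFDerivAt_const B y)
    refine this.congr_fderiv ?_
    ext1 V; simp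
  have e2 : fderiv ℝ (fun z => met G z (gam G z Y Z) W + met G z Z (gam G z Y W)) y X = _ :=
    congrArg (· X) (((hm.hasFDerivAt.clm_apply (hg' Y Z)).clm_apply (hasFDerivAt_const W y)).add
      ((hm.hasFDerivAt.clm_apply (hasFDerivAt_const Z y)).clm_apply (hg' Y W))).fderiv
  rw [← e1, fderiv_congr_on h.isOpen (fun z hz => fderiv_met h hz Y Z W) hy, e2]
  simp
  ring

lemma met_curv_antisymm (h : MetricOn G U) (hy : y ∈ U) (X Y Z W : Coord) :
    met G y W (curv G y X Y Z) = - met G y Z (curv G y X Y W) := by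
  have h1 := fderiv_fderiv_met h hy X Y Z W
  have h2 := fderiv_fderiv_met h hy Y X Z W
  rw [fderiv_fderiv_comm h.isOpen h.contDiffOn_met hy X Y] at h1
  rw [met_symm h hy W]
  simp only [curv_apply, fderiv_met h hy, map_add, map_sub, add_apply,
    sub_apply] at h1 h2 ⊢
  linarith

lemma met_curv_pair (h : MetricOn G U) (hy : y ∈ U) (L K I J : Coord) :
    met G y L (curv G y I J K) = met G y I (curv G y L K J) := by
  have c : ∀ A B C D, met G y A (curv G y B C D) + met G y A (curv G y C D B)
      + met G y A (curv G y D B C) = 0 := by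
    intro A B C D
    have := congrArg (met G y A) (curv_cyclic h hy B C D)
    simpa using this
  have a : ∀ A B C D, met G y A (curv G y B C D) = - met G y A (curv G y C B D) := by
    intro A B C D
    rw [curv_antisymm]; simp
  have s := met_curv_antisymm h hy
  linarith [c L I J K, c I J K L, c J K L I, c K L I J, a L I J K, a L J K I, a L K I J, a I J K L,
    a I K L J, a I L J K, a J K L I, a J L I K, a J I K L, a K L I J, a K I J L, a K J L I,
    s I J K L, s J K I L, s K I J L, s J K L I, s K L J I, s L J K I, s K L I J, s L I K J,
    s I K L J, s L I J K, s I J L K, s J L I K]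

lemma ric_symm (h : MetricOn G U) (hy : y ∈ U) (K J : Coord) : ric G y K J = ric G y J K := by
  rw [← trg_curv h hy, ← trg_curv h hy, trg_comm h hy]
  congr 1
  funext X Y
  rw [met_curv_pair h hy, met_curv_antisymm h hy]

lemma sch_symm (h : MetricOn G U) (hy : y ∈ U) (K J : Coord) : sch G y K J = sch G y J K := by
  rw [sch_apply, sch_apply, ric_symm h hy, met_symm h hy]

/-! ### Symmetries of the Weyl tensor -/

lemma wey_antisymm_right (h : MetricOn G U) (hy : y ∈ U) (L K I J : Coord) :
    wey G y L K I J = - wey G y L K J I := by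
  rw [wey_apply h hy, wey_apply h hy, curv_antisymm]
  simp only [map_neg]
  ring

lemma wey_pair (h : MetricOn G U) (hy : y ∈ U) (L K I J : Coord) :
    wey G y L K I J = wey G y I J L K := by
  rw [wey_apply h hy, wey_apply h hy, met_curv_pair h hy, met_symm h hy I L, met_symm h hy I K,
    met_symm h hy J K, met_symm h hy J L, sch_symm h hy J K, sch_symm h hy J L, sch_symm h hy I K,
    sch_symm h hy I L]
  ring

lemma wey_cyclic (h : MetricOn G U) (hy : y ∈ U) (L K I J : Coord) :
    wey G y L K I J + wey G y L I J K + wey G y L J K I = 0 := by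
  have := congrArg (met G y L) (curv_cyclic h hy I J K)
  simp only [map_add, map_zero] at this
  rw [wey_apply h hy, wey_apply h hy, wey_apply h hy, met_symm h hy J I, met_symm h hy K J,
    met_symm h hy K I, sch_symm h hy J I, sch_symm h hy K J, sch_symm h hy K I]
  linarith

lemma trg_sch (h : MetricOn G U) (hy : y ∈ U) :
    trg (G y) (fun X Y => sch G y X Y) = scalarCurv G y / 3 := by
  simp only [sch_apply, trg_sub, trg_smul, ← scalarCurv_eq, trg_met h hy]
  ring

lemma wey_trace (h : MetricOn G U) (hy : y ∈ U) (K J : Coord) :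
    trg (G y) (fun X Y => wey G y X K Y J) = 0 := by
  simp only [wey_apply h hy, trg_sub, trg_smul, trg_add, trg_curv h hy]
  have e1 : trg (G y) (fun X Y => met G y X Y * sch G y K J) = 4 * sch G y K J := by
    simp only [mul_comm _ (sch G y K J), trg_smul, trg_met h hy]
  have e2 : trg (G y) (fun X Y => met G y X J * sch G y K Y) = sch G y K J :=
    trg_met_left h hy J (sch G y K)
  have e3 : trg (G y) (fun X Y => met G y K Y * sch G y X J) = sch G y K J := by
    rw [trg_comm h hy]
    simp only [met_symm h hy K, sch_symm h hy _ J]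
    rw [trg_met_left h hy K (sch G y J), sch_symm h hy]
  rw [e1, e2, e3, trg_sch h hy, sch_apply]
  ring

/-! ### Smoothness -/

lemma contDiffOn_riemannUp (h : MetricOn G U) (l k i j : Fin 4) :
    ContDiffOn ℝ ∞ (riemannUp G l k i j) U :=
  ((contDiffOn_pd h.isOpen (contDiffOn_christoffel h l j k) i).sub
    (contDiffOn_pd h.isOpen (contDiffOn_christoffel h l i k) j)).add
    (ContDiffOn.sum fun m _ =>
      ((contDiffOn_christoffel h l i m).mul (contDiffOn_christoffel h m j k)).sub
      ((contDiffOn_christoffel h l j m).mul (contDiffOn_christoffel h m i k)))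

lemma contDiffOn_ricci (h : MetricOn G U) (k j : Fin 4) : ContDiffOn ℝ ∞ (ricci G k j) U :=
  ContDiffOn.sum fun i _ => contDiffOn_riemannUp h i k i j

lemma contDiffOn_scalarCurv (h : MetricOn G U) : ContDiffOn ℝ ∞ (scalarCurv G) U :=
  ContDiffOn.sum fun i _ => ContDiffOn.sum fun j _ =>
    (contDiffOn_inv h i j).mul (contDiffOn_ricci h i j)

lemma contDiffOn_schouten (h : MetricOn G U) (k j : Fin 4) : ContDiffOn ℝ ∞ (schouten G k j) U :=
  (contDiffOn_ricci h k j).sub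
    ((contDiffOn_const.mul (contDiffOn_scalarCurv h)).mul (h.smooth k j))

lemma contDiffOn_sch (h : MetricOn G U) : ContDiffOn ℝ ∞ (sch G) U :=
  contDiffOn_bilin fun k j => contDiffOn_schouten h k j

lemma contDiffOn_weyl (h : MetricOn G U) (l k i j : Fin 4) : ContDiffOn ℝ ∞ (weyl G l k i j) U :=
  (ContDiffOn.sum fun m _ => (h.smooth l m).mul (contDiffOn_riemannUp h m k i j)).sub
    (contDiffOn_const.mul (((((h.smooth l i).mul (contDiffOn_schouten h k j)).sub
      ((h.smooth l j).mul (contDiffOn_schouten h k i))).add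
      ((h.smooth k j).mul (contDiffOn_schouten h l i))).sub
      ((h.smooth k i).mul (contDiffOn_schouten h l j))))

lemma contDiffOn_wey (h : MetricOn G U) : ContDiffOn ℝ ∞ (wey G) U :=
  contDiffOn_quadrilin fun l k i j => contDiffOn_weyl h l k i j

lemma contDiffOn_gamGam (h : MetricOn G U) : ContDiffOn ℝ ∞ (fun y => gamGam (gam G y)) U := by
  unfold gamGam
  exact ContDiffOn.clm_comp (contDiffOn_const.clm_apply (contDiffOn_gam h))
    (contDiffOn_const.clm_comp (contDiffOn_gam h))

lemma contDiffOn_flip {F F' G' : Type*} [NormedAddCommGroup F] [NormedSpace ℝ F]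
    [NormedAddCommGroup F'] [NormedSpace ℝ F'] [NormedAddCommGroup G'] [NormedSpace ℝ G']
    {T : Coord → F →L[ℝ] F' →L[ℝ] G'} (hT : ContDiffOn ℝ ∞ T U) :
    ContDiffOn ℝ ∞ (fun y => (T y).flip) U :=
  (ContinuousLinearMap.flipₗᵢ ℝ F F' G').contDiff.comp_contDiffOn hT

lemma contDiffOn_curv (h : MetricOn G U) : ContDiffOn ℝ ∞ (curv G) U :=
  (((contDiffOn_fderiv h.isOpen (contDiffOn_gam h)).sub
    (contDiffOn_flip (contDiffOn_fderiv h.isOpen (contDiffOn_gam h)))).add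
    (contDiffOn_gamGam h)).sub (contDiffOn_flip (contDiffOn_gamGam h))

/-! ### The second Bianchi identity -/

/-- The covariant derivative `(∇_X S)(Y, Z)` of the Schouten tensor. -/
def covSch (G : MatField) (y X Y Z : Coord) : ℝ :=
  fderiv ℝ (sch G) y X Y Z - sch G y (gam G y X Y) Z - sch G y Y (gam G y X Z)

/-- The Cotton tensor `(∇_X S)(Y, Z) - (∇_Y S)(X, Z)`. -/
def cotton (G : MatField) (y X Y Z : Coord) : ℝ := covSch G y X Y Z - covSch G y Y X Z

/-- The covariant derivative `(∇_V C)(L, K, I, J)` of the Weyl tensor. -/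
def covWey (G : MatField) (y V L K I J : Coord) : ℝ :=
  fderiv ℝ (wey G) y V L K I J - wey G y (gam G y V L) K I J - wey G y L (gam G y V K) I J
    - wey G y L K (gam G y V I) J - wey G y L K I (gam G y V J)

/-- The covariant derivative `(∇_V R)(X, Y) Z` of the curvature operator. -/
def covCurv (G : MatField) (y V X Y Z : Coord) : Coord :=
  fderiv ℝ (curv G) y V X Y Z + gam G y V (curv G y X Y Z) - curv G y (gam G y V X) Y Z
    - curv G y X (gam G y V Y) Z - curv G y X Y (gam G y V Z)

lemma hasFDerivAt_eval₂ {E F F' G' : Type*} [NormedAddCommGroup E] [NormedSpace ℝ E]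
    [NormedAddCommGroup F] [NormedSpace ℝ F] [NormedAddCommGroup F'] [NormedSpace ℝ F']
    [NormedAddCommGroup G'] [NormedSpace ℝ G']
    {T : E → F →L[ℝ] F' →L[ℝ] G'} {y : E} (hT : DifferentiableAt ℝ T y) (A : F) (B : F') :
    HasFDerivAt (fun z => T z A B) (((fderiv ℝ T y).flip A).flip B) y := by
  have := (hT.hasFDerivAt.clm_apply (hasFDerivAt_const A y)).clm_apply (hasFDerivAt_const B y)
  refine this.congr_fderiv ?_
  ext1 V; simp

lemma fderiv_curv (h : MetricOn G U) (hy : y ∈ U) (V X Y Z : Coord) :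
    fderiv ℝ (curv G) y V X Y Z
      = fderiv ℝ (fderiv ℝ (gam G)) y V X Y Z - fderiv ℝ (fderiv ℝ (gam G)) y V Y X Z
        + (fderiv ℝ (gam G) y V X (gam G y Y Z) + gam G y X (fderiv ℝ (gam G) y V Y Z))
        - (fderiv ℝ (gam G) y V Y (gam G y X Z) + gam G y Y (fderiv ℝ (gam G) y V X Z)) := by
  have hg := diffAt h.isOpen (contDiffOn_gam h) hy
  have hg2 := diffAt h.isOpen (contDiffOn_fderiv h.isOpen (contDiffOn_gam h)) hy
  have hc := diffAt h.isOpen (contDiffOn_curv h) hy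
  have e1 : fderiv ℝ (fun z => curv G z X Y Z) y V = fderiv ℝ (curv G) y V X Y Z := by
    rw [fderiv_clm_eval₂ (T := fun z => curv G z X)
      (hc.clm_apply (differentiableAt_const _)), fderiv_clm_eval hc]
  have hd : ∀ A B C, HasFDerivAt (fun z => fderiv ℝ (gam G) z A B C)
      (((((fderiv ℝ (fderiv ℝ (gam G)) y).flip A).flip B)).flip C) y := by
    intro A B C
    have := (hasFDerivAt_eval₂ hg2 A B).clm_apply (hasFDerivAt_const C y)
    refine this.congr_fderiv ?_
    ext1 V; simp
  have hq : ∀ A B C, HasFDerivAt (fun z => gam G z A (gam G z B C)) _ y := fun A B C =>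
    (hg.hasFDerivAt.clm_apply (hasFDerivAt_const A y)).clm_apply (hasFDerivAt_eval₂ hg B C)
  rw [← e1]
  simp only [curv_apply]
  rw [((((hd X Y Z).fun_sub (hd Y X Z)).fun_add (hq X Y Z)).fun_sub (hq Y X Z)).fderiv]
  simp
  abel

lemma bianchi_algebra {E : Type*} [AddCommGroup E] {D₂ : E → E → E → E → E} {D₁ : E → E → E → E}
    {Γ : E → E → E} (hc : ∀ A B C D, D₂ A B C D = D₂ B A C D) (hs : ∀ A B, Γ A B = Γ B A)
    (ha : ∀ A B C, Γ A (B + C) = Γ A B + Γ A C) (hb : ∀ A B C, Γ A (B - C) = Γ A B - Γ A C)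
    (R : E → E → E → E)
    (hR : ∀ X Y Z, R X Y Z = D₁ X Y Z - D₁ Y X Z + Γ X (Γ Y Z) - Γ Y (Γ X Z))
    (DR : E → E → E → E → E)
    (hDR : ∀ V X Y Z, DR V X Y Z = D₂ V X Y Z - D₂ V Y X Z + (D₁ V X (Γ Y Z) + Γ X (D₁ V Y Z))
      - (D₁ V Y (Γ X Z) + Γ Y (D₁ V X Z))) (V X Y Z : E) :
    (DR V X Y Z + Γ V (R X Y Z) - R (Γ V X) Y Z - R X (Γ V Y) Z - R X Y (Γ V Z))
      + (DR X Y V Z + Γ X (R Y V Z) - R (Γ X Y) V Z - R Y (Γ X V) Z - R Y V (Γ X Z))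
      + (DR Y V X Z + Γ Y (R V X Z) - R (Γ Y V) X Z - R V (Γ Y X) Z - R V X (Γ Y Z)) = 0 := by
  simp only [hDR, hR, ha, hb]
  rw [hc X V, hc Y V, hc Y X, hs X V, hs Y V, hs Y X]
  abel

/-- The second Bianchi identity. -/
lemma covCurv_cyclic (h : MetricOn G U) (hy : y ∈ U) (V X Y Z : Coord) :
    covCurv G y V X Y Z + covCurv G y X Y V Z + covCurv G y Y V X Z = 0 := by
  have hc : ∀ A B C D, fderiv ℝ (fderiv ℝ (gam G)) y A B C D
      = fderiv ℝ (fderiv ℝ (gam G)) y B A C D := by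
    intro A B C D
    have := fderiv_fderiv_comm h.isOpen (contDiffOn_gam h) hy A B
    exact congrArg (fun T : Coord →L[ℝ] Coord →L[ℝ] Coord => T C D) this
  have hR := curv_apply G y
  have hDR := fderiv_curv h hy
  have hs := gam_symm h hy
  unfold covCurv
  generalize fderiv ℝ (curv G) y = DR at *
  generalize fderiv ℝ (fderiv ℝ (gam G)) y = D₂ at *
  generalize fderiv ℝ (gam G) y = D₁ at *
  generalize curv G y = R at *
  generalize gam G y = Γ at *
  exact bianchi_algebra (D₂ := fun A B C D => D₂ A B C D) (D₁ := fun A B C => D₁ A B C)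
    (Γ := fun A B => Γ A B) hc hs (fun A B C => map_add (Γ A) B C) (fun A B C => map_sub (Γ A) B C)
    (fun A B C => R A B C) hR (fun A B C D => DR A B C D) hDR V X Y Z

lemma covWey_eq (h : MetricOn G U) (hy : y ∈ U) (V L K I J : Coord) :
    covWey G y V L K I J = met G y L (covCurv G y V I J K)
      - (1 / 2) * (met G y L I * covSch G y V K J - met G y L J * covSch G y V K I
        + met G y K J * covSch G y V L I - met G y K I * covSch G y V L J) := by
  have hm := diffAt h.isOpen h.contDiffOn_met hy
  have hs := diffAt h.isOpen (contDiffOn_sch h) hy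
  have hc := diffAt h.isOpen (contDiffOn_curv h) hy
  have hw := diffAt h.isOpen (contDiffOn_wey h) hy
  have e1 : fderiv ℝ (fun z => wey G z L K I J) y V = fderiv ℝ (wey G) y V L K I J := by
    rw [fderiv_clm_eval₂ (T := fun z => wey G z L K)
      ((hw.clm_apply (differentiableAt_const _)).clm_apply (differentiableAt_const _)),
      fderiv_clm_eval₂ hw]
  have hcc : HasFDerivAt (fun z => curv G z I J K)
      (((((fderiv ℝ (curv G) y).flip I).flip J)).flip K) y := by
    have := (hasFDerivAt_eval₂ hc I J).clm_apply (hasFDerivAt_const K y)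
    refine this.congr_fderiv ?_
    ext1 V; simp
  have hms : ∀ A B C D, HasFDerivAt (fun z => met G z A B * sch G z C D) _ y :=
    fun A B C D => (hasFDerivAt_eval₂ hm A B).mul (hasFDerivAt_eval₂ hs C D)
  have hmc : HasFDerivAt (fun z => met G z L (curv G z I J K)) _ y :=
    (hm.hasFDerivAt.clm_apply (hasFDerivAt_const L y)).clm_apply hcc
  have e2 := fderiv_congr_on h.isOpen (fun z hz => wey_apply h hz L K I J) hy
  rw [(hmc.fun_sub ((((hms L I K J).fun_sub (hms L J K I)).fun_add (hms K J L I)).fun_sub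
    (hms K I L J) |>.const_mul (1 / 2))).fderiv] at e2
  rw [covWey, ← e1, e2]
  simp only [wey_apply h hy, covSch, covCurv, map_add, map_sub]
  simp [fderiv_met h hy]
  ring

/-- The second Bianchi identity for the Weyl tensor. -/
lemma covWey_cyclic (h : MetricOn G U) (hy : y ∈ U) (L K V I J : Coord) :
    covWey G y V L K I J + covWey G y I L K J V + covWey G y J L K V I
      = - (1 / 2) * (met G y L I * cotton G y V J K - met G y K I * cotton G y V J L
        + met G y L J * cotton G y I V K - met G y K J * cotton G y I V L
        + met G y L V * cotton G y J I K - met G y K V * cotton G y J I L) := by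
  have b := congrArg (met G y L) (covCurv_cyclic h hy V I J K)
  simp only [map_add, map_zero] at b
  have s : ∀ A B C, covSch G y A B C = covSch G y A C B := by
    intro A B C
    have hs := diffAt h.isOpen (contDiffOn_sch h) hy
    have : fderiv ℝ (sch G) y A B C = fderiv ℝ (sch G) y A C B := by
      rw [← fderiv_clm_eval₂ hs, ← fderiv_clm_eval₂ hs,
        fderiv_congr_on h.isOpen (fun z hz => sch_symm h hz B C) hy]
    rw [covSch, covSch, this, sch_symm h hy C, sch_symm h hy (gam G y A C)]
    ring
  simp only [covWey_eq h hy, cotton]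
  rw [s V K J, s V K I, s V L I, s V L J, s I K J, s I K V, s I L J, s I L V, s J K V, s J K I,
    s J L V, s J L I]
  linear_combination b

end

section

/-! ### Conformal rescaling -/

/-- The gradient of `f` as a vector field. -/
def grad (G : MatField) (f : Coord → ℝ) (y : Coord) : Coord := WithLp.toLp 2 (gradVec G f y)

/-- The covariant Hessian as a function of two vectors. -/
def hess (G : MatField) (f : Coord → ℝ) (y I J : Coord) : ℝ :=
  fderiv ℝ (fderiv ℝ f) y I J - fderiv ℝ f y (gam G y I J)

/-- The change of the Schouten tensor (up to a factor `-2`) under rescaling by `θ²`. -/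
def confP (G : MatField) (θ : Coord → ℝ) (y I J : Coord) : ℝ :=
  (θ y)⁻¹ * hess G θ y I J - 2 * ((θ y)⁻¹ * fderiv ℝ θ y I) * ((θ y)⁻¹ * fderiv ℝ θ y J)
    + (1 / 2) * ((θ y)⁻¹) ^ 2 * fderiv ℝ θ y (grad G θ y) * met G y I J

variable {G : MatField} {U : Set Coord} {y : Coord} {θ f : Coord → ℝ}

lemma met_grad (h : MetricOn G U) (hy : y ∈ U) (f : Coord → ℝ) (X : Coord) :
    met G y (grad G f y) X = fderiv ℝ f y X := by
  rw [met_symm h hy, clm_eq_sum (fderiv ℝ f y) X, met_apply]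
  refine Finset.sum_congr rfl fun i _ => ?_
  have : ∑ j, G y i j * gradVec G f y j = pd i f y := by
    simp only [gradVec, Finset.mul_sum]
    rw [Finset.sum_comm]
    simp only [← mul_assoc, ← Finset.sum_mul, inv_mul_met h hy]
    simp
  change ∑ j, G y i j * X i * gradVec G f y j = X i * pd i f y
  rw [← this, Finset.mul_sum]
  exact Finset.sum_congr rfl fun j _ => by ring

lemma contDiffOn_grad (h : MetricOn G U) (hf : ContDiffOn ℝ ∞ f U) :
    ContDiffOn ℝ ∞ (grad G f) U := by
  rw [contDiffOn_euclidean]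
  intro i
  change ContDiffOn ℝ ∞ (fun x => ∑ j, (G x)⁻¹ i j * pd j f x) U
  exact ContDiffOn.sum fun j _ => (contDiffOn_inv h i j).mul (contDiffOn_pd h.isOpen hf j)

lemma hess_symm (h : MetricOn G U) (hf : ContDiffOn ℝ ∞ f U) (hy : y ∈ U) (I J : Coord) :
    hess G f y I J = hess G f y J I := by
  rw [hess, hess, fderiv_fderiv_comm h.isOpen hf hy, gam_symm h hy]

lemma hess_basisVec (h : MetricOn G U) (hf : ContDiffOn ℝ ∞ f U) (hy : y ∈ U) (i j : Fin 4) :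
    hess G f y (basisVec i) (basisVec j) = hessian G f i j y := by
  rw [hess, hessian, clm_eq_sum (fderiv ℝ f y)]
  simp only [gam_basisVec]
  congr 1
  unfold pd
  rw [fderiv_clm_eval (diffAt h.isOpen (contDiffOn_fderiv h.isOpen hf) hy)]

/-- `g(∇_X grad f, Y)` is the Hessian. -/
lemma met_fderiv_grad (h : MetricOn G U) (hf : ContDiffOn ℝ ∞ f U) (hy : y ∈ U) (X Y : Coord) :
    met G y (fderiv ℝ (grad G f) y X + gam G y X (grad G f y)) Y = hess G f y X Y := by
  have hm := diffAt h.isOpen h.contDiffOn_met hy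
  have hn := diffAt h.isOpen (contDiffOn_grad h hf) hy
  have hf2 := diffAt h.isOpen (contDiffOn_fderiv h.isOpen hf) hy
  have e := congrArg (fun T : Coord →L[ℝ] ℝ => T X)
    (fderiv_congr_on h.isOpen (fun z hz => met_grad h hz f Y) hy)
  rw [fderiv_clm_eval hf2, ((hm.hasFDerivAt.clm_apply hn.hasFDerivAt).clm_apply
    (hasFDerivAt_const Y y)).fderiv] at e
  simp only [hess, ← e, ← met_grad h hy f]
  simp [fderiv_met h hy]
  ring

section Rescale

variable {G' : MatField}

lemma met_rescale {y : Coord} (hG : ∀ i j, G' y i j = θ y ^ 2 * G y i j) (X Y : Coord) :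
    met G' y X Y = θ y ^ 2 * met G y X Y := by
  simp only [met_apply, hG, Finset.mul_sum]
  exact Finset.sum_congr rfl fun i _ => Finset.sum_congr rfl fun j _ => by ring

lemma gam_rescale (h : MetricOn G U) (h' : MetricOn G' U) (hθ : ContDiffOn ℝ ∞ θ U)
    (h0 : ∀ z ∈ U, θ z ≠ 0) (hG : ∀ z ∈ U, ∀ i j, G' z i j = θ z ^ 2 * G z i j) (hy : y ∈ U)
    (X Y : Coord) :
    gam G' y X Y = gam G y X Y + ((θ y)⁻¹ * fderiv ℝ θ y X) • Y + ((θ y)⁻¹ * fderiv ℝ θ y Y) • X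
      - met G y X Y • (θ y)⁻¹ • grad G θ y := by
  have hm := diffAt h.isOpen h.contDiffOn_met hy
  have hm' := diffAt h.isOpen h'.contDiffOn_met hy
  have ht := diffAt h.isOpen hθ hy
  have hd : ∀ A B C, fderiv ℝ (met G') y A B C
      = 2 * θ y * fderiv ℝ θ y A * met G y B C + θ y ^ 2 * fderiv ℝ (met G) y A B C := by
    intro A B C
    rw [← fderiv_clm_eval₂ hm', fderiv_congr_on h.isOpen (fun z hz => met_rescale (hG z hz) B C) hy,
      ((ht.hasFDerivAt.pow 2).fun_mul (hasFDerivAt_eval₂ hm B C)).fderiv]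
    simp
    ring
  rw [← sub_eq_zero]
  refine nondegenerate h' hy fun Z => ?_
  have k' := koszul h' hy X Y Z
  have k := koszul h hy X Y Z
  simp only [hd] at k'
  have n0 := h0 y hy
  have e := met_grad h hy θ Z
  simp only [map_sub, map_add, map_smul, sub_apply, add_apply, smul_apply, smul_eq_mul,
    met_rescale (hG y hy)] at k' ⊢
  rw [e]
  field_simp
  linear_combination (1 / 2) * k' - (θ y) ^ 2 / 2 * k

lemma rescale_algebra {E : Type*} [AddCommGroup E] [Module ℝ E] {Γ : E →ₗ[ℝ] E →ₗ[ℝ] E}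
    {D : E → E → E → E} {ψ : E →ₗ[ℝ] ℝ} {Dψ : E → E → ℝ} {g : E →ₗ[ℝ] E →ₗ[ℝ] ℝ}
    {Dg : E → E → E → ℝ} {Ψ : E} {DΨ : E → E}
    (hg : ∀ X Y, g X Y = g Y X) (hΨ : ∀ X, g Ψ X = ψ X) (hΓ : ∀ X Y, Γ X Y = Γ Y X)
    (hDg : ∀ W X Y, Dg W X Y = g (Γ W X) Y + g X (Γ W Y))
    (hDψ : ∀ X Y, Dψ X Y = Dψ Y X)
    (Γ' : E → E → E) (hΓ' : ∀ X Y, Γ' X Y = Γ X Y + ψ X • Y + ψ Y • X - g X Y • Ψ)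
    (D' : E → E → E → E) (hD' : ∀ W X Y, D' W X Y = D W X Y + Dψ W X • Y + Dψ W Y • X
      - (Dg W X Y • Ψ + g X Y • DΨ W))
    (P : E → E → ℝ) (hP : ∀ X Y, P X Y = Dψ X Y - ψ (Γ X Y) - ψ X * ψ Y + (1 / 2) * ψ Ψ * g X Y)
    (Q : E → E) (hQ : ∀ X, Q X = DΨ X + Γ X Ψ - ψ X • Ψ + ((1 / 2) * ψ Ψ) • X) (I J K : E) :
    D' I J K - D' J I K + Γ' I (Γ' J K) - Γ' J (Γ' I K)
      = D I J K - D J I K + Γ I (Γ J K) - Γ J (Γ I K)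
        - (P K J • I + g K J • Q I - P K I • J - g K I • Q J) := by
  simp only [hD', hΓ', hP, hQ, hDg, map_add, map_sub, map_smul, smul_eq_mul, hΓ _ K]
  rw [hg J K, hg I K, hg J I, hg I Ψ, hg J Ψ, hΨ, hΨ, hDψ K J, hDψ K I, hDψ J I, hΓ J I,
    hg (Γ I J) K, hg I (Γ K J), hg J (Γ K I)]
  module

lemma curv_rescale (h : MetricOn G U) (h' : MetricOn G' U) (hθ : ContDiffOn ℝ ∞ θ U)
    (h0 : ∀ z ∈ U, θ z ≠ 0) (hG : ∀ z ∈ U, ∀ i j, G' z i j = θ z ^ 2 * G z i j) (hy : y ∈ U) :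
    ∃ Q : Coord →L[ℝ] Coord, (∀ X Y, met G y (Q X) Y = confP G θ y X Y) ∧
      ∀ I J K, curv G' y I J K = curv G y I J K - (confP G θ y K J • I + met G y K J • Q I
        - confP G θ y K I • J - met G y K I • Q J) := by
  have hm := diffAt h.isOpen h.contDiffOn_met hy
  have hg := diffAt h.isOpen (contDiffOn_gam h) hy
  have hg' := diffAt h.isOpen (contDiffOn_gam h') hy
  have ht := diffAt h.isOpen hθ hy
  have ht2 := diffAt h.isOpen (contDiffOn_fderiv h.isOpen hθ) hy
  have hn := diffAt h.isOpen (contDiffOn_grad h hθ) hy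
  have n0 := h0 y hy
  set ψ : Coord → Coord →L[ℝ] ℝ := fun z => (θ z)⁻¹ • fderiv ℝ θ z with hψ
  set Ψ : Coord → Coord := fun z => (θ z)⁻¹ • grad G θ z with hΨ
  have hti : DifferentiableAt ℝ (fun z => (θ z)⁻¹) y := ht.inv n0
  have hψd : DifferentiableAt ℝ ψ y := hti.smul ht2
  have hΨd : DifferentiableAt ℝ Ψ y := hti.smul hn
  have hinv : fderiv ℝ (fun z => (θ z)⁻¹) y = -((θ y ^ 2)⁻¹) • fderiv ℝ θ y := by
    have := (hasDerivAt_inv n0).comp_hasFDerivAt y ht.hasFDerivAt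
    exact this.fderiv
  have hDψ : ∀ X Y, fderiv ℝ ψ y X Y = (θ y)⁻¹ * fderiv ℝ (fderiv ℝ θ) y X Y
      - ((θ y)⁻¹ * fderiv ℝ θ y X) * ((θ y)⁻¹ * fderiv ℝ θ y Y) := by
    intro X Y
    rw [hψ, (hti.hasFDerivAt.fun_smul ht2.hasFDerivAt).fderiv, hinv]
    simp
    ring
  have hmΨ : ∀ z ∈ U, ∀ X, met G z (Ψ z) X = ψ z X := by
    intro z hz X
    simp [hΨ, hψ, met_grad h hz]
  have hDΨ : ∀ X Y, met G y (fderiv ℝ Ψ y X + gam G y X (Ψ y)) Y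
      = fderiv ℝ ψ y X Y - ψ y (gam G y X Y) := by
    intro X Y
    have e := congrArg (fun T : Coord →L[ℝ] ℝ => T X)
      (fderiv_congr_on h.isOpen (fun z hz => hmΨ z hz Y) hy)
    rw [fderiv_clm_eval hψd, ((hm.hasFDerivAt.clm_apply hΨd.hasFDerivAt).clm_apply
      (hasFDerivAt_const Y y)).fderiv] at e
    rw [← e, ← hmΨ y hy]
    simp [fderiv_met h hy]
    ring
  have hgam : ∀ z ∈ U, ∀ X Y, gam G' z X Y = gam G z X Y + ψ z X • Y + ψ z Y • X
      - met G z X Y • Ψ z := fun z hz X Y => gam_rescale h h' hθ h0 hG hz X Y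
  have hD' : ∀ W X Y, fderiv ℝ (gam G') y W X Y = fderiv ℝ (gam G) y W X Y
      + fderiv ℝ ψ y W X • Y + fderiv ℝ ψ y W Y • X
      - (fderiv ℝ (met G) y W X Y • Ψ y + met G y X Y • fderiv ℝ Ψ y W) := by
    intro W X Y
    have hψX : ∀ A, HasFDerivAt (fun z => ψ z A) ((fderiv ℝ ψ y).flip A) y := by
      intro A
      refine (hψd.hasFDerivAt.clm_apply (hasFDerivAt_const A y)).congr_fderiv ?_
      ext1 V; simp
    rw [← fderiv_clm_eval₂ hg', fderiv_congr_on h.isOpen (fun z hz => hgam z hz X Y) hy,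
      ((((hasFDerivAt_eval₂ hg X Y).fun_add ((hψX X).fun_smul (hasFDerivAt_const Y y))).fun_add
      ((hψX Y).fun_smul (hasFDerivAt_const X y))).fun_sub
      ((hasFDerivAt_eval₂ hm X Y).fun_smul hΨd.hasFDerivAt)).fderiv]
    simp
    abel
  set Q : Coord →L[ℝ] Coord := fderiv ℝ Ψ y + (gam G y).flip (Ψ y) - (ψ y).smulRight (Ψ y)
    + ((1 / 2) * ψ y (Ψ y)) • ContinuousLinearMap.id ℝ Coord with hQ
  have hP : ∀ X Y, confP G θ y X Y = fderiv ℝ ψ y X Y - ψ y (gam G y X Y) - ψ y X * ψ y Y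
      + (1 / 2) * ψ y (Ψ y) * met G y X Y := by
    intro X Y
    rw [hDψ]
    simp only [confP, hess, hψ, hΨ, smul_apply, map_smul, smul_eq_mul]
    ring
  refine ⟨Q, fun X Y => ?_, fun I J K => ?_⟩
  · have := hDΨ X Y
    have e2 := hmΨ y hy Y
    rw [hP]
    simp only [hQ, add_apply, sub_apply, map_add, map_sub, ContinuousLinearMap.flip_apply,
      ContinuousLinearMap.smulRight_apply, map_smul, smul_apply,
      ContinuousLinearMap.id_apply, smul_eq_mul] at this ⊢
    linear_combination this - ψ y X * e2
  · have hs : ∀ X Y, fderiv ℝ ψ y X Y = fderiv ℝ ψ y Y X := by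
      intro X Y
      rw [hDψ, hDψ, fderiv_fderiv_comm h.isOpen hθ hy]
      ring
    let toL : (Coord →L[ℝ] Coord →L[ℝ] Coord) → (Coord →ₗ[ℝ] Coord →ₗ[ℝ] Coord) :=
      fun T => LinearMap.mk₂ ℝ (fun a b => T a b) (by simp) (by simp) (by simp) (by simp)
    let toB : (Coord →L[ℝ] Coord →L[ℝ] ℝ) → (Coord →ₗ[ℝ] Coord →ₗ[ℝ] ℝ) :=
      fun T => LinearMap.mk₂ ℝ (fun a b => T a b) (by simp) (by simp) (by simp) (by simp)
    exact rescale_algebra (Γ := toL (gam G y)) (D := fun a b c => fderiv ℝ (gam G) y a b c)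
      (ψ := (ψ y).toLinearMap) (Dψ := fun a b => fderiv ℝ ψ y a b) (g := toB (met G y))
      (Dg := fun a b c => fderiv ℝ (met G) y a b c) (Ψ := Ψ y) (DΨ := fun a => fderiv ℝ Ψ y a)
      (met_symm h hy) (hmΨ y hy) (gam_symm h hy) (fderiv_met h hy) hs
      (fun a b => gam G' y a b) (hgam y hy) (fun a b c => fderiv ℝ (gam G') y a b c) hD'
      (confP G θ y) hP (fun a => Q a) (fun a => rfl) I J K

lemma trg_rescale (h : MetricOn G U) (h0 : ∀ z ∈ U, θ z ≠ 0)
    (hG : ∀ z ∈ U, ∀ i j, G' z i j = θ z ^ 2 * G z i j) (hy : y ∈ U) (T : Coord → Coord → ℝ) :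
    trg (G' y) T = ((θ y)⁻¹) ^ 2 * trg (G y) T := by
  have e : G' y = (θ y ^ 2) • G y := by
    ext i j; simp [hG y hy]
  have : (G' y)⁻¹ = ((θ y)⁻¹) ^ 2 • (G y)⁻¹ := by
    refine Matrix.inv_eq_right_inv ?_
    rw [e, Matrix.smul_mul, Matrix.mul_smul, smul_smul, Matrix.mul_nonsing_inv _ (h.det y hy)]
    rw [← mul_pow, mul_inv_cancel₀ (h0 y hy)]; simp
  simp only [trg, this, Finset.mul_sum, Matrix.smul_apply, smul_eq_mul]
  exact Finset.sum_congr rfl fun i _ => Finset.sum_congr rfl fun j _ => by ring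

lemma confP_symm (h : MetricOn G U) (hθ : ContDiffOn ℝ ∞ θ U) (hy : y ∈ U) (X Y : Coord) :
    confP G θ y X Y = confP G θ y Y X := by
  rw [confP, confP, hess_symm h hθ hy, met_symm h hy]
  ring

lemma ric_rescale (h : MetricOn G U) (h' : MetricOn G' U) (hθ : ContDiffOn ℝ ∞ θ U)
    (h0 : ∀ z ∈ U, θ z ≠ 0) (hG : ∀ z ∈ U, ∀ i j, G' z i j = θ z ^ 2 * G z i j) (hy : y ∈ U)
    (K J : Coord) : ric G' y K J = ric G y K J - 2 * confP G θ y K J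
      - trg (G y) (confP G θ y) * met G y K J := by
  obtain ⟨Q, hQ, hR⟩ := curv_rescale h h' hθ h0 hG hy
  have e1 : ∑ i, Q (basisVec i) i = trg (G y) (confP G θ y) := by
    rw [trg]
    refine Finset.sum_congr rfl fun i _ => ?_
    rw [← sum_inv_met h hy i]
    refine Finset.sum_congr rfl fun j _ => ?_
    rw [inv_symm h hy, met_symm h hy, hQ]
  have e2 : ∑ i, met G y K (basisVec i) * Q J i = confP G θ y K J := by
    rw [confP_symm h hθ hy, ← hQ, met_symm h hy, clm_eq_sum (met G y K) (Q J)]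
    exact Finset.sum_congr rfl fun i _ => by simp [mul_comm]
  have e3 : ∀ T : Coord →L[ℝ] ℝ, ∑ i, T (basisVec i) * J i = T J := by
    intro T
    rw [clm_eq_sum T J]
    exact Finset.sum_congr rfl fun i _ => by simp [mul_comm]
  have e4 : ∑ i, confP G θ y K (basisVec i) * J i = confP G θ y K J := by
    simp only [← hQ]
    exact e3 (met G y (Q K))
  rw [ric_apply h' hy, ric_apply h hy]
  simp only [hR, PiLp.sub_apply, PiLp.add_apply, PiLp.smul_apply, smul_eq_mul,
    Finset.sum_sub_distrib, Finset.sum_add_distrib, ← Finset.mul_sum, e1, e2, e4]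
  simp
  ring

lemma scalarCurv_rescale (h : MetricOn G U) (h' : MetricOn G' U) (hθ : ContDiffOn ℝ ∞ θ U)
    (h0 : ∀ z ∈ U, θ z ≠ 0) (hG : ∀ z ∈ U, ∀ i j, G' z i j = θ z ^ 2 * G z i j) (hy : y ∈ U) :
    scalarCurv G' y = ((θ y)⁻¹) ^ 2 * (scalarCurv G y - 6 * trg (G y) (confP G θ y)) := by
  rw [scalarCurv_eq, trg_rescale h h0 hG hy]
  simp only [ric_rescale h h' hθ h0 hG hy, trg_sub, trg_smul, trg_met h hy, ← scalarCurv_eq]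
  ring

lemma sch_rescale (h : MetricOn G U) (h' : MetricOn G' U) (hθ : ContDiffOn ℝ ∞ θ U)
    (h0 : ∀ z ∈ U, θ z ≠ 0) (hG : ∀ z ∈ U, ∀ i j, G' z i j = θ z ^ 2 * G z i j) (hy : y ∈ U)
    (K J : Coord) : sch G' y K J = sch G y K J - 2 * confP G θ y K J := by
  rw [sch_apply, sch_apply, ric_rescale h h' hθ h0 hG hy, scalarCurv_rescale h h' hθ h0 hG hy,
    met_rescale (hG y hy)]
  have := h0 y hy
  field_simp
  ring

/-- Conformal invariance of the Weyl tensor. -/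
lemma wey_rescale (h : MetricOn G U) (h' : MetricOn G' U) (hθ : ContDiffOn ℝ ∞ θ U)
    (h0 : ∀ z ∈ U, θ z ≠ 0) (hG : ∀ z ∈ U, ∀ i j, G' z i j = θ z ^ 2 * G z i j) (hy : y ∈ U)
    (L K I J : Coord) : wey G' y L K I J = θ y ^ 2 * wey G y L K I J := by
  obtain ⟨Q, hQ, hR⟩ := curv_rescale h h' hθ h0 hG hy
  have q : ∀ X Y, met G y X (Q Y) = confP G θ y X Y := fun X Y => by
    rw [met_symm h hy, hQ, confP_symm h hθ hy]
  rw [wey_apply h' hy, wey_apply h hy]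
  simp only [hR, sch_rescale h h' hθ h0 hG hy, met_rescale (hG y hy), map_sub, map_add, map_smul,
    smul_eq_mul, q]
  ring

end Rescale

end

section

/-! ### The conformal field equations near infinity -/

/-- A conformal completion in a coordinate domain, with rescaled matter tensor `T`. -/
structure CompletionOn (G : MatField) (U : Set Coord) (Ω : Coord → ℝ) (T : MatField) : Prop where
  metric : MetricOn G U
  smooth : ContDiffOn ℝ ∞ Ω U
  smoothT : ∀ i j, ContDiffOn ℝ ∞ (fun y => T y i j) U
  regular : ∀ y ∈ U, Ω y = 0 → fderiv ℝ Ω y ≠ 0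
  field : ∀ y ∈ U, 0 < Ω y → ∀ i j,
    einstein (fun z => ((Ω z) ^ 2)⁻¹ • G z) i j y = (Ω y) ^ 2 * T y i j

/-- The trace-adjusted matter tensor `T - (tr T) g / 3`. -/
def matter (G T : MatField) (y : Coord) : Coord →L[ℝ] Coord →L[ℝ] ℝ :=
  met T y - ((1 / 3) * trg (G y) (fun X Y => met T y X Y)) • met G y

/-- The smooth function equal to `|dΩ|² / Ω` in the physical spacetime. -/
def normRatio (G T : MatField) (Ω : Coord → ℝ) (y : Coord) : ℝ :=
  (1 / 4) * (2 * trg (G y) (hess G Ω y) + Ω y * trg (G y) (fun X Y => sch G y X Y)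
    - Ω y ^ 3 * trg (G y) (fun X Y => matter G T y X Y))

variable {G T : MatField} {U : Set Coord} {y : Coord} {Ω : Coord → ℝ}

lemma CompletionOn.isOpen_pos (h : CompletionOn G U Ω T) : IsOpen {z | z ∈ U ∧ 0 < Ω z} :=
  h.smooth.continuousOn.isOpen_inter_preimage h.metric.isOpen isOpen_Ioi

lemma CompletionOn.mem_closure (h : CompletionOn G U Ω T) (hy : y ∈ U) (h0 : Ω y = 0) :
    y ∈ closure {z | z ∈ U ∧ 0 < Ω z} := by
  by_contra hc
  rw [mem_closure_iff_frequently, not_frequently] at hc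
  refine h.regular y hy h0 (IsLocalMax.fderiv_eq_zero ?_)
  filter_upwards [hc, h.metric.isOpen.mem_nhds hy] with z hz hzU
  rw [h0]
  by_contra hlt
  exact hz ⟨hzU, not_le.1 hlt⟩

lemma CompletionOn.eq_zero_of_pos {F : Type*} [NormedAddCommGroup F] (h : CompletionOn G U Ω T)
    (hy : y ∈ U) (h0 : Ω y = 0) {f : Coord → F} (hf : ContinuousOn f U)
    (hV : ∀ z ∈ U, 0 < Ω z → f z = 0) : f y = 0 := by
  have hc := hf.continuousAt (h.metric.isOpen.mem_nhds hy)
  have : (𝓝[{z | z ∈ U ∧ 0 < Ω z}] y).NeBot :=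
    mem_closure_iff_nhdsWithin_neBot.1 (h.mem_closure hy h0)
  have t1 : Tendsto f (𝓝[{z | z ∈ U ∧ 0 < Ω z}] y) (𝓝 (f y)) := hc.mono_left nhdsWithin_le_nhds
  have t2 : Tendsto f (𝓝[{z | z ∈ U ∧ 0 < Ω z}] y) (𝓝 0) := by
    refine tendsto_const_nhds.congr' ?_
    filter_upwards [self_mem_nhdsWithin] with z hz
    exact (hV z hz.1 hz.2).symm
  exact tendsto_nhds_unique t1 t2

lemma CompletionOn.fderiv_eq_zero_of_pos {F : Type*} [NormedAddCommGroup F] [NormedSpace ℝ F]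
    (h : CompletionOn G U Ω T) (hy : y ∈ U) (h0 : Ω y = 0) {f : Coord → F}
    (hf : ContDiffOn ℝ ∞ f U) (hV : ∀ z ∈ U, 0 < Ω z → f z = 0) : fderiv ℝ f y = 0 := by
  refine h.eq_zero_of_pos hy h0 (contDiffOn_fderiv h.metric.isOpen hf).continuousOn ?_
  intro z hz hp
  rw [fderiv_congr_on (f' := fun _ => (0 : F)) h.isOpen_pos (fun w hw => hV w hw.1 hw.2) ⟨hz, hp⟩]
  simp

lemma contDiffOn_trg (h : MetricOn G U) {S : Coord → Coord → Coord → ℝ}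
    (hS : ∀ X Y, ContDiffOn ℝ ∞ (fun y => S y X Y) U) :
    ContDiffOn ℝ ∞ (fun y => trg (G y) (S y)) U :=
  ContDiffOn.sum fun i _ => ContDiffOn.sum fun j _ => (contDiffOn_inv h i j).mul (hS _ _)

lemma contDiffOn_eval₂ {S : Coord → Coord →L[ℝ] Coord →L[ℝ] ℝ} (hS : ContDiffOn ℝ ∞ S U)
    (X Y : Coord) : ContDiffOn ℝ ∞ (fun y => S y X Y) U :=
  (hS.clm_apply contDiffOn_const).clm_apply contDiffOn_const

lemma contDiffOn_hess (h : MetricOn G U) {f : Coord → ℝ} (hf : ContDiffOn ℝ ∞ f U)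
    (X Y : Coord) : ContDiffOn ℝ ∞ (fun y => hess G f y X Y) U :=
  (((contDiffOn_fderiv h.isOpen (contDiffOn_fderiv h.isOpen hf)).clm_apply
    contDiffOn_const).clm_apply contDiffOn_const).sub
    ((contDiffOn_fderiv h.isOpen hf).clm_apply
      (((contDiffOn_gam h).clm_apply contDiffOn_const).clm_apply contDiffOn_const))

lemma CompletionOn.contDiffOn_matter (h : CompletionOn G U Ω T) :
    ContDiffOn ℝ ∞ (matter G T) U := by
  have hT : ContDiffOn ℝ ∞ (met T) U := contDiffOn_bilin h.smoothT
  exact hT.sub ((contDiffOn_const.mul (contDiffOn_trg h.metric fun X Y =>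
    contDiffOn_eval₂ hT X Y)).smul h.metric.contDiffOn_met)

lemma CompletionOn.contDiffOn_normRatio (h : CompletionOn G U Ω T) :
    ContDiffOn ℝ ∞ (normRatio G T Ω) U :=
  contDiffOn_const.mul (((contDiffOn_const.mul (contDiffOn_trg h.metric
    (contDiffOn_hess h.metric h.smooth))).add (h.smooth.mul (contDiffOn_trg h.metric
    (contDiffOn_eval₂ (contDiffOn_sch h.metric))))).sub ((h.smooth.pow 3).mul
    (contDiffOn_trg h.metric (contDiffOn_eval₂ h.contDiffOn_matter))))

lemma hess_inv (h : MetricOn G U) (hΩ : ContDiffOn ℝ ∞ Ω U) (h0 : ∀ z ∈ U, Ω z ≠ 0) (hy : y ∈ U)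
    (X Y : Coord) : hess G (fun z => (Ω z)⁻¹) y X Y = - ((Ω y)⁻¹) ^ 2 * hess G Ω y X Y
      + 2 * ((Ω y)⁻¹) ^ 3 * fderiv ℝ Ω y X * fderiv ℝ Ω y Y := by
  have ht := fun z hz => diffAt h.isOpen hΩ (y := z) hz
  have hinv : ∀ z ∈ U, fderiv ℝ (fun z => (Ω z)⁻¹) z = -((Ω z ^ 2)⁻¹) • fderiv ℝ Ω z := by
    intro z hz
    exact ((hasDerivAt_inv (h0 z hz)).comp_hasFDerivAt z (ht z hz).hasFDerivAt).fderiv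
  have ht2 := diffAt h.isOpen (contDiffOn_fderiv h.isOpen hΩ) hy
  have n0 := h0 y hy
  have hq : HasFDerivAt (fun z => -((Ω z ^ 2)⁻¹)) ((2 * ((Ω y)⁻¹) ^ 3) • fderiv ℝ Ω y) y := by
    have h2 : HasDerivAt (fun t : ℝ => -((t ^ 2)⁻¹)) (2 * ((Ω y)⁻¹) ^ 3) (Ω y) := by
      have := ((hasDerivAt_pow 2 (Ω y)).inv (pow_ne_zero 2 n0)).neg
      refine this.congr_deriv ?_
      field_simp
      norm_num
      ring
    exact h2.comp_hasFDerivAt y (ht y hy).hasFDerivAt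
  rw [hess, hess, fderiv_congr_on h.isOpen hinv hy, hinv y hy,
    (hq.fun_smul ht2.hasFDerivAt).fderiv]
  simp
  ring

/-- Einstein's equations for the physical metric, in terms of the unphysical metric. -/
lemma CompletionOn.conformal_einstein (h : CompletionOn G U Ω T) (hy : y ∈ U) (hp : 0 < Ω y)
    (X Y : Coord) : 2 * Ω y * hess G Ω y X Y = fderiv ℝ Ω y (grad G Ω y) * met G y X Y
      - Ω y ^ 2 * sch G y X Y + Ω y ^ 4 * matter G T y X Y := by
  set V : Set Coord := {z | z ∈ U ∧ 0 < Ω z} with hV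
  set G' : MatField := fun z => ((Ω z) ^ 2)⁻¹ • G z with hG'
  have hVo : IsOpen V := h.isOpen_pos
  have hsub : V ⊆ U := fun z hz => hz.1
  have hGV : MetricOn G V := ⟨hVo, fun i j => (h.metric.smooth i j).mono hsub,
    fun z hz => h.metric.symm z hz.1, fun z hz => h.metric.det z hz.1⟩
  have hΩV : ContDiffOn ℝ ∞ Ω V := h.smooth.mono hsub
  have n0 : ∀ z ∈ V, Ω z ≠ 0 := fun z hz => hz.2.ne'
  have hθ : ContDiffOn ℝ ∞ (fun z => (Ω z)⁻¹) V := hΩV.inv n0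
  have hθ0 : ∀ z ∈ V, (Ω z)⁻¹ ≠ 0 := fun z hz => inv_ne_zero (n0 z hz)
  have hG : ∀ z ∈ V, ∀ i j, G' z i j = ((Ω z)⁻¹) ^ 2 * G z i j := by
    intro z hz i j
    simp [hG']
  have hM' : MetricOn G' V := by
    refine ⟨hVo, fun i j => ?_, fun z hz i j => ?_, fun z hz => ?_⟩
    · exact ((hθ.pow 2).mul (hGV.smooth i j)).congr fun z hz => hG z hz i j
    · rw [hG z hz, hG z hz, hGV.symm z hz]
    · simp only [hG', Matrix.det_smul]
      exact (IsUnit.mk0 _ (by have := n0 z hz; positivity)).mul (hGV.det z hz)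
  have hyV : y ∈ V := ⟨hy, hp⟩
  have hs := sch_rescale hGV hM' hθ hθ0 hG hyV
  have hr : ∀ X Y, ric G' y X Y - (1 / 2) * scalarCurv G' y * met G' y X Y
      = Ω y ^ 2 * met T y X Y := by
    intro X Y
    have : ∀ i j, ricci G' i j y - (1 / 2) * scalarCurv G' y * G' y i j = Ω y ^ 2 * T y i j :=
      h.field y hy hp
    simp only [ric, met, bilin_apply, Finset.mul_sum, ← Finset.sum_sub_distrib]
    refine Finset.sum_congr rfl fun i _ => Finset.sum_congr rfl fun j _ => ?_
    linear_combination (X i * Y j) * this i j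
  have hsc : scalarCurv G' y = - Ω y ^ 4 * trg (G y) (fun X Y => met T y X Y) := by
    have e : trg (G y) (fun X Y => ric G' y X Y - (1 / 2) * scalarCurv G' y * met G' y X Y)
        = trg (G y) (fun X Y => Ω y ^ 2 * met T y X Y) := by simp only [hr]
    rw [trg_sub, trg_smul, trg_smul] at e
    have e2 := scalarCurv_eq G' y
    rw [trg_rescale hGV hθ0 hG hyV] at e2
    have e3 : trg (G y) (fun X Y => met G' y X Y) = ((Ω y)⁻¹) ^ 2 * 4 := by
      simp only [met_rescale (θ := fun z => (Ω z)⁻¹) (hG y hyV), trg_smul, trg_met hGV hyV]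
    rw [e3] at e
    have n := n0 y hyV
    simp only [inv_inv] at e2
    generalize trg (G y) (fun X Y => ric G' y X Y) = r at e e2
    generalize trg (G y) (fun X Y => met T y X Y) = t at e ⊢
    field_simp at e
    linear_combination (-1) * e2 - e / 2
  have key := hs X Y
  rw [sch_apply] at key
  have := hr X Y
  have gr : grad G (fun z => (Ω z)⁻¹) y = (-((Ω y ^ 2)⁻¹)) • grad G Ω y := by
    have hinv : fderiv ℝ (fun z => (Ω z)⁻¹) y = -((Ω y ^ 2)⁻¹) • fderiv ℝ Ω y :=
      ((hasDerivAt_inv (n0 y hyV)).comp_hasFDerivAt y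
        (diffAt hVo hΩV hyV).hasFDerivAt).fderiv
    refine sub_eq_zero.1 (nondegenerate hGV hyV fun Z => ?_)
    simp only [map_sub, sub_apply, map_smul, smul_apply, met_grad hGV hyV, hinv, smul_eq_mul]
    ring
  have hinv : fderiv ℝ (fun z => (Ω z)⁻¹) y = -((Ω y ^ 2)⁻¹) • fderiv ℝ Ω y :=
      ((hasDerivAt_inv (n0 y hyV)).comp_hasFDerivAt y
        (diffAt hVo hΩV hyV).hasFDerivAt).fderiv
  rw [confP, hess_inv hGV hΩV n0 hyV, gr, hinv, met_rescale (θ := fun z => (Ω z)⁻¹) (hG y hyV)] at key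
  rw [met_rescale (θ := fun z => (Ω z)⁻¹) (hG y hyV)] at this
  simp only [matter, smul_apply, sub_apply, map_smul, smul_eq_mul, inv_inv, neg_mul] at key ⊢
  have n := n0 y hyV
  rw [hsc] at key this
  generalize trg (G y) (fun X Y => met T y X Y) = t at key this ⊢
  field_simp at key this ⊢
  linear_combination (-1 / 2) * key + (3 / 2) * Ω y ^ 2 * this

lemma CompletionOn.normSq_eq (h : CompletionOn G U Ω T) (hy : y ∈ U) (hp : 0 < Ω y) :
    fderiv ℝ Ω y (grad G Ω y) = Ω y * normRatio G T Ω y := by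
  have e : trg (G y) (fun X Y => 2 * Ω y * hess G Ω y X Y)
      = trg (G y) (fun X Y => fderiv ℝ Ω y (grad G Ω y) * met G y X Y
        - Ω y ^ 2 * sch G y X Y + Ω y ^ 4 * matter G T y X Y) := by
    simp only [h.conformal_einstein hy hp]
  rw [trg_smul, trg_add, trg_sub, trg_smul, trg_smul, trg_smul, trg_met h.metric hy] at e
  rw [normRatio]
  linear_combination (-1 / 4) * e

lemma CompletionOn.two_hess (h : CompletionOn G U Ω T) (hy : y ∈ U) (hp : 0 < Ω y)
    (X Y : Coord) : 2 * hess G Ω y X Y = normRatio G T Ω y * met G y X Y - Ω y * sch G y X Y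
      + Ω y ^ 3 * matter G T y X Y := by
  have e := h.conformal_einstein hy hp X Y
  rw [h.normSq_eq hy hp] at e
  refine mul_left_cancel₀ hp.ne' ?_
  linear_combination e

lemma CompletionOn.fderiv_normRatio (h : CompletionOn G U Ω T) (hy : y ∈ U) (hp : 0 < Ω y)
    (X : Coord) : fderiv ℝ (normRatio G T Ω) y X = - sch G y X (grad G Ω y)
      + Ω y ^ 2 * matter G T y X (grad G Ω y) := by
  have hO := h.metric.isOpen
  have hn := diffAt hO (contDiffOn_grad h.metric h.smooth) hy
  have hf := diffAt hO h.smooth hy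
  have hf2 := diffAt hO (contDiffOn_fderiv hO h.smooth) hy
  have hr := diffAt hO h.contDiffOn_normRatio hy
  have e := congrArg (fun T : Coord →L[ℝ] ℝ => T X)
    (fderiv_congr_on h.isOpen_pos (fun z hz => h.normSq_eq hz.1 hz.2) ⟨hy, hp⟩)
  rw [(hf2.hasFDerivAt.clm_apply hn.hasFDerivAt).fderiv,
    (hf.hasFDerivAt.fun_mul hr.hasFDerivAt).fderiv] at e
  simp only [add_apply, ContinuousLinearMap.comp_apply, ContinuousLinearMap.flip_apply,
    smul_apply, smul_eq_mul] at e
  have e2 := met_fderiv_grad h.metric h.smooth hy X (grad G Ω y)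
  rw [map_add, add_apply, met_symm h.metric hy, met_grad h.metric hy, met_symm h.metric hy,
    met_grad h.metric hy] at e2
  have e3 : fderiv ℝ (fderiv ℝ Ω) y X (grad G Ω y)
      = hess G Ω y X (grad G Ω y) + fderiv ℝ Ω y (gam G y X (grad G Ω y)) := by rw [hess]; ring
  have e4 := h.two_hess hy hp X (grad G Ω y)
  rw [met_symm h.metric hy, met_grad h.metric hy] at e4
  refine mul_left_cancel₀ hp.ne' ?_
  linear_combination (-1) * e + e2 + e3 + e4

/-- The matter contribution to the equation for the Weyl tensor. -/
def matterCurl (G T : MatField) (Ω : Coord → ℝ) (y X Y Z : Coord) : ℝ :=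
  3 * (fderiv ℝ Ω y X * matter G T y Y Z - fderiv ℝ Ω y Y * matter G T y X Z)
    + Ω y * (fderiv ℝ (matter G T) y X Y Z - matter G T y Y (gam G y X Z)
      - fderiv ℝ (matter G T) y Y X Z + matter G T y X (gam G y Y Z))
    + matter G T y X (grad G Ω y) * met G y Y Z - matter G T y Y (grad G Ω y) * met G y X Z

/-- The Ricci identity for the gradient of `f`. -/
lemma ricci_identity (h : MetricOn G U) {f : Coord → ℝ} (hf : ContDiffOn ℝ ∞ f U) (hy : y ∈ U)
    (X Y Z : Coord) : fderiv ℝ (fun z => hess G f z Y Z) y X - fderiv ℝ (fun z => hess G f z X Z) y Y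
      = - fderiv ℝ f y (curv G y X Y Z) - hess G f y X (gam G y Y Z)
        + hess G f y Y (gam G y X Z) := by
  have hg := diffAt h.isOpen (contDiffOn_gam h) hy
  have c1 := contDiffOn_fderiv h.isOpen hf
  have hf1 := diffAt h.isOpen c1 hy
  have hf2 := diffAt h.isOpen (contDiffOn_fderiv h.isOpen c1) hy
  have hd : ∀ A B W, fderiv ℝ (fun z => hess G f z A B) y W
      = fderiv ℝ (fderiv ℝ (fderiv ℝ f)) y W A B - fderiv ℝ (fderiv ℝ f) y W (gam G y A B)
        - fderiv ℝ f y (fderiv ℝ (gam G) y W A B) := by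
    intro A B W
    have : fderiv ℝ (fun z => hess G f z A B) y = _ :=
      ((hasFDerivAt_eval₂ hf2 A B).fun_sub
        (hf1.hasFDerivAt.clm_apply (hasFDerivAt_eval₂ hg A B))).fderiv
    rw [this]
    simp
    ring
  have c2 := congrArg (fun T : Coord →L[ℝ] ℝ => T Z) (fderiv_fderiv_comm h.isOpen c1 hy X Y)
  rw [hd, hd, c2]
  simp only [curv_apply, hess, map_add, map_sub]
  ring

/-- The contraction of the Weyl tensor with the normal. -/
lemma CompletionOn.two_wey_grad (h : CompletionOn G U Ω T) (hy : y ∈ U) (hp : 0 < Ω y)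
    (X Y Z : Coord) : 2 * wey G y (grad G Ω y) Z X Y = Ω y * cotton G y X Y Z
      - Ω y ^ 2 * matterCurl G T Ω y X Y Z := by
  have hO := h.metric.isOpen
  have hm := diffAt hO h.metric.contDiffOn_met hy
  have hs := diffAt hO (contDiffOn_sch h.metric) hy
  have ht := diffAt hO h.contDiffOn_matter hy
  have hf := diffAt hO h.smooth hy
  have hr := diffAt hO h.contDiffOn_normRatio hy
  have hh := fun A B => diffAt hO (contDiffOn_hess h.metric h.smooth A B) hy
  have key : ∀ W A B, 2 * fderiv ℝ (fun z => hess G Ω z A B) y W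
      = fderiv ℝ (normRatio G T Ω) y W * met G y A B
        + normRatio G T Ω y * fderiv ℝ (met G) y W A B
        - fderiv ℝ Ω y W * sch G y A B - Ω y * fderiv ℝ (sch G) y W A B
        + 3 * Ω y ^ 2 * fderiv ℝ Ω y W * matter G T y A B
        + Ω y ^ 3 * fderiv ℝ (matter G T) y W A B := by
    intro W A B
    have e := congrArg (fun T : Coord →L[ℝ] ℝ => T W)
      (fderiv_congr_on h.isOpen_pos (fun z hz => h.two_hess hz.1 hz.2 A B) ⟨hy, hp⟩)
    rw [((hh A B).hasFDerivAt.const_mul 2).fderiv,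
      (((hr.hasFDerivAt.fun_mul (hasFDerivAt_eval₂ hm A B)).fun_sub
        (hf.hasFDerivAt.fun_mul (hasFDerivAt_eval₂ hs A B))).fun_add
        ((hf.hasFDerivAt.pow 3).fun_mul (hasFDerivAt_eval₂ ht A B))).fderiv] at e
    simp at e
    rw [e]
    ring
  have k1 := key X Y Z
  have k2 := key Y X Z
  have ri := ricci_identity h.metric h.smooth hy X Y Z
  have t1 := h.two_hess hy hp X (gam G y Y Z)
  have t2 := h.two_hess hy hp Y (gam G y X Z)
  rw [h.fderiv_normRatio hy hp, fderiv_met h.metric hy] at k1 k2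
  rw [wey_apply h.metric hy, met_grad h.metric hy, met_grad h.metric hy, met_grad h.metric hy,
    cotton, covSch, covSch, matterCurl, sch_symm h.metric hy Z Y, sch_symm h.metric hy Z X,
    met_symm h.metric hy Z Y, met_symm h.metric hy Z X, gam_symm h.metric hy Y X,
    sch_symm h.metric hy (grad G Ω y), sch_symm h.metric hy (grad G Ω y)]
  rw [gam_symm h.metric hy Y X] at k2
  linear_combination k2 - k1 + 2 * ri - t1 + t2

/-! ### Consequences at infinity -/

lemma CompletionOn.grad_null (h : CompletionOn G U Ω T) (hy : y ∈ U) (h0 : Ω y = 0) :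
    met G y (grad G Ω y) (grad G Ω y) = 0 := by
  have c := contDiffOn_grad h.metric h.smooth
  have := h.eq_zero_of_pos hy h0
    (f := fun z => fderiv ℝ Ω z (grad G Ω z) - Ω z * normRatio G T Ω z)
    (((contDiffOn_fderiv h.metric.isOpen h.smooth).clm_apply c).sub
      (h.smooth.mul h.contDiffOn_normRatio)).continuousOn
    (fun z hz hp => by rw [h.normSq_eq hz hp, sub_self])
  rw [met_grad h.metric hy]
  simpa [h0] using this

lemma CompletionOn.grad_ne_zero (h : CompletionOn G U Ω T) (hy : y ∈ U) (h0 : Ω y = 0) :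
    grad G Ω y ≠ 0 := by
  intro hn
  refine h.regular y hy h0 ?_
  ext1 X
  rw [← met_grad h.metric hy, hn]
  simp

lemma CompletionOn.hess_scri (h : CompletionOn G U Ω T) (hy : y ∈ U) (h0 : Ω y = 0)
    (X Y : Coord) : 2 * hess G Ω y X Y = normRatio G T Ω y * met G y X Y := by
  have := h.eq_zero_of_pos hy h0
    (f := fun z => 2 * hess G Ω z X Y - (normRatio G T Ω z * met G z X Y - Ω z * sch G z X Y
      + Ω z ^ 3 * matter G T z X Y))
    ((contDiffOn_const.mul (contDiffOn_hess h.metric h.smooth X Y)).sub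
      (((h.contDiffOn_normRatio.mul (contDiffOn_eval₂ h.metric.contDiffOn_met X Y)).sub
      (h.smooth.mul (contDiffOn_eval₂ (contDiffOn_sch h.metric) X Y))).add
      ((h.smooth.pow 3).mul (contDiffOn_eval₂ h.contDiffOn_matter X Y)))).continuousOn
    (fun z hz hp => by rw [h.two_hess hz hp, sub_self])
  simp only [h0] at this
  linear_combination this

lemma CompletionOn.normRatio_scri (h0 : Ω y = 0) :
    normRatio G T Ω y = (1 / 2) * trg (G y) (hess G Ω y) := by
  rw [normRatio, h0]; ring

lemma CompletionOn.fderiv_normRatio_scri (h : CompletionOn G U Ω T) (hy : y ∈ U) (h0 : Ω y = 0)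
    (X : Coord) : fderiv ℝ (normRatio G T Ω) y X = - sch G y X (grad G Ω y) := by
  have c := contDiffOn_grad h.metric h.smooth
  have hX : ContDiffOn ℝ ∞ (fun _ : Coord => X) U := contDiffOn_const
  have := h.eq_zero_of_pos hy h0
    (f := fun z => fderiv ℝ (normRatio G T Ω) z X - (- sch G z X (grad G Ω z)
      + Ω z ^ 2 * matter G T z X (grad G Ω z)))
    (((contDiffOn_fderiv h.metric.isOpen h.contDiffOn_normRatio).clm_apply hX).sub
      ((((contDiffOn_sch h.metric).clm_apply hX).clm_apply c).neg.add
      ((h.smooth.pow 2).mul ((h.contDiffOn_matter.clm_apply hX).clm_apply c)))).continuousOn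
    (fun z hz hp => by rw [h.fderiv_normRatio hz hp, sub_self])
  simp only [h0] at this
  linear_combination this

lemma contDiffOn_covSch (h : MetricOn G U) (X Y Z : Coord) :
    ContDiffOn ℝ ∞ (fun y => covSch G y X Y Z) U := by
  have c := contDiffOn_sch h
  have hg : ∀ A B, ContDiffOn ℝ ∞ (fun y => gam G y A B) U := fun A B =>
    ((contDiffOn_gam h).clm_apply contDiffOn_const).clm_apply contDiffOn_const
  exact ((contDiffOn_eval₂ ((contDiffOn_fderiv h.isOpen c).clm_apply contDiffOn_const) Y Z).sub
    ((c.clm_apply (hg X Y)).clm_apply contDiffOn_const)).sub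
    ((c.clm_apply contDiffOn_const).clm_apply (hg X Z))

lemma contDiffOn_cotton (h : MetricOn G U) (X Y Z : Coord) :
    ContDiffOn ℝ ∞ (fun y => cotton G y X Y Z) U :=
  (contDiffOn_covSch h X Y Z).sub (contDiffOn_covSch h Y X Z)

lemma CompletionOn.contDiffOn_matterCurl (h : CompletionOn G U Ω T) (X Y Z : Coord) :
    ContDiffOn ℝ ∞ (fun y => matterCurl G T Ω y X Y Z) U := by
  have c := h.contDiffOn_matter
  have hO := h.metric.isOpen
  have hg : ∀ A B, ContDiffOn ℝ ∞ (fun y => gam G y A B) U := fun A B =>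
    ((contDiffOn_gam h.metric).clm_apply contDiffOn_const).clm_apply contDiffOn_const
  have hN := contDiffOn_grad h.metric h.smooth
  have hf : ∀ A, ContDiffOn ℝ ∞ (fun y => fderiv ℝ Ω y A) U := fun A =>
    (contDiffOn_fderiv hO h.smooth).clm_apply contDiffOn_const
  have ht := contDiffOn_eval₂ c
  have hm := contDiffOn_eval₂ h.metric.contDiffOn_met
  have hd : ∀ A B C, ContDiffOn ℝ ∞ (fun y => fderiv ℝ (matter G T) y A B C) U := fun A B C =>
    contDiffOn_eval₂ ((contDiffOn_fderiv hO c).clm_apply contDiffOn_const) B C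
  have ha : ∀ A {v : Coord → Coord}, ContDiffOn ℝ ∞ v U →
      ContDiffOn ℝ ∞ (fun y => matter G T y A (v y)) U := fun A v hv =>
    (c.clm_apply contDiffOn_const).clm_apply hv
  exact (((contDiffOn_const.mul (((hf X).mul (ht Y Z)).sub ((hf Y).mul (ht X Z)))).add
    (h.smooth.mul ((((hd X Y Z).sub (ha Y (hg X Z))).sub (hd Y X Z)).add (ha X (hg Y Z))))).add
    ((ha X hN).mul (hm Y Z))).sub ((ha Y hN).mul (hm X Z))

lemma contDiffOn_wey_eval (h : MetricOn G U) {v : Coord → Coord} (hv : ContDiffOn ℝ ∞ v U)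
    (Z X Y : Coord) : ContDiffOn ℝ ∞ (fun y => wey G y (v y) Z X Y) U :=
  ((((contDiffOn_wey h).clm_apply hv).clm_apply contDiffOn_const).clm_apply
    contDiffOn_const).clm_apply contDiffOn_const

/-- The Weyl tensor has the normal as a repeated principal direction at infinity. -/
lemma CompletionOn.wey_grad_scri (h : CompletionOn G U Ω T) (hy : y ∈ U) (h0 : Ω y = 0)
    (Z X Y : Coord) : wey G y (grad G Ω y) Z X Y = 0 := by
  have := h.eq_zero_of_pos hy h0
    (f := fun z => 2 * wey G z (grad G Ω z) Z X Y - (Ω z * cotton G z X Y Z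
      - Ω z ^ 2 * matterCurl G T Ω z X Y Z))
    ((contDiffOn_const.mul (contDiffOn_wey_eval h.metric (contDiffOn_grad h.metric h.smooth)
      Z X Y)).sub ((h.smooth.mul (contDiffOn_cotton h.metric X Y Z)).sub
      ((h.smooth.pow 2).mul (h.contDiffOn_matterCurl X Y Z)))).continuousOn
    (fun z hz hp => by rw [h.two_wey_grad hz hp, sub_self])
  simp only [h0] at this
  linear_combination (1 / 2) * this

lemma CompletionOn.covWey_grad_scri (h : CompletionOn G U Ω T) (hy : y ∈ U) (h0 : Ω y = 0)
    (hH : ∀ A B, hess G Ω y A B = 0) (V Z X Y : Coord) :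
    2 * covWey G y V (grad G Ω y) Z X Y = fderiv ℝ Ω y V * cotton G y X Y Z := by
  have hO := h.metric.isOpen
  have c := contDiffOn_grad h.metric h.smooth
  have cc := contDiffOn_cotton h.metric X Y Z
  have cm := h.contDiffOn_matterCurl X Y Z
  have := h.fderiv_eq_zero_of_pos hy h0
    (f := fun z => 2 * wey G z (grad G Ω z) Z X Y - (Ω z * cotton G z X Y Z
      - Ω z ^ 2 * matterCurl G T Ω z X Y Z))
    ((contDiffOn_const.mul (contDiffOn_wey_eval h.metric c Z X Y)).sub
      ((h.smooth.mul cc).sub ((h.smooth.pow 2).mul cm)))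
    (fun z hz hp => by rw [h.two_wey_grad hz hp, sub_self])
  have hf := (diffAt hO h.smooth hy).hasFDerivAt
  have hw := (((((diffAt hO (contDiffOn_wey h.metric) hy).hasFDerivAt.clm_apply
    (diffAt hO c hy).hasFDerivAt).clm_apply (hasFDerivAt_const Z y)).clm_apply
    (hasFDerivAt_const X y)).clm_apply (hasFDerivAt_const Y y))
  rw [((hw.const_mul 2).fun_sub ((hf.fun_mul (diffAt hO cc hy).hasFDerivAt).fun_sub
    ((hf.pow 2).fun_mul (diffAt hO cm hy).hasFDerivAt))).fderiv] at this
  have e := DFunLike.congr_fun this V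
  simp [h0] at e
  have hN : fderiv ℝ (grad G Ω) y V = - gam G y V (grad G Ω y) := by
    refine eq_neg_of_add_eq_zero_left (nondegenerate h.metric hy fun B => ?_)
    rw [met_fderiv_grad h.metric h.smooth hy, hH]
  rw [hN] at e
  simp only [map_neg, neg_apply] at e
  rw [covWey, h.wey_grad_scri hy h0, h.wey_grad_scri hy h0, h.wey_grad_scri hy h0]
  linear_combination e

end

section

/-! ### Lorentzian linear algebra -/

/-- Bilinear forms on the coordinate space. -/
abbrev Form2 : Type := Coord →L[ℝ] Coord →L[ℝ] ℝ

/-- Four-linear forms on the coordinate space. -/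
abbrev Form4 : Type := Coord →L[ℝ] Coord →L[ℝ] Coord →L[ℝ] Coord →L[ℝ] ℝ

/-- `B` is a bilinear form of signature `(-,+,+,+)`. -/
def IsLorentzForm (B : Form2) : Prop :=
  ∃ f : Module.Basis (Fin 4) ℝ Coord,
    ∀ a b, B (f a) (f b) = Matrix.diagonal ![(-1 : ℝ), 1, 1, 1] a b

lemma IsLorentzForm.exists_coords {B : Form2} (hB : IsLorentzForm B) :
    ∃ f : Module.Basis (Fin 4) ℝ Coord, ∀ v w, B v w = - (f.repr v 0 * f.repr w 0)
      + f.repr v 1 * f.repr w 1 + f.repr v 2 * f.repr w 2 + f.repr v 3 * f.repr w 3 := by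
  obtain ⟨f, hf⟩ := hB
  refine ⟨f, fun v w => ?_⟩
  conv_lhs => rw [← f.sum_repr v, ← f.sum_repr w]
  rw [Fin.sum_univ_four, Fin.sum_univ_four]
  simp only [map_add, map_smul, add_apply, smul_apply, smul_eq_mul, hf]
  simp
  ring

lemma IsLorentzForm.symm {B : Form2} (hB : IsLorentzForm B) (v w : Coord) : B v w = B w v := by
  obtain ⟨f, hf⟩ := hB.exists_coords
  rw [hf, hf]; ring

/-- A vector orthogonal to a null vector is spacelike or a multiple of it. -/
lemma IsLorentzForm.null_orthogonal {B : Form2} (hB : IsLorentzForm B) {N v : Coord} (hN0 : N ≠ 0)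
    (hN : B N N = 0) (hv : B v N = 0) : 0 ≤ B v v ∧ (B v v ≤ 0 → ∃ c : ℝ, v = c • N) := by
  obtain ⟨f, hf⟩ := hB.exists_coords
  rw [hf] at hN hv
  rw [hf]
  set n := f.repr N with hn
  set a := f.repr v with ha
  have n0 : n 0 ≠ 0 := by
    intro h0
    rw [h0] at hN
    refine hN0 (f.ext_elem fun i => ?_)
    have h1 : n 1 = 0 := by nlinarith [sq_nonneg (n 1), sq_nonneg (n 2), sq_nonneg (n 3)]
    have h2 : n 2 = 0 := by nlinarith [sq_nonneg (n 1), sq_nonneg (n 2), sq_nonneg (n 3)]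
    have h3 : n 3 = 0 := by nlinarith [sq_nonneg (n 1), sq_nonneg (n 2), sq_nonneg (n 3)]
    fin_cases i <;> simp [← hn, h0, h1, h2, h3]
  have key : n 0 ^ 2 * (-(a 0 * a 0) + a 1 * a 1 + a 2 * a 2 + a 3 * a 3)
      = (n 0 * a 1 - a 0 * n 1) ^ 2 + (n 0 * a 2 - a 0 * n 2) ^ 2
        + (n 0 * a 3 - a 0 * n 3) ^ 2 := by
    linear_combination 2 * n 0 * a 0 * hv - a 0 ^ 2 * hN
  have p : 0 < n 0 ^ 2 := by positivity
  refine ⟨?_, fun hle => ⟨a 0 / n 0, f.ext_elem fun i => ?_⟩⟩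
  · refine (mul_nonneg_iff_of_pos_left p).1 ?_
    rw [key]; positivity
  · have hz : n 0 ^ 2 * (-(a 0 * a 0) + a 1 * a 1 + a 2 * a 2 + a 3 * a 3) ≤ 0 :=
      mul_nonpos_of_nonneg_of_nonpos p.le hle
    rw [key] at hz
    have q1 := sq_nonneg (n 0 * a 1 - a 0 * n 1)
    have q2 := sq_nonneg (n 0 * a 2 - a 0 * n 2)
    have q3 := sq_nonneg (n 0 * a 3 - a 0 * n 3)
    have h1 : n 0 * a 1 - a 0 * n 1 = 0 := pow_eq_zero_iff two_ne_zero |>.1 (by linarith)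
    have h2 : n 0 * a 2 - a 0 * n 2 = 0 := pow_eq_zero_iff two_ne_zero |>.1 (by linarith)
    have h3 : n 0 * a 3 - a 0 * n 3 = 0 := pow_eq_zero_iff two_ne_zero |>.1 (by linarith)
    simp only [map_smul, Finsupp.smul_apply, smul_eq_mul, ← hn, ← ha]
    fin_cases i
    · change a 0 = a 0 / n 0 * n 0
      field_simp
    · change a 1 = a 0 / n 0 * n 1
      field_simp; linarith
    · change a 2 = a 0 / n 0 * n 2
      field_simp; linarith
    · change a 3 = a 0 / n 0 * n 3
      field_simp; linarith

/-- A frame adapted to a null vector `N` and a transverse vector `w`. -/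
structure NullFrame (B : Form2) (N w e₁ e₂ : Coord) : Prop where
  symm : ∀ v v', B v v' = B v' v
  NN : B N N = 0
  wN : B w N = 1
  N1 : B e₁ N = 0
  N2 : B e₂ N = 0
  w1 : B e₁ w = 0
  w2 : B e₂ w = 0
  e11 : B e₁ e₁ = 1
  e22 : B e₂ e₂ = 1
  e12 : B e₁ e₂ = 0
  complete : ∀ v, v = (B v w - B w w * B v N) • N + B v N • w + B v e₁ • e₁ + B v e₂ • e₂

lemma IsLorentzForm.nullFrame {B : Form2} (hB : IsLorentzForm B) {N w e₁ e₂ : Coord} (hN0 : N ≠ 0)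
    (NN : B N N = 0) (wN : B w N = 1) (N1 : B e₁ N = 0) (N2 : B e₂ N = 0) (w1 : B e₁ w = 0)
    (w2 : B e₂ w = 0) (e11 : B e₁ e₁ = 1) (e22 : B e₂ e₂ = 1) (e12 : B e₁ e₂ = 0) :
    NullFrame B N w e₁ e₂ := by
  refine ⟨hB.symm, NN, wN, N1, N2, w1, w2, e11, e22, e12, fun v => ?_⟩
  have s := hB.symm
  have li : LinearIndependent ℝ ![N, w, e₁, e₂] := by
    rw [Fintype.linearIndependent_iff]
    intro c hc
    simp only [Fin.sum_univ_four, Matrix.cons_val_zero, Matrix.cons_val_one, Matrix.cons_val] at hc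
    have pair : ∀ u, c 0 * B N u + c 1 * B w u + c 2 * B e₁ u + c 3 * B e₂ u = 0 := by
      intro u
      have := congrArg (fun x => B x u) hc
      simpa using this
    have p0 := pair N
    have p1 := pair w
    have p2 := pair e₁
    have p3 := pair e₂
    rw [NN, wN, N1, N2] at p0
    rw [w1, w2, s N w, wN] at p1
    rw [s N, s w, s e₂, N1, w1, e11, e12] at p2
    rw [s N, s w, N2, w2, e22, e12] at p3
    have c1 : c 1 = 0 := by linarith
    have c0 : c 0 = 0 := by rw [c1] at p1; linarith
    intro i
    fin_cases i
    · exact c0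
    · exact c1
    · simpa using p2
    · simpa using p3
  have hspan := li.span_eq_top_of_card_eq_finrank (by simp)
  set v' := v - ((B v w - B w w * B v N) • N + B v N • w + B v e₁ • e₁ + B v e₂ • e₂) with hv'
  have z0 : B v' N = 0 := by
    simp [hv', NN, wN, N1, N2]
  have z1 : B v' w = 0 := by
    simp [hv', w1, w2, s N w, wN]; ring
  have z2 : B v' e₁ = 0 := by
    simp [hv', s N e₁, s w e₁, N1, w1, e11, s e₂ e₁, e12]
  have z3 : B v' e₂ = 0 := by
    simp [hv', s N e₂, s w e₂, N2, w2, e22, e12]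
  have hker : (⊤ : Submodule ℝ Coord) ≤ LinearMap.ker (B v').toLinearMap := by
    rw [← hspan, Submodule.span_le]
    rintro _ ⟨i, rfl⟩
    fin_cases i
    · exact z0
    · exact z1
    · exact z2
    · exact z3
  have hvv : B v' v' = 0 := hker (Submodule.mem_top : v' ∈ ⊤)
  obtain ⟨c, hc⟩ := (hB.null_orthogonal hN0 NN z0).2 hvv.le
  have : c = 0 := by
    rw [hc] at z1
    simpa [s N w, wN] using z1
  rw [this, zero_smul] at hc
  exact sub_eq_zero.1 hc

lemma exists_ne_zero_orthogonal (B : Form2) (a b c : Coord) :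
    ∃ v : Coord, v ≠ 0 ∧ B v a = 0 ∧ B v b = 0 ∧ B v c = 0 := by
  let L : Coord →ₗ[ℝ] (Fin 3 → ℝ) := LinearMap.pi
    ![(B.flip a).toLinearMap, (B.flip b).toLinearMap, (B.flip c).toLinearMap]
  have : LinearMap.ker L ≠ ⊥ := LinearMap.ker_ne_bot_of_finrank_lt (by simp)
  obtain ⟨v, hv, hv0⟩ := (Submodule.ne_bot_iff _).1 this
  have hv' : L v = 0 := hv
  exact ⟨v, hv0, congrFun hv' 0, congrFun hv' 1, congrFun hv' 2⟩

lemma IsLorentzForm.exists_nullFrame {B : Form2} (hB : IsLorentzForm B) {N w : Coord}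
    (hN0 : N ≠ 0) (NN : B N N = 0) (wN : B w N = 1) : ∃ e₁ e₂, NullFrame B N w e₁ e₂ := by
  have s := hB.symm
  have pos : ∀ v, v ≠ 0 → B v N = 0 → B v w = 0 → 0 < B v v := by
    intro v hv h1 h2
    by_contra hle
    obtain ⟨c, hc⟩ := (hB.null_orthogonal hN0 NN h1).2 (not_lt.1 hle)
    rw [hc] at h2
    have : c = 0 := by simpa [s N w, wN] using h2
    rw [this, zero_smul] at hc
    exact hv hc
  obtain ⟨v, hv0, hvN, hvw, -⟩ := exists_ne_zero_orthogonal B N w w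
  have pv := pos v hv0 hvN hvw
  have qv : 0 < √(B v v) := Real.sqrt_pos.2 pv
  obtain ⟨u, hu0, huN, huw, huv⟩ := exists_ne_zero_orthogonal B N w v
  have pu := pos u hu0 huN huw
  have qu : 0 < √(B u u) := Real.sqrt_pos.2 pu
  refine ⟨(√(B v v))⁻¹ • v, (√(B u u))⁻¹ • u, hB.nullFrame hN0 NN wN ?_ ?_ ?_ ?_ ?_ ?_ ?_⟩
  · simp [hvN]
  · simp [huN]
  · simp [hvw]
  · simp [huw]
  · simp only [map_smul, smul_apply, smul_eq_mul]
    field_simp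
    rw [Real.sq_sqrt pv.le]
  · simp only [map_smul, smul_apply, smul_eq_mul]
    field_simp
    rw [Real.sq_sqrt pu.le]
  · simp [s v u, huv]

/-- Two orthogonal vectors of equal positive length, tangent to the null hyperplane `N^⊥`, are part
of a frame. -/
lemma IsLorentzForm.exists_nullFrame_of_conformal {B : Form2} (hB : IsLorentzForm B)
    {N X Y : Coord} (hN0 : N ≠ 0) (NN : B N N = 0) (hex : ∃ w, B w N = 1) {c : ℝ} (hc : 0 < c)
    (XN : B X N = 0) (YN : B Y N = 0) (XX : B X X = c) (YY : B Y Y = c) (XY : B X Y = 0) :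
    ∃ w, NullFrame B N w ((√c)⁻¹ • X) ((√c)⁻¹ • Y) := by
  obtain ⟨w, hw⟩ := hex
  have s := hB.symm
  have q : 0 < √c := Real.sqrt_pos.2 hc
  have q2 : √c * √c = c := Real.mul_self_sqrt hc.le
  refine ⟨w - (B w X / c) • X - (B w Y / c) • Y, hB.nullFrame hN0 NN ?_ ?_ ?_ ?_ ?_ ?_ ?_ ?_⟩
  · simp [hw, XN, YN]
  · simp [XN]
  · simp [YN]
  · simp only [map_sub, map_smul, smul_apply, smul_eq_mul, XX, XY, s X w]
    field_simp; ring
  · simp only [map_sub, map_smul, smul_apply, smul_eq_mul, YY, XY, s Y w, s Y X]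
    field_simp; ring
  · simp only [map_smul, smul_apply, smul_eq_mul, XX]
    field_simp; rw [pow_two, q2]
  · simp only [map_smul, smul_apply, smul_eq_mul, YY]
    field_simp; rw [pow_two, q2]
  · simp [XY]

variable {B : Form2} {N w e₁ e₂ : Coord}

lemma NullFrame.tangent (F : NullFrame B N w e₁ e₂) {v : Coord} (hv : B v N = 0) :
    v = B v w • N + B v e₁ • e₁ + B v e₂ • e₂ := by
  have := F.complete v
  rw [hv] at this
  simpa using this

lemma NullFrame.exists_tangent (F : NullFrame B N w e₁ e₂) (v : Coord) :
    ∃ u, B u N = 0 ∧ v = B v N • w + u := by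
  refine ⟨v - B v N • w, ?_, by abel⟩
  simp [F.wN]

/-- A trace in terms of a null frame. -/
lemma NullFrame.trg_eq {G : MatField} {U : Set Coord} {y : Coord} (h : MetricOn G U) (hy : y ∈ U)
    (F : NullFrame (met G y) N w e₁ e₂) (S : Form2) :
    trg (G y) (fun X Y => S X Y) = S N w + S w N - met G y w w * S N N + S e₁ e₁ + S e₂ e₂ := by
  have e : ∀ X Y, S X Y = met G y X w * S N Y - met G y w w * (met G y X N * S N Y)
      + met G y X N * S w Y + met G y X e₁ * S e₁ Y + met G y X e₂ * S e₂ Y := by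
    intro X Y
    conv_lhs => rw [F.complete X]
    simp only [map_add, map_smul, add_apply, smul_apply, smul_eq_mul]
    ring
  have : (fun X Y => S X Y) = fun X Y => met G y X w * S N Y
      - met G y w w * (met G y X N * S N Y)
      + met G y X N * S w Y + met G y X e₁ * S e₁ Y + met G y X e₂ * S e₂ Y := by
    funext X Y; exact e X Y
  rw [this, trg_add, trg_add, trg_add, trg_sub, trg_smul]
  simp only [trg_met_left h hy]
  ring

/-! ### Algebra of Weyl-type tensors -/

/-- The algebraic symmetries of the Weyl tensor, with respect to the metric `h`. -/
structure WeylType (h : Matrix (Fin 4) (Fin 4) ℝ) (C : Form4) : Prop where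
  antisymm : ∀ L K I J, C L K I J = - C L K J I
  pair : ∀ L K I J, C L K I J = C I J L K
  cyclic : ∀ L K I J, C L K I J + C L I J K + C L J K I = 0
  trace : ∀ K J, trg h (fun X Y => C X K Y J) = 0

variable {C : Form4} {G : MatField} {U : Set Coord} {y : Coord}

lemma WeylType.antisymm_left {h : Matrix (Fin 4) (Fin 4) ℝ} (hC : WeylType h C) (L K I J : Coord) :
    C L K I J = - C K L I J := by
  rw [hC.pair, hC.antisymm, hC.pair]

lemma WeylType.self_left {h : Matrix (Fin 4) (Fin 4) ℝ} (hC : WeylType h C) (L I J : Coord) :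
    C L L I J = 0 := by
  have := hC.antisymm_left L L I J
  linarith

lemma WeylType.self_right {h : Matrix (Fin 4) (Fin 4) ℝ} (hC : WeylType h C) (L K I : Coord) :
    C L K I I = 0 := by
  have := hC.antisymm L K I I
  linarith

lemma WeylType.frame_trace (h : MetricOn G U) (hy : y ∈ U) (hC : WeylType (G y) C)
    (F : NullFrame (met G y) N w e₁ e₂) (K J : Coord) :
    C N K w J + C w K N J - met G y w w * C N K N J + C e₁ K e₁ J + C e₂ K e₂ J = 0 := by
  let S : Form2 := bilin fun i j => C (basisVec i) K (basisVec j) J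
  have hS : ∀ X Y, S X Y = C X K Y J := by
    intro X Y
    refine bilin_eq (f := fun X Y => C X K Y J) ?_ ?_ X Y
    all_goals intro _; constructor <;> intros <;> simp
  have := F.trg_eq h hy S
  simp only [hS, hC.trace] at this
  linarith

/-- If the normal annihilates a Weyl-type tensor, so does the bivector of any two tangent
vectors. -/
lemma WeylType.tangent_eq_zero (h : MetricOn G U) (hy : y ∈ U) (hC : WeylType (G y) C)
    (F : NullFrame (met G y) N w e₁ e₂) (hN : ∀ Z X Y, C N Z X Y = 0) {X Y : Coord}
    (hX : met G y X N = 0) (hY : met G y Y N = 0) (I J : Coord) : C X Y I J = 0 := by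
  have N2 : ∀ A D E, C A N D E = 0 := fun A D E => by rw [hC.antisymm_left, hN, neg_zero]
  have N3 : ∀ A D E, C A D N E = 0 := fun A D E => by rw [hC.pair, hN]
  have N4 : ∀ A D E, C A D E N = 0 := fun A D E => by rw [hC.pair, N2]
  have t1 : ∀ J, C e₁ e₂ e₁ J = 0 := by
    intro J
    have := hC.frame_trace h hy F e₂ J
    rw [hN, hN, N3, hC.self_left] at this
    linarith
  have t2 : ∀ J, C e₁ e₂ e₂ J = 0 := by
    intro J
    have := hC.frame_trace h hy F e₁ J
    rw [hN, hN, N3, hC.self_left, hC.antisymm_left e₂] at this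
    linarith
  have t3 : ∀ I, C e₁ e₂ I e₁ = 0 := fun I => by rw [hC.antisymm, t1, neg_zero]
  have t4 : ∀ I, C e₁ e₂ I e₂ = 0 := fun I => by rw [hC.antisymm, t2, neg_zero]
  have t5 : ∀ I J, C e₁ e₂ I J = 0 := by
    intro I J
    rw [F.complete I, F.complete J]
    simp only [map_add, map_smul, add_apply, smul_apply, N3, t1, t2, N4, t3, t4, hC.self_right]
    simp
  have t6 : ∀ I J, C e₂ e₁ I J = 0 := fun I J => by rw [hC.antisymm_left, t5, neg_zero]
  rw [F.tangent hX, F.tangent hY]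
  simp only [map_add, map_smul, add_apply, smul_apply, hN, N2, t5, t6, hC.self_left]
  simp

/-- If the normal annihilates a Weyl-type tensor and its transverse part vanishes, then it
vanishes. -/
lemma WeylType.eq_zero (h : MetricOn G U) (hy : y ∈ U) (hC : WeylType (G y) C)
    (F : NullFrame (met G y) N w e₁ e₂) (hN : ∀ Z X Y, C N Z X Y = 0)
    (hK : ∀ X Y, met G y X N = 0 → met G y Y N = 0 → C w X w Y = 0) (L K I J : Coord) :
    C L K I J = 0 := by
  have t : ∀ {X Y}, met G y X N = 0 → met G y Y N = 0 → ∀ I J, C X Y I J = 0 :=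
    fun hX hY => hC.tangent_eq_zero h hy F hN hX hY
  have t' : ∀ {X Y}, met G y X N = 0 → met G y Y N = 0 → ∀ I J, C I J X Y = 0 :=
    fun hX hY I J => by rw [hC.pair, t hX hY]
  obtain ⟨l, hl, el⟩ := F.exists_tangent L
  obtain ⟨k, hk, ek⟩ := F.exists_tangent K
  obtain ⟨i, hi, ei⟩ := F.exists_tangent I
  obtain ⟨j, hj, ej⟩ := F.exists_tangent J
  rw [el, ek, ei, ej]
  simp only [map_add, map_smul, add_apply, smul_apply, hC.self_left, hC.self_right, t hl hk,
    t' hi hj, hC.antisymm _ _ _ w, hC.antisymm_left _ w, hK _ _ hk hj, hK _ _ hk hi, hK _ _ hl hj,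
    hK _ _ hl hi]
  simp

lemma WeylType.trace_free (h : MetricOn G U) (hy : y ∈ U) (hL : IsLorentzForm (met G y))
    (hC : WeylType (G y) C) (hN0 : N ≠ 0) (NN : met G y N N = 0) (hw : met G y w N = 1)
    (hN : ∀ Z X Y, C N Z X Y = 0) {c : ℝ} (hc : 0 < c) {X Y : Coord} (XN : met G y X N = 0)
    (YN : met G y Y N = 0) (XX : met G y X X = c) (YY : met G y Y Y = c) (XY : met G y X Y = 0) :
    C w X w X + C w Y w Y = 0 := by
  obtain ⟨w', F⟩ := hL.exists_nullFrame_of_conformal hN0 NN ⟨w, hw⟩ hc XN YN XX YY XY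
  have := hC.frame_trace h hy F w w
  rw [hN, hN, hC.pair w', hN] at this
  simp only [map_smul, smul_apply, smul_eq_mul] at this
  rw [hC.antisymm_left X, hC.antisymm_left Y, hC.antisymm w, hC.antisymm w Y] at this
  have q : (√c)⁻¹ ≠ 0 := inv_ne_zero (Real.sqrt_pos.2 hc).ne'
  have : (√c)⁻¹ * (√c)⁻¹ * (C w X w X + C w Y w Y) = 0 := by linarith
  simpa [q] using this

/-- In four dimensions a Weyl-type tensor is determined on `(w, Z, Y, X)`, with `X, Y, Z` tangent to
the null hyperplane, by its contraction with the normal. -/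
lemma WeylType.transverse_eq (h : MetricOn G U) (hy : y ∈ U) (hC : WeylType (G y) C)
    (F : NullFrame (met G y) N w e₁ e₂) {X Y Z : Coord} (hX : met G y X N = 0)
    (hY : met G y Y N = 0) (hZ : met G y Z N = 0) :
    C w Z Y X = -(met G y w w * C N Z X Y - met G y Z w * C N w X Y + met G y w Y * C N Z w X
      - met G y Z Y * C N w w X + met G y w X * C N Z Y w - met G y Z X * C N w Y w) := by
  have tr := hC.frame_trace h hy F
  have T1 := tr N N
  have T2 := tr N w
  have T3 := tr N e₁
  have T4 := tr N e₂
  have T5 := tr w e₁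
  have T6 := tr w e₂
  have T7 := tr e₁ e₁
  have T8 := tr e₁ e₂
  have T9 := tr e₂ e₂
  have l1 : ∀ I J, C w N I J = - C N w I J := fun I J => hC.antisymm_left _ _ _ _
  have l2 : ∀ I J, C e₁ N I J = - C N e₁ I J := fun I J => hC.antisymm_left _ _ _ _
  have l3 : ∀ I J, C e₂ N I J = - C N e₂ I J := fun I J => hC.antisymm_left _ _ _ _
  have l4 : ∀ I J, C e₁ w I J = - C w e₁ I J := fun I J => hC.antisymm_left _ _ _ _
  have l5 : ∀ I J, C e₂ w I J = - C w e₂ I J := fun I J => hC.antisymm_left _ _ _ _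
  have l6 : ∀ I J, C e₂ e₁ I J = - C e₁ e₂ I J := fun I J => hC.antisymm_left _ _ _ _
  have r1 : ∀ I J, C I J w N = - C I J N w := fun I J => hC.antisymm _ _ _ _
  have r2 : ∀ I J, C I J e₁ N = - C I J N e₁ := fun I J => hC.antisymm _ _ _ _
  have r3 : ∀ I J, C I J e₂ N = - C I J N e₂ := fun I J => hC.antisymm _ _ _ _
  have r4 : ∀ I J, C I J e₁ w = - C I J w e₁ := fun I J => hC.antisymm _ _ _ _
  have r5 : ∀ I J, C I J e₂ w = - C I J w e₂ := fun I J => hC.antisymm _ _ _ _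
  have r6 : ∀ I J, C I J e₂ e₁ = - C I J e₁ e₂ := fun I J => hC.antisymm _ _ _ _
  have z1 := hC.self_left
  have z2 := hC.self_right
  have p := hC.pair
  simp only [l1, l2, l3, l4, l5, l6, r1, r2, r3, r4, r5, r6, z1, z2, p w e₁ N w, p w e₂ N w,
    p e₁ e₂ N w, p N e₁ N w, p N e₂ N w, p N e₂ N e₁, p w e₁ N e₁, p w e₂ N e₁, p e₁ e₂ N e₁,
    p w e₁ N e₂, p w e₂ N e₂, p e₁ e₂ N e₂, p w e₂ w e₁, p e₁ e₂ w e₁, p e₁ e₂ w e₂]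
    at T1 T2 T3 T4 T5 T6 T7 T8 T9
  have e0 : ∀ {V}, met G y V N = 0 → V = met G y V w • N + met G y V e₁ • e₁ + met G y V e₂ • e₂ :=
    fun hV => F.tangent hV
  have hX' := e0 hX
  have hY' := e0 hY
  have hZ' := e0 hZ
  generalize met G y X w = x0 at hX'
  generalize met G y X e₁ = x1 at hX'
  generalize met G y X e₂ = x2 at hX'
  generalize met G y Y w = y0 at hY'
  generalize met G y Y e₁ = y1 at hY'
  generalize met G y Y e₂ = y2 at hY'
  generalize met G y Z w = z0 at hZ'
  generalize met G y Z e₁ = z3 at hZ'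
  generalize met G y Z e₂ = z4 at hZ'
  subst hX' hY' hZ'
  simp only [map_add, map_smul, add_apply, smul_apply, smul_eq_mul, F.NN, F.wN, F.N1, F.N2, F.w1,
    F.w2, F.e11, F.e22, F.e12, F.symm N w, F.symm N e₁, F.symm N e₂, F.symm w e₁, F.symm w e₂,
    F.symm e₂ e₁]
  simp only [l1, l2, l3, l4, l5, l6, r1, r2, r3, r4, r5, r6, z1, z2, p w e₁ N w, p w e₂ N w,
    p e₁ e₂ N w, p N e₁ N w, p N e₂ N w, p N e₂ N e₁, p w e₁ N e₁, p w e₂ N e₁, p e₁ e₂ N e₁,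
    p w e₁ N e₂, p w e₂ N e₂, p e₁ e₂ N e₂, p w e₂ w e₁, p e₁ e₂ w e₁, p e₁ e₂ w e₂]
  linear_combination
    ((x0 * y1 - x1 * y0) * z3) * (-T7 + (T7 + T9) / 2 - T2 + met G y w w / 2 * T1)
    + ((x0 * y2 - x2 * y0) * z4) * (-T9 + (T7 + T9) / 2 - T2 + met G y w w / 2 * T1)
    - ((x0 * y1 - x1 * y0) * z4 + (x0 * y2 - x2 * y0) * z3) * T8
    + ((x1 * y2 - x2 * y1) * z3) * (T6 - met G y w w * T4)
    + ((x1 * y2 - x2 * y1) * z4) * (-T5 + met G y w w * T3)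

end

section

variable {G T : MatField} {U : Set Coord} {y : Coord} {Ω : Coord → ℝ}

/-! ### The covariant derivative of the Weyl tensor is of Weyl type -/

lemma fderiv_inv (h : MetricOn G U) (hy : y ∈ U) (V : Coord) (i m : Fin 4) :
    fderiv ℝ (fun z => (G z)⁻¹ i m) y V = - ∑ k, (G y)⁻¹ i k * gam G y V (basisVec k) m
      - ∑ l, gam G y V (basisVec l) i * (G y)⁻¹ l m := by
  have hi := fun a b => (diffAt h.isOpen (contDiffOn_inv h a b) hy).hasFDerivAt
  have hg := fun a b => (diffAt h.isOpen (h.smooth a b) hy).hasFDerivAt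
  have e : ∀ k, ∑ l, G y k l * fderiv ℝ (fun z => (G z)⁻¹ l m) y V
      = - ∑ l, fderiv ℝ (met G) y V (basisVec k) (basisVec l) * (G y)⁻¹ l m := by
    intro k
    have e1 := congrArg (fun T : Coord →L[ℝ] ℝ => T V)
      (fderiv_congr_on h.isOpen (fun z hz => inv_mul_met h hz k m) hy)
    rw [(HasFDerivAt.fun_sum fun l _ => (hg k l).fun_mul (hi l m)).fderiv] at e1
    simp only [sum_apply, add_apply, smul_apply, smul_eq_mul, Finset.sum_add_distrib,
      fderiv_fun_const, Pi.zero_apply, zero_apply] at e1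
    rw [eq_neg_iff_add_eq_zero, ← e1]
    congr 1
    refine Finset.sum_congr rfl fun l _ => ?_
    rw [← fderiv_clm_eval₂ (diffAt h.isOpen h.contDiffOn_met hy)]
    simp only [met_basisVec]
    ring
  have e2 : ∀ k, ∑ l, fderiv ℝ (met G) y V (basisVec k) (basisVec l) * (G y)⁻¹ l m
      = gam G y V (basisVec k) m
        + ∑ l, met G y (basisVec k) (gam G y V (basisVec l)) * (G y)⁻¹ l m := by
    intro k
    simp only [fderiv_met h hy, add_mul, Finset.sum_add_distrib]
    congr 1
    rw [← sum_inv_met h hy m]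
    refine Finset.sum_congr rfl fun l _ => ?_
    rw [met_symm h hy]; ring
  have e3 : fderiv ℝ (fun z => (G z)⁻¹ i m) y V
      = ∑ k, (G y)⁻¹ i k * ∑ l, G y k l * fderiv ℝ (fun z => (G z)⁻¹ l m) y V := by
    have hδ : ∀ l, ∑ k, (G y)⁻¹ i k * G y k l = if i = l then 1 else 0 := by
      intro l
      have := congrFun (congrFun (Matrix.nonsing_inv_mul (G y) (h.det y hy)) i) l
      simpa [Matrix.mul_apply, Matrix.one_apply] using this
    simp only [Finset.mul_sum, ← mul_assoc]
    rw [Finset.sum_comm]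
    simp only [← Finset.sum_mul, hδ]
    simp
  rw [e3]
  simp only [e, e2, mul_neg, mul_add, Finset.sum_neg_distrib, Finset.sum_add_distrib]
  have e4 : ∑ k, (G y)⁻¹ i k * ∑ l, met G y (basisVec k) (gam G y V (basisVec l)) * (G y)⁻¹ l m
      = ∑ l, gam G y V (basisVec l) i * (G y)⁻¹ l m := by
    simp only [Finset.mul_sum]
    rw [Finset.sum_comm]
    refine Finset.sum_congr rfl fun l _ => ?_
    rw [← sum_inv_met h hy i, Finset.sum_mul]
    refine Finset.sum_congr rfl fun k _ => ?_
    rw [inv_symm h hy]; ring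
  rw [e4]
  ring

/-- Traces commute with covariant differentiation. -/
lemma fderiv_trg (h : MetricOn G U) (hy : y ∈ U) (V : Coord) {S : Coord → Form2}
    (hS : DifferentiableAt ℝ S y) :
    fderiv ℝ (fun z => trg (G z) (fun X Y => S z X Y)) y V
      = trg (G y) (fun X Y => fderiv ℝ S y V X Y - S y (gam G y V X) Y - S y X (gam G y V Y)) := by
  have hi := fun a b => (diffAt h.isOpen (contDiffOn_inv h a b) hy).hasFDerivAt
  unfold trg
  rw [(HasFDerivAt.fun_sum fun i _ => HasFDerivAt.fun_sum fun j _ =>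
    (hi i j).fun_mul (hasFDerivAt_eval₂ hS (basisVec i) (basisVec j))).fderiv]
  simp only [sum_apply, add_apply, smul_apply, smul_eq_mul, Finset.sum_add_distrib, mul_sub,
    Finset.sum_sub_distrib, fderiv_inv h hy, ContinuousLinearMap.flip_apply]
  have e1 : ∑ i, ∑ j, S y (basisVec i) (basisVec j)
      * ∑ k, (G y)⁻¹ i k * gam G y V (basisVec k) j
      = ∑ i, ∑ j, (G y)⁻¹ i j * S y (basisVec i) (gam G y V (basisVec j)) := by
    refine Finset.sum_congr rfl fun i _ => ?_
    simp only [Finset.mul_sum]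
    rw [Finset.sum_comm]
    refine Finset.sum_congr rfl fun k _ => ?_
    rw [clm_eq_sum (S y (basisVec i)) (gam G y V (basisVec k)), Finset.mul_sum]
    exact Finset.sum_congr rfl fun j _ => by simp only [smul_eq_mul]; ring
  have e2 : ∑ i, ∑ j, S y (basisVec i) (basisVec j)
      * ∑ l, gam G y V (basisVec l) i * (G y)⁻¹ l j
      = ∑ i, ∑ j, (G y)⁻¹ i j * S y (gam G y V (basisVec i)) (basisVec j) := by
    have : ∀ l j, (G y)⁻¹ l j * S y (gam G y V (basisVec l)) (basisVec j)
        = ∑ i, (G y)⁻¹ l j * (gam G y V (basisVec l) i * S y (basisVec i) (basisVec j)) := by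
      intro l j
      rw [clm_eq_sum (S y) (gam G y V (basisVec l))]
      simp [Finset.mul_sum]
    simp only [this, Finset.mul_sum]
    trans ∑ j, ∑ l, ∑ i,
      (G y)⁻¹ l j * (gam G y V (basisVec l) i * S y (basisVec i) (basisVec j))
    · rw [Finset.sum_comm]
      refine Finset.sum_congr rfl fun j _ => ?_
      rw [Finset.sum_comm]
      exact Finset.sum_congr rfl fun l _ => Finset.sum_congr rfl fun i _ => by ring
    · exact Finset.sum_comm
  simp only [mul_neg, Finset.sum_neg_distrib, e1, e2]
  ring

/-- `∇_V C` as a four-linear form. -/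
def covWeyL (G : MatField) (y V : Coord) : Form4 :=
  quadrilin fun l k i j => covWey G y V (basisVec l) (basisVec k) (basisVec i) (basisVec j)

lemma covWeyL_apply (G : MatField) (y V L K I J : Coord) :
    covWeyL G y V L K I J = covWey G y V L K I J := by
  refine quadrilin_eq (f := fun L K I J => covWey G y V L K I J) ?_ ?_ ?_ ?_ L K I J
  all_goals intro _ _ _; constructor <;> intros <;> simp [covWey] <;> ring

lemma wey_weylType (h : MetricOn G U) (hy : y ∈ U) : WeylType (G y) (wey G y) :=
  ⟨wey_antisymm_right h hy, wey_pair h hy, wey_cyclic h hy, wey_trace h hy⟩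

lemma fderiv_wey_eval (h : MetricOn G U) (hy : y ∈ U) (V L K I J : Coord) :
    fderiv ℝ (fun z => wey G z L K I J) y V = fderiv ℝ (wey G) y V L K I J := by
  have hw := diffAt h.isOpen (contDiffOn_wey h) hy
  rw [fderiv_clm_eval₂ (T := fun z => wey G z L K)
    ((hw.clm_apply (differentiableAt_const _)).clm_apply (differentiableAt_const _)),
    fderiv_clm_eval₂ hw]

lemma covWey_antisymm_right (h : MetricOn G U) (hy : y ∈ U) (V L K I J : Coord) :
    covWey G y V L K I J = - covWey G y V L K J I := by
  have : fderiv ℝ (wey G) y V L K I J = - fderiv ℝ (wey G) y V L K J I := by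
    rw [← fderiv_wey_eval h hy, ← fderiv_wey_eval h hy,
      fderiv_congr_on h.isOpen (fun z hz => wey_antisymm_right h hz L K I J) hy,
      fderiv_fun_neg]
    rfl
  rw [covWey, covWey, this, wey_antisymm_right h hy _ _ I J,
    wey_antisymm_right h hy _ _ I J, wey_antisymm_right h hy _ _ (gam G y V I) J,
    wey_antisymm_right h hy _ _ I (gam G y V J)]
  ring

lemma covWey_pair (h : MetricOn G U) (hy : y ∈ U) (V L K I J : Coord) :
    covWey G y V L K I J = covWey G y V I J L K := by
  have : fderiv ℝ (wey G) y V L K I J = fderiv ℝ (wey G) y V I J L K := by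
    rw [← fderiv_wey_eval h hy, ← fderiv_wey_eval h hy,
      fderiv_congr_on h.isOpen (fun z hz => wey_pair h hz L K I J) hy]
  rw [covWey, covWey, this, wey_pair h hy _ K I J,
    wey_pair h hy L _ I J, wey_pair h hy _ _ (gam G y V I) J, wey_pair h hy _ _ I (gam G y V J)]
  ring

lemma covWey_cyclic_right (h : MetricOn G U) (hy : y ∈ U) (V L K I J : Coord) :
    covWey G y V L K I J + covWey G y V L I J K + covWey G y V L J K I = 0 := by
  have hd : ∀ L K I J, HasFDerivAt (fun z => wey G z L K I J)
      (fderiv ℝ (fun z => wey G z L K I J) y) y := fun L K I J =>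
    (diffAt h.isOpen (contDiffOn_wey_eval h (contDiffOn_const (c := L)) K I J) hy).hasFDerivAt
  have this : fderiv ℝ (wey G) y V L K I J + fderiv ℝ (wey G) y V L I J K
      + fderiv ℝ (wey G) y V L J K I = 0 := by
    have e := congrArg (fun T : Coord →L[ℝ] ℝ => T V)
      (fderiv_congr_on h.isOpen (fun z hz => wey_cyclic h hz L K I J) hy)
    rw [(((hd L K I J).fun_add (hd L I J K)).fun_add (hd L J K I)).fderiv] at e
    simp only [add_apply, fderiv_fun_const, Pi.zero_apply, zero_apply] at e
    rw [← fderiv_wey_eval h hy, ← fderiv_wey_eval h hy, ← fderiv_wey_eval h hy]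
    exact e
  have c1 := wey_cyclic h hy (gam G y V L) K I J
  have c2 := wey_cyclic h hy L (gam G y V K) I J
  have c3 := wey_cyclic h hy L K (gam G y V I) J
  have c4 := wey_cyclic h hy L K I (gam G y V J)
  simp only [covWey]
  linarith

lemma covWey_trace (h : MetricOn G U) (hy : y ∈ U) (V K J : Coord) :
    trg (G y) (fun X Y => covWey G y V X K Y J) = 0 := by
  let S : Coord → Form2 := fun z => bilin fun i j => wey G z (basisVec i) K (basisVec j) J
  have hS : ∀ z X Y, S z X Y = wey G z X K Y J := by
    intro z X Y
    refine bilin_eq (f := fun X Y => wey G z X K Y J) ?_ ?_ X Y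
    all_goals intro _; constructor <;> intros <;> simp
  have hSd : DifferentiableAt ℝ S y :=
    diffAt h.isOpen (contDiffOn_bilin fun i j => contDiffOn_wey_eval h contDiffOn_const K _ J) hy
  have hSf : ∀ X Y, fderiv ℝ S y V X Y = fderiv ℝ (wey G) y V X K Y J := by
    intro X Y
    rw [← fderiv_clm_eval₂ hSd, ← fderiv_wey_eval h hy]
    simp only [hS]
  have e := fderiv_trg h hy V hSd
  have e0 : fderiv ℝ (fun z => trg (G z) (fun X Y => S z X Y)) y V = 0 := by
    rw [fderiv_congr_on (f' := fun _ => (0 : ℝ)) h.isOpen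
      (fun z hz => by simp only [hS]; exact wey_trace h hz K J) hy]
    simp
  rw [e0] at e
  simp only [hS, hSf] at e
  have e3 : ∀ K' J', trg (G y) (fun X Y => wey G y X K' Y J') = 0 := wey_trace h hy
  have : (fun X Y => covWey G y V X K Y J) = fun X Y => (fderiv ℝ (wey G) y V X K Y J
      - wey G y (gam G y V X) K Y J - wey G y X K (gam G y V Y) J)
      - wey G y X (gam G y V K) Y J - wey G y X K Y (gam G y V J) := by
    funext X Y; rw [covWey]; ring
  rw [this, trg_sub, trg_sub, ← e, e3, e3]
  ring

lemma covWeyL_weylType (h : MetricOn G U) (hy : y ∈ U) (V : Coord) :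
    WeylType (G y) (covWeyL G y V) := by
  constructor
  · intro L K I J; rw [covWeyL_apply, covWeyL_apply]; exact covWey_antisymm_right h hy V L K I J
  · intro L K I J; rw [covWeyL_apply, covWeyL_apply]; exact covWey_pair h hy V L K I J
  · intro L K I J
    rw [covWeyL_apply, covWeyL_apply, covWeyL_apply]
    exact covWey_cyclic_right h hy V L K I J
  · intro K J; simp only [covWeyL_apply]; exact covWey_trace h hy V K J

/-! ### The transverse part of the Weyl tensor at infinity -/

/-- The covariant derivative of a field of bilinear forms. -/
def covB (G : MatField) (P : Coord → Form2) (y X Y Z : Coord) : ℝ :=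
  fderiv ℝ P y X Y Z - P y (gam G y X Y) Z - P y Y (gam G y X Z)

/-- A vector field with `dΩ(w) = 1`. -/
def transv (Ω : Coord → ℝ) (y : Coord) : Coord :=
  (∑ i, (pd i Ω y) ^ 2)⁻¹ • ∑ i, pd i Ω y • basisVec i

lemma fderiv_transv (h0 : fderiv ℝ Ω y ≠ 0) : fderiv ℝ Ω y (transv Ω y) = 1 := by
  have hs : ∑ i, (pd i Ω y) ^ 2 ≠ 0 := by
    intro hs
    refine h0 (clm_ext fun i => ?_)
    have := (Finset.sum_eq_zero_iff_of_nonneg (fun i _ => sq_nonneg (pd i Ω y))).1 hs i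
      (Finset.mem_univ i)
    exact pow_eq_zero_iff two_ne_zero |>.1 this
  have : fderiv ℝ Ω y (∑ i, pd i Ω y • basisVec i) = ∑ i, (pd i Ω y) ^ 2 := by
    rw [map_sum]
    exact Finset.sum_congr rfl fun i _ => by rw [map_smul, smul_eq_mul, pow_two]; rfl
  rw [transv, map_smul, this, smul_eq_mul, inv_mul_cancel₀ hs]

lemma contDiffAt_transv (hU : IsOpen U) (hΩ : ContDiffOn ℝ ∞ Ω U) (hy : y ∈ U)
    (h0 : fderiv ℝ Ω y ≠ 0) : ContDiffAt ℝ ∞ (transv Ω) y := by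
  have hp := fun i => smoothAt hU (contDiffOn_pd hU hΩ i) hy
  have hs : ∑ i, (pd i Ω y) ^ 2 ≠ 0 := by
    intro hs
    refine h0 (clm_ext fun i => ?_)
    have := (Finset.sum_eq_zero_iff_of_nonneg (fun i _ => sq_nonneg (pd i Ω y))).1 hs i
      (Finset.mem_univ i)
    exact pow_eq_zero_iff two_ne_zero |>.1 this
  exact ((ContDiffAt.sum fun i _ => (hp i).pow 2).inv hs).smul
    (ContDiffAt.sum fun i _ => (hp i).smul contDiffAt_const)

/-- The transverse part `C(w, ·, w, ·)` of the Weyl tensor. -/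
def weyK (G : MatField) (Ω : Coord → ℝ) (y : Coord) : Form2 :=
  (wey G y (transv Ω y)).flip (transv Ω y)

lemma weyK_apply (G : MatField) (Ω : Coord → ℝ) (y X Y : Coord) :
    weyK G Ω y X Y = wey G y (transv Ω y) X (transv Ω y) Y := rfl

lemma differentiableAt_weyK (h : MetricOn G U) (hΩ : ContDiffOn ℝ ∞ Ω U) (hy : y ∈ U)
    (h0 : fderiv ℝ Ω y ≠ 0) : DifferentiableAt ℝ (weyK G Ω) y := by
  have ht : DifferentiableAt ℝ (transv Ω) y :=
    (contDiffAt_transv h.isOpen hΩ hy h0).differentiableAt (by simp)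
  have hw : DifferentiableAt ℝ (fun z => wey G z (transv Ω z)) y :=
    (diffAt h.isOpen (contDiffOn_wey h) hy).clm_apply ht
  exact ((ContinuousLinearMap.flipₗᵢ ℝ Coord Coord
    (Coord →L[ℝ] ℝ)).toContinuousLinearEquiv.toContinuousLinearMap.differentiableAt.comp y
      hw).clm_apply ht

/-- The Codazzi equation for the transverse part of the Weyl tensor at infinity. -/
lemma CompletionOn.covWey_codazzi (h : CompletionOn G U Ω T) (hy : y ∈ U) (h0 : Ω y = 0)
    (hL : IsLorentzForm (met G y)) (hH : ∀ A B, hess G Ω y A B = 0) {w X Y Z : Coord}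
    (hw : fderiv ℝ Ω y w = 1) (hX : fderiv ℝ Ω y X = 0) (hY : fderiv ℝ Ω y Y = 0)
    (hZ : fderiv ℝ Ω y Z = 0) : covWey G y X w Y w Z - covWey G y Y w X w Z = 0 := by
  have hm := h.metric
  have e : ∀ V, met G y V (grad G Ω y) = fderiv ℝ Ω y V := fun V => by
    rw [met_symm hm hy, met_grad hm hy]
  obtain ⟨e₁, e₂, F⟩ := hL.exists_nullFrame (h.grad_ne_zero hy h0) (h.grad_null hy h0)
    ((e w).trans hw)
  have key := (covWeyL_weylType hm hy w).transverse_eq hm hy F ((e X).trans hX) ((e Y).trans hY)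
    ((e Z).trans hZ)
  simp only [covWeyL_apply] at key
  have g := fun A B D => h.covWey_grad_scri hy h0 hH w A B D
  simp only [hw, one_mul] at g
  have b := covWey_cyclic hm hy w Z X w Y
  have p := covWey_pair hm hy
  have a := covWey_antisymm_right hm hy
  rw [p X w Y w Z, p Y w X w Z]
  rw [a Y w Z X w] at b
  simp only [← g] at b
  rw [met_symm hm hy Z X, met_symm hm hy Z Y] at *
  linear_combination b - key

/-- At infinity, in a divergence-free gauge, the transverse part of the Weyl tensor satisfies the
Codazzi equation. -/
lemma CompletionOn.weyK_codazzi (h : CompletionOn G U Ω T) (hy : y ∈ U) (h0 : Ω y = 0)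
    (hL : IsLorentzForm (met G y)) (hH : ∀ A B, hess G Ω y A B = 0) {X Y Z : Coord}
    (hX : fderiv ℝ Ω y X = 0) (hY : fderiv ℝ Ω y Y = 0) (hZ : fderiv ℝ Ω y Z = 0) :
    covB G (weyK G Ω) y X Y Z - covB G (weyK G Ω) y Y X Z = 0 := by
  have hm := h.metric
  have hO := hm.isOpen
  have hr := h.regular y hy h0
  have hw := fderiv_transv hr
  have e : ∀ V, met G y V (grad G Ω y) = fderiv ℝ Ω y V := fun V => by
    rw [met_symm hm hy, met_grad hm hy]
  obtain ⟨e₁, e₂, F⟩ := hL.exists_nullFrame (h.grad_ne_zero hy h0) (h.grad_null hy h0)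
    ((e (transv Ω y)).trans hw)
  have hWT := wey_weylType hm hy
  have tz : ∀ A B I J, fderiv ℝ Ω y A = 0 → fderiv ℝ Ω y B = 0 → wey G y A B I J = 0 :=
    fun A B I J hA hB => hWT.tangent_eq_zero hm hy F (h.wey_grad_scri hy h0)
      ((e A).trans hA) ((e B).trans hB) I J
  have ht : DifferentiableAt ℝ (transv Ω) y :=
    (contDiffAt_transv hO h.smooth hy hr).differentiableAt (by simp)
  have hd2 := diffAt hO (contDiffOn_fderiv hO h.smooth) hy
  have hnw : ∀ V, fderiv ℝ Ω y (fderiv ℝ (transv Ω) y V + gam G y V (transv Ω y)) = 0 := by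
    intro V
    have hev : (fun z => fderiv ℝ Ω z (transv Ω z)) =ᶠ[𝓝 y] fun _ => (1 : ℝ) := by
      have hc : ContinuousAt (fderiv ℝ Ω) y := hd2.continuousAt
      filter_upwards [hc.eventually_ne hr] with z hz
      exact fderiv_transv hz
    have := congrArg (fun T : Coord →L[ℝ] ℝ => T V) hev.fderiv_eq
    rw [(hd2.hasFDerivAt.clm_apply ht.hasFDerivAt).fderiv] at this
    simp only [add_apply, ContinuousLinearMap.comp_apply, ContinuousLinearMap.flip_apply,
      fderiv_fun_const, Pi.zero_apply, zero_apply] at this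
    have hh := hH V (transv Ω y)
    rw [hess] at hh
    rw [map_add]
    linarith
  have hcov : ∀ V A B, fderiv ℝ Ω y A = 0 → fderiv ℝ Ω y B = 0 →
      covB G (weyK G Ω) y V A B = covWey G y V (transv Ω y) A (transv Ω y) B := by
    intro V A B hA hB
    have hd : fderiv ℝ (weyK G Ω) y V A B = fderiv ℝ (wey G) y V (transv Ω y) A (transv Ω y) B
        + wey G y (fderiv ℝ (transv Ω) y V) A (transv Ω y) B
        + wey G y (transv Ω y) A (fderiv ℝ (transv Ω) y V) B := by
      rw [← fderiv_clm_eval₂ (differentiableAt_weyK hm h.smooth hy hr)]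
      simp only [weyK_apply]
      rw [(((((diffAt hO (contDiffOn_wey hm) hy).hasFDerivAt.clm_apply ht.hasFDerivAt).clm_apply
        (hasFDerivAt_const A y)).clm_apply ht.hasFDerivAt).clm_apply
        (hasFDerivAt_const B y)).fderiv]
      simp
      ring
    have z1 := tz _ A (transv Ω y) B (hnw V) hA
    have z2 : wey G y (transv Ω y) A (fderiv ℝ (transv Ω) y V + gam G y V (transv Ω y)) B = 0 := by
      rw [hWT.pair]; exact tz _ B _ _ (hnw V) hB
    simp only [map_add, add_apply] at z1 z2
    rw [covB, hd, covWey]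
    simp only [weyK_apply]
    linear_combination z1 + z2
  rw [hcov X Y Z hY hZ, hcov Y X Z hX hZ]
  exact h.covWey_codazzi hy h0 hL hH hw hX hY hZ

end

section

variable {G T : MatField} {U : Set Coord} {y : Coord} {Ω : Coord → ℝ} {N w e₁ e₂ : Coord}

/-! ### The supermomentum of a null vector -/

lemma NullFrame.trg_eq_of_isLinearMap (h : MetricOn G U) (hy : y ∈ U)
    (F : NullFrame (met G y) N w e₁ e₂) {S : Coord → Coord → ℝ}
    (h1 : ∀ Y, IsLinearMap ℝ fun X => S X Y) (h2 : ∀ X, IsLinearMap ℝ (S X)) :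
    trg (G y) S = S N w + S w N - met G y w w * S N N + S e₁ e₁ + S e₂ e₂ := by
  have := F.trg_eq h hy (bilin fun i j => S (basisVec i) (basisVec j))
  simp only [bilin_eq h1 h2] at this
  exact this

/-- The contraction of two copies of a Weyl-type tensor that gives the supermomentum of `N`. -/
def superContraction (h : Matrix (Fin 4) (Fin 4) ℝ) (D : Form4) (N V : Coord) : ℝ :=
  trg h fun X Y => trg h fun X' Y' => D V X' N Y * D N X N Y'

lemma superContraction_eq (h : MetricOn G U) (hy : y ∈ U) {D : Form4} (hD : WeylType (G y) D)
    (F : NullFrame (met G y) N w e₁ e₂) (V : Coord) :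
    superContraction (G y) D N V = D V N N e₁ * D N e₁ N w + D V N N e₂ * D N e₂ N w
      + D V e₁ N e₁ * D N e₁ N e₁ + D V e₂ N e₁ * D N e₁ N e₂
      + D V e₁ N e₂ * D N e₂ N e₁ + D V e₂ N e₂ * D N e₂ N e₂ := by
  have inner : ∀ X Y, trg (G y) (fun X' Y' => D V X' N Y * D N X N Y')
      = D V N N Y * D N X N w + D V e₁ N Y * D N X N e₁ + D V e₂ N Y * D N X N e₂ := by
    intro X Y
    rw [F.trg_eq_of_isLinearMap h hy]
    · rw [hD.self_right N X N]; ring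
    · intro _; constructor <;> intros <;> simp <;> ring
    · intro _; constructor <;> intros <;> simp <;> ring
  unfold superContraction
  simp only [inner]
  rw [F.trg_eq_of_isLinearMap h hy]
  · simp only [hD.self_right, hD.self_left]; ring
  · intro _; constructor <;> intros <;> simp <;> ring
  · intro _; constructor <;> intros <;> simp <;> ring

lemma quadrilin_sum_second (d : Fin 4 → Fin 4 → Fin 4 → Fin 4 → ℝ) (a b c : Fin 4) (N : Coord) :
    ∑ γ, N γ * d a b γ c = quadrilin d (basisVec a) (basisVec b) N (basisVec c) := by
  rw [clm_eq_sum (quadrilin d (basisVec a) (basisVec b)) N]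
  simp

lemma quadrilin_sum_first_third (d : Fin 4 → Fin 4 → Fin 4 → Fin 4 → ℝ) (b c : Fin 4) (N : Coord) :
    ∑ δ, ∑ β, N δ * N β * d δ b β c = quadrilin d N (basisVec b) N (basisVec c) := by
  rw [clm_eq_sum (quadrilin d) N]
  simp only [sum_apply, smul_apply, smul_eq_mul]
  refine Finset.sum_congr rfl fun δ _ => ?_
  rw [← quadrilin_sum_second, Finset.mul_sum]
  exact Finset.sum_congr rfl fun β _ => by ring

lemma sum_comm₃ {A : Type*} [AddCommMonoid A] (f : Fin 4 → Fin 4 → Fin 4 → A) :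
    ∑ a, ∑ b, ∑ c, f a b c = ∑ c, ∑ a, ∑ b, f a b c :=
  (Finset.sum_congr rfl fun _ _ => Finset.sum_comm).trans Finset.sum_comm

lemma sum_comm₄ {A : Type*} [AddCommMonoid A] (f : Fin 4 → Fin 4 → Fin 4 → Fin 4 → A) :
    ∑ a, ∑ b, ∑ c, ∑ d, f a b c d = ∑ d, ∑ a, ∑ b, ∑ c, f a b c d :=
  (Finset.sum_congr rfl fun _ _ => sum_comm₃ _).trans Finset.sum_comm

lemma belRobinson_contract (h : Matrix (Fin 4) (Fin 4) ℝ) (d : Fin 4 → Fin 4 → Fin 4 → Fin 4 → ℝ)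
    (N : Coord) (hN : ∑ i, ∑ j, h i j * N i * N j = 0) (σ : Fin 4) :
    ∑ μ, ∑ ν, ∑ ρ, belRobinson h d σ μ ν ρ * N μ * N ν * N ρ
      = 2 * superContraction h (quadrilin d) N (basisVec σ) := by
  have e1 : ∀ m n, ∑ ν, N ν * raiseLast h d σ m ν n
      = ∑ a, h⁻¹ n a * quadrilin d (basisVec σ) (basisVec m) N (basisVec a) := by
    intro m n
    simp only [raiseLast, ← quadrilin_sum_second, Finset.mul_sum]
    rw [Finset.sum_comm]
    exact Finset.sum_congr rfl fun _ _ => Finset.sum_congr rfl fun _ _ => by ring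
  have e2 : ∀ m n, ∑ ρ, ∑ μ, N ρ * N μ * raiseLast h d ρ n μ m
      = ∑ b, h⁻¹ m b * quadrilin d N (basisVec n) N (basisVec b) := by
    intro m n
    simp only [raiseLast, ← quadrilin_sum_first_third, Finset.mul_sum]
    rw [sum_comm₃]
    exact Finset.sum_congr rfl fun _ _ => Finset.sum_congr rfl fun _ _ =>
      Finset.sum_congr rfl fun _ _ => by ring
  have e3 : superContraction h (quadrilin d) N (basisVec σ)
      = ∑ m, ∑ n, (∑ ν, N ν * raiseLast h d σ m ν n)
          * ∑ ρ, ∑ μ, N ρ * N μ * raiseLast h d ρ n μ m := by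
    simp only [e1, e2, superContraction, trg]
    rw [Finset.sum_comm (s := Finset.univ) (t := Finset.univ) (f := fun m n =>
      (∑ a, h⁻¹ n a * quadrilin d (basisVec σ) (basisVec m) N (basisVec a))
        * ∑ b, h⁻¹ m b * quadrilin d N (basisVec n) N (basisVec b))]
    refine Finset.sum_congr rfl fun n _ => ?_
    simp only [Finset.sum_mul]
    rw [Finset.sum_comm (s := Finset.univ) (t := Finset.univ) (f := fun m a =>
      h⁻¹ n a * quadrilin d (basisVec σ) (basisVec m) N (basisVec a)
        * ∑ b, h⁻¹ m b * quadrilin d N (basisVec n) N (basisVec b))]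
    refine Finset.sum_congr rfl fun a _ => ?_
    simp only [Finset.mul_sum]
    exact Finset.sum_congr rfl fun _ _ => Finset.sum_congr rfl fun _ _ => by ring
  have e4 : ∑ μ, ∑ ν, ∑ ρ, (∑ m, ∑ n, raiseLast h d σ m ν n * raiseLast h d ρ n μ m)
      * N μ * N ν * N ρ = superContraction h (quadrilin d) N (basisVec σ) := by
    rw [e3]
    simp only [Finset.sum_mul]
    rw [sum_comm₄]
    refine Finset.sum_congr rfl fun m _ => ?_
    rw [sum_comm₄]
    refine Finset.sum_congr rfl fun n _ => ?_
    rw [Finset.sum_comm]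
    refine Finset.sum_congr rfl fun ν _ => ?_
    rw [Finset.sum_comm]
    simp only [Finset.mul_sum]
    exact Finset.sum_congr rfl fun _ _ => Finset.sum_congr rfl fun _ _ => by ring
  have e5 : ∑ μ, ∑ ν, ∑ ρ, (∑ m, ∑ n, raiseLast h d σ m ρ n * raiseLast h d ν n μ m)
      * N μ * N ν * N ρ = superContraction h (quadrilin d) N (basisVec σ) := by
    rw [← e4]
    refine Finset.sum_congr rfl fun μ _ => ?_
    rw [Finset.sum_comm]
    exact Finset.sum_congr rfl fun _ _ => Finset.sum_congr rfl fun _ _ => by ring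
  have e6 : ∑ μ, ∑ ν, ∑ ρ, ((1 / 8) * h σ μ * h ν ρ * normSq h d) * N μ * N ν * N ρ = 0 := by
    refine Finset.sum_eq_zero fun μ _ => ?_
    have : ∑ ν, ∑ ρ, ((1 / 8) * h σ μ * h ν ρ * normSq h d) * N μ * N ν * N ρ
        = (1 / 8) * h σ μ * normSq h d * N μ * ∑ i, ∑ j, h i j * N i * N j := by
      simp only [Finset.mul_sum]
      exact Finset.sum_congr rfl fun _ _ => Finset.sum_congr rfl fun _ _ => by ring
    rw [this, hN, mul_zero]
  simp only [belRobinson, sub_mul, add_mul, Finset.sum_sub_distrib, Finset.sum_add_distrib]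
  rw [e4, e5, e6]
  ring

lemma superMomentum_eq_zero_iff (h : MetricOn G U) (hy : y ∈ U)
    (d : Fin 4 → Fin 4 → Fin 4 → Fin 4 → ℝ) (NN : met G y N N = 0) :
    (∀ α, superMomentum (G y) d N α = 0) ↔
      ∀ V, superContraction (G y) (quadrilin d) N V = 0 := by
  have e : ∀ α, superMomentum (G y) d N α
      = - ∑ σ, (G y)⁻¹ α σ * (2 * superContraction (G y) (quadrilin d) N (basisVec σ)) := by
    intro α
    rw [superMomentum]
    congr 1
    refine Finset.sum_congr rfl fun σ _ => ?_
    rw [← belRobinson_contract (G y) d N (by rw [← met_apply]; exact NN)]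
    simp only [Finset.mul_sum]
    exact Finset.sum_congr rfl fun _ _ => Finset.sum_congr rfl fun _ _ =>
      Finset.sum_congr rfl fun _ _ => by ring
  constructor
  · intro hs V
    have hz : ∀ m, superContraction (G y) (quadrilin d) N (basisVec m) = 0 := by
      intro m
      have : ∑ α, G y m α * ∑ σ, (G y)⁻¹ α σ
          * (2 * superContraction (G y) (quadrilin d) N (basisVec σ)) = 0 := by
        refine Finset.sum_eq_zero fun α _ => ?_
        have := hs α
        rw [e, neg_eq_zero] at this
        rw [this, mul_zero]
      simp only [Finset.mul_sum, ← mul_assoc] at this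
      rw [Finset.sum_comm] at this
      simp only [← Finset.sum_mul, inv_mul_met h hy] at this
      simpa using this
    have hl : IsLinearMap ℝ fun V => superContraction (G y) (quadrilin d) N V := by
      constructor <;> intros <;> simp only [superContraction, trg, Finset.mul_sum,
        ← Finset.sum_add_distrib, map_add, map_smul, add_apply, smul_apply, smul_eq_mul] <;>
      exact Finset.sum_congr rfl fun _ _ => Finset.sum_congr rfl fun _ _ =>
        Finset.sum_congr rfl fun _ _ => Finset.sum_congr rfl fun _ _ => by ring
    rw [IsLinearMap.eq_sum_basisVec hl V]
    simp [hz]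
  · intro hs α
    rw [e]
    simp [hs]

/-- The supermomentum of a null vector `N` vanishes if and only if the radiative part of the
Weyl-type tensor does. -/
lemma WeylType.superContraction_eq_zero_iff (h : MetricOn G U) (hy : y ∈ U) {D : Form4}
    (hD : WeylType (G y) D) (F : NullFrame (met G y) N w e₁ e₂) :
    (∀ V, superContraction (G y) D N V = 0) ↔
      ∀ X Y Z, met G y X N = 0 → met G y Y N = 0 → met G y Z N = 0 → D N Z X Y = 0 := by
  have E := superContraction_eq h hy hD F
  have a := hD.antisymm
  have al := hD.antisymm_left
  have p := hD.pair
  have t1 := hD.frame_trace h hy F e₂ N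
  have t2 := hD.frame_trace h hy F e₁ N
  simp only [hD.self_left, hD.self_right] at t1 t2
  rw [a N e₂ w N, p e₁ e₂ e₁ N, al e₁ N] at t1
  rw [a N e₁ w N, p e₂ e₁ e₂ N, al e₂ N, a N e₂ e₂ e₁] at t2
  constructor
  · intro hV X Y Z hX hY hZ
    have v1 := (E N).symm.trans (hV N)
    have v2 := (E w).symm.trans (hV w)
    simp only [hD.self_left] at v1
    rw [p N e₂ N e₁] at v1
    have s1 := mul_self_nonneg (D N e₁ N e₁)
    have s2 := mul_self_nonneg (D N e₁ N e₂)
    have s3 := mul_self_nonneg (D N e₂ N e₂)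
    have d11 : D N e₁ N e₁ = 0 := mul_self_eq_zero.1 (by linarith)
    have d12 : D N e₁ N e₂ = 0 := mul_self_eq_zero.1 (by linarith)
    have d22 : D N e₂ N e₂ = 0 := mul_self_eq_zero.1 (by linarith)
    have d21 : D N e₂ N e₁ = 0 := by rw [p, d12]
    rw [d11, d12, d22, d21, al w N N e₁, al w N N e₂, p N w N e₁, p N w N e₂] at v2
    have s4 := mul_self_nonneg (D N e₁ N w)
    have s5 := mul_self_nonneg (D N e₂ N w)
    have w1 : D N e₁ N w = 0 := mul_self_eq_zero.1 (by linarith)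
    have w2 : D N e₂ N w = 0 := mul_self_eq_zero.1 (by linarith)
    have c1 : D N e₁ e₁ e₂ = 0 := by linarith
    have c2 : D N e₂ e₁ e₂ = 0 := by linarith
    rw [F.tangent hX, F.tangent hY, F.tangent hZ]
    simp only [map_add, map_smul, add_apply, smul_apply, smul_eq_mul, hD.self_left, hD.self_right,
      a N e₁ e₁ N, a N e₁ e₂ N, a N e₂ e₁ N, a N e₂ e₂ N, a N e₁ e₂ e₁, a N e₂ e₂ e₁, d11, d12, d21,
      d22, c1, c2]
    simp
  · intro hz V
    have z : ∀ {X Y Z}, met G y X N = 0 → met G y Y N = 0 → met G y Z N = 0 → D N Z X Y = 0 :=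
      fun hX hY hZ => hz _ _ _ hX hY hZ
    rw [z F.N1 F.N2 F.N1] at t1
    rw [z F.N1 F.N2 F.N2] at t2
    have w1 : D N e₁ N w = 0 := by linarith
    have w2 : D N e₂ N w = 0 := by linarith
    rw [E, z F.NN F.N1 F.N1, z F.NN F.N2 F.N1, z F.NN F.N1 F.N2, z F.NN F.N2 F.N2, w1, w2]
    ring

/-! ### Derivatives along a level set -/

/-- A function that vanishes on the regular level set `Ω = 0` has vanishing derivative along it. -/
lemma fderiv_eq_zero_of_level {f : Coord → ℝ} (hΩ : ContDiffAt ℝ ∞ Ω y) (hf : ContDiffAt ℝ 1 f y)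
    (h0 : Ω y = 0) (hr : fderiv ℝ Ω y ≠ 0) (hz : ∀ᶠ z in 𝓝 y, Ω z = 0 → f z = 0) {X : Coord}
    (hX : fderiv ℝ Ω y X = 0) : fderiv ℝ f y X = 0 := by
  have hext : IsLocalExtrOn f {x | Ω x = Ω y} y := by
    refine Or.inl ?_
    have hfy : f y = 0 := hz.self_of_nhds h0
    filter_upwards [mem_nhdsWithin_of_mem_nhds hz, self_mem_nhdsWithin] with z h1 h2
    rw [hfy, h1 (h2.trans h0)]
  obtain ⟨a, b, hab, e⟩ := hext.exists_multipliers_of_hasStrictFDerivAt_1d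
    (hΩ.hasStrictFDerivAt (by simp)) (hf.hasStrictFDerivAt (by simp))
  have eX := congrArg (fun T : Coord →L[ℝ] ℝ => T X) e
  simp only [add_apply, smul_apply, smul_eq_mul, hX, mul_zero, zero_add, zero_apply] at eX
  rcases mul_eq_zero.1 eX with hb | hX'
  · subst hb
    rw [zero_smul, add_zero] at e
    rcases smul_eq_zero.1 e with ha | he
    · exact absurd (by rw [ha]; rfl) hab
    · exact absurd he hr
  · exact hX'

/-- The quotient `f / Ω` near a regular level set on which `f` vanishes. -/
lemma tendsto_div_of_level {f : Coord → ℝ} (hU : IsOpen U) (hy : y ∈ U) (hΩ : ContDiffOn ℝ ∞ Ω U)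
    (hf : ContDiffOn ℝ ∞ f U) (h0 : Ω y = 0) (hz : ∀ᶠ z in 𝓝 y, Ω z = 0 → f z = 0) {w : Coord}
    (hw : fderiv ℝ Ω y w = 1) :
    Tendsto (fun z => (Ω z)⁻¹ * f z) (𝓝[{z | z ∈ U ∧ 0 < Ω z}] y) (𝓝 (fderiv ℝ f y w)) := by
  have cΩ : ContinuousAt (fun z => fderiv ℝ Ω z w) y :=
    ((contDiffOn_fderiv hU hΩ).continuousOn.continuousAt (hU.mem_nhds hy)).clm_apply
      continuousAt_const
  have cf : ContinuousAt (fun z => fderiv ℝ f z w) y :=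
    ((contDiffOn_fderiv hU hf).continuousOn.continuousAt (hU.mem_nhds hy)).clm_apply
      continuousAt_const
  have cq : ContinuousAt (fun z => (fderiv ℝ Ω z w)⁻¹ * fderiv ℝ f z w) y :=
    (cΩ.inv₀ (by rw [hw]; exact one_ne_zero)).mul cf
  have c0 : ContinuousAt Ω y := hΩ.continuousOn.continuousAt (hU.mem_nhds hy)
  rw [Metric.tendsto_nhdsWithin_nhds]
  intro ε hε
  have hq := Metric.continuousAt_iff.1 cq ε hε
  obtain ⟨r₁, hr₁, hq⟩ := hq
  have hev : ∀ᶠ z in 𝓝 y, z ∈ U ∧ (Ω z = 0 → f z = 0) ∧ 1 / 2 < fderiv ℝ Ω z w := by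
    filter_upwards [hU.mem_nhds hy, hz, cΩ.eventually (Ioi_mem_nhds (a := 1 / 2)
      (by simp only [hw]; norm_num))] with z h1 h2 h3
    exact ⟨h1, h2, h3⟩
  obtain ⟨r₂, hr₂, hev⟩ := Metric.eventually_nhds_iff.1 hev
  set r := min r₁ r₂ with hr
  have hrp : 0 < r := lt_min hr₁ hr₂
  have hm : 0 < r / (4 * (‖w‖ + 1)) := by positivity
  obtain ⟨δ, hδ, hΩs⟩ := Metric.continuousAt_iff.1 c0 _ hm
  refine ⟨min δ (r / 2), lt_min hδ (half_pos hrp), fun z hzA hzd => ?_⟩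
  have hΩz : 0 < Ω z := hzA.2
  have hΩz' : Ω z < r / (4 * (‖w‖ + 1)) := by
    have := hΩs (hzd.trans_le (min_le_left _ _))
    rw [h0, Real.dist_eq, sub_zero, abs_of_pos hΩz] at this
    exact this
  set t₀ := 2 * Ω z with ht₀
  have ht₀p : 0 < t₀ := by positivity
  have hseg : ∀ t ∈ Icc 0 t₀, dist (z - t • w) y < r := by
    intro t ht
    have h1 : dist (z - t • w) y ≤ dist z y + t * ‖w‖ := by
      rw [dist_eq_norm, dist_eq_norm]
      calc ‖z - t • w - y‖ = ‖(z - y) - t • w‖ := by congr 1; abel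
        _ ≤ ‖z - y‖ + ‖t • w‖ := norm_sub_le _ _
        _ = _ := by rw [norm_smul, Real.norm_of_nonneg ht.1]
    have h2 : t * ‖w‖ < r / 2 := by
      have h3 : t * ‖w‖ ≤ 2 * Ω z * ‖w‖ := mul_le_mul_of_nonneg_right ht.2 (norm_nonneg _)
      have h4 : 2 * Ω z * ‖w‖ ≤ 2 * Ω z * (‖w‖ + 1) := by nlinarith
      have h5 : Ω z * (4 * (‖w‖ + 1)) < r := (lt_div_iff₀ (by positivity)).1 hΩz'
      linarith
    have := hzd.trans_le (min_le_right _ _)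
    linarith
  have hgood : ∀ t ∈ Icc 0 t₀, z - t • w ∈ U := fun t ht =>
    (hev ((hseg t ht).trans_le (min_le_right _ _))).1
  have hline : ∀ t : ℝ, HasDerivAt (fun t : ℝ => z - t • w) (-w) t := fun t => by
    simpa using ((hasDerivAt_id t).smul_const w).const_sub z
  have dΩ : ∀ t ∈ Icc 0 t₀, HasDerivAt (fun t : ℝ => Ω (z - t • w))
      (- fderiv ℝ Ω (z - t • w) w) t := fun t ht => by
    have := (diffAt hU hΩ (hgood t ht)).hasFDerivAt.comp_hasDerivAt t (hline t)
    exact this.congr_deriv (by simp)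
  have df : ∀ t ∈ Icc 0 t₀, HasDerivAt (fun t : ℝ => f (z - t • w))
      (- fderiv ℝ f (z - t • w) w) t := fun t ht => by
    have := (diffAt hU hf (hgood t ht)).hasFDerivAt.comp_hasDerivAt t (hline t)
    exact this.congr_deriv (by simp)
  have kΩ : ContinuousOn (fun t : ℝ => Ω (z - t • w)) (Icc 0 t₀) := fun t ht =>
    (dΩ t ht).continuousAt.continuousWithinAt
  have kf : ContinuousOn (fun t : ℝ => f (z - t • w)) (Icc 0 t₀) := fun t ht =>
    (df t ht).continuousAt.continuousWithinAt
  have hneg : Ω (z - t₀ • w) ≤ 0 := by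
    obtain ⟨c, hc, e⟩ := exists_hasDerivAt_eq_slope _ _ ht₀p kΩ
      (fun t ht => dΩ t (Ioo_subset_Icc_self ht))
    have hb := (hev ((hseg c (Ioo_subset_Icc_self hc)).trans_le (min_le_right _ _))).2.2
    simp only [zero_smul, sub_zero] at e
    rw [eq_div_iff ht₀p.ne'] at e
    nlinarith
  obtain ⟨t, ht, ht0⟩ := intermediate_value_Icc' ht₀p.le kΩ
    (show (0 : ℝ) ∈ Icc _ _ from ⟨hneg, by simpa using hΩz.le⟩)
  simp only at ht0
  have htp : 0 < t := by
    rcases ht.1.lt_or_eq with h | h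
    · exact h
    · rw [← h] at ht0; simp only [zero_smul, sub_zero] at ht0; exact absurd ht0 hΩz.ne'
  have hsub : Icc 0 t ⊆ Icc 0 t₀ := Icc_subset_Icc_right ht.2
  obtain ⟨c, hc, e⟩ := exists_ratio_hasDerivAt_eq_ratio_slope _ _ htp (kf.mono hsub)
    (fun s hs => df s (hsub (Ioo_subset_Icc_self hs))) _ _ (kΩ.mono hsub)
    (fun s hs => dΩ s (hsub (Ioo_subset_Icc_self hs)))
  have hft : f (z - t • w) = 0 := (hev ((hseg t ht).trans_le (min_le_right _ _))).2.1 ht0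
  simp only [ht0, hft, zero_smul, sub_zero] at e
  have hcI := hsub (Ioo_subset_Icc_self hc)
  have hb := (hev ((hseg c hcI).trans_le (min_le_right _ _))).2.2
  have hval : (Ω z)⁻¹ * f z = (fderiv ℝ Ω (z - c • w) w)⁻¹ * fderiv ℝ f (z - c • w) w := by
    have hb' : fderiv ℝ Ω (z - c • w) w ≠ 0 := by linarith
    field_simp
    linarith
  have := hq ((hseg c hcI).trans_le (min_le_left _ _))
  rw [hw, inv_one, one_mul] at this
  rw [hval]
  exact this

/-- The covariant derivative along infinity of a tensor that vanishes on vectors tangent to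
infinity. -/
lemma covB_eq_zero_of_level {P : Coord → Form2} (hU : IsOpen U) (hΩ : ContDiffOn ℝ ∞ Ω U)
    (hP : ContDiffOn ℝ ∞ P U) (hy : y ∈ U) (h0 : Ω y = 0) (hr : fderiv ℝ Ω y ≠ 0)
    (hH : ∀ A B, hess G Ω y A B = 0)
    (hz : ∀ᶠ z in 𝓝 y, Ω z = 0 → ∀ Y Z, fderiv ℝ Ω z Y = 0 → fderiv ℝ Ω z Z = 0 → P z Y Z = 0)
    {X Y Z : Coord} (hX : fderiv ℝ Ω y X = 0) (hY : fderiv ℝ Ω y Y = 0)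
    (hZ : fderiv ℝ Ω y Z = 0) : covB G P y X Y Z = 0 := by
  have hc1 := smoothAt hU (contDiffOn_fderiv hU hΩ) hy
  have ct := contDiffAt_transv hU hΩ hy hr
  let ext : Coord → Coord → Coord := fun A z => A - fderiv ℝ Ω z A • transv Ω z
  have cext : ∀ A, ContDiffAt ℝ ∞ (ext A) y := fun A =>
    contDiffAt_const.sub ((hc1.clm_apply contDiffAt_const).smul ct)
  have hd2 := diffAt hU (contDiffOn_fderiv hU hΩ) hy
  have dext : ∀ A, fderiv ℝ Ω y A = 0 → HasFDerivAt (ext A)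
      (-((fderiv ℝ (fderiv ℝ Ω) y).flip A).smulRight (transv Ω y)) y := by
    intro A hA
    have h1 := (hd2.hasFDerivAt.clm_apply (hasFDerivAt_const A y)).fun_smul
      (ct.differentiableAt (by simp)).hasFDerivAt
    have h2 := h1.const_sub A
    refine h2.congr_fderiv ?_
    ext W
    simp [hA]
  have hev : ∀ᶠ z in 𝓝 y, Ω z = 0 → P z (ext Y z) (ext Z z) = 0 := by
    have hc : ContinuousAt (fderiv ℝ Ω) y := hd2.continuousAt
    filter_upwards [hz, hc.eventually_ne hr] with z h1 h2 h3
    have : ∀ A, fderiv ℝ Ω z (ext A z) = 0 := by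
      intro A
      simp [ext, fderiv_transv h2]
    exact h1 h3 _ _ (this Y) (this Z)
  have hcf : ContDiffAt ℝ 1 (fun z => P z (ext Y z) (ext Z z)) y :=
    (((smoothAt hU hP hy).clm_apply (cext Y)).clm_apply (cext Z)).of_le (by simp)
  have key := fderiv_eq_zero_of_level (smoothAt hU hΩ hy) hcf h0 hr hev hX
  rw [((((diffAt hU hP hy).hasFDerivAt.clm_apply (dext Y hY)).clm_apply (dext Z hZ))).fderiv] at key
  have hP0 : ∀ A B, fderiv ℝ Ω y A = 0 → fderiv ℝ Ω y B = 0 → P y A B = 0 :=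
    hz.self_of_nhds h0
  have eY : ext Y y = Y := by simp [ext, hY]
  have eZ : ext Z y = Z := by simp [ext, hZ]
  simp only [add_apply, ContinuousLinearMap.comp_apply, ContinuousLinearMap.flip_apply, eY, eZ,
    neg_apply, ContinuousLinearMap.smulRight_apply, map_neg, map_smul, smul_apply,
    smul_eq_mul] at key
  have hh : ∀ A, fderiv ℝ (fderiv ℝ Ω) y X A = fderiv ℝ Ω y (gam G y X A) := fun A => by
    have := hH X A
    rw [hess] at this
    linarith
  have tY := hP0 (gam G y X Y - fderiv ℝ Ω y (gam G y X Y) • transv Ω y) Z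
    (by simp [fderiv_transv hr]) hZ
  have tZ := hP0 Y (gam G y X Z - fderiv ℝ Ω y (gam G y X Z) • transv Ω y) hY
    (by simp [fderiv_transv hr])
  simp only [map_sub, map_smul, sub_apply, smul_apply, smul_eq_mul] at tY tZ
  rw [hh, hh] at key
  rw [covB]
  linarith

/-! ### Consequences of the divergence-free gauge -/

lemma CompletionOn.hess_eq_zero (h : CompletionOn G U Ω T) (hy : y ∈ U) (h0 : Ω y = 0)
    (hdiv : trg (G y) (hess G Ω y) = 0) (A B : Coord) : hess G Ω y A B = 0 := by
  have := h.hess_scri hy h0 A B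
  rw [normRatio_scri h0, hdiv] at this
  linarith

lemma CompletionOn.sch_grad (h : CompletionOn G U Ω T) (hy : y ∈ U) (h0 : Ω y = 0)
    (hdiv : ∀ z ∈ U, Ω z = 0 → trg (G z) (hess G Ω z) = 0) {X : Coord}
    (hX : fderiv ℝ Ω y X = 0) : sch G y X (grad G Ω y) = 0 := by
  have hO := h.metric.isOpen
  have := fderiv_eq_zero_of_level (smoothAt hO h.smooth hy)
    ((smoothAt hO h.contDiffOn_normRatio hy).of_le (by simp)) h0 (h.regular y hy h0)
    (by filter_upwards [hO.mem_nhds hy] with z hz hz0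
        rw [normRatio_scri hz0, hdiv z hz hz0, mul_zero]) hX
  rw [h.fderiv_normRatio_scri hy h0] at this
  linarith

/-! ### The rescaled Weyl tensor at infinity -/

lemma CompletionOn.tendsto_weyl_div (h : CompletionOn G U Ω T) (hy : y ∈ U)
    (h0 : Ω y = 0) (hC : ∀ᶠ z in 𝓝 y, Ω z = 0 → ∀ l k i j, weyl G l k i j z = 0) {w : Coord}
    (hw : fderiv ℝ Ω y w = 1) (l k i j : Fin 4) :
    Tendsto (fun z => (Ω z)⁻¹ * weyl G l k i j z) (𝓝[{z | z ∈ U ∧ 0 < Ω z}] y)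
      (𝓝 (fderiv ℝ (weyl G l k i j) y w)) :=
  tendsto_div_of_level h.metric.isOpen hy h.smooth (contDiffOn_weyl h.metric l k i j) h0
    (hC.mono fun _ hz hz0 => hz hz0 l k i j) hw

lemma CompletionOn.extendFrom_weyl (h : CompletionOn G U Ω T) (hy : y ∈ U)
    (h0 : Ω y = 0) (hC : ∀ᶠ z in 𝓝 y, Ω z = 0 → ∀ l k i j, weyl G l k i j z = 0) {w : Coord}
    (hw : fderiv ℝ Ω y w = 1) (l k i j : Fin 4) :
    extendFrom {z | z ∈ U ∧ 0 < Ω z} (fun z => (Ω z)⁻¹ * weyl G l k i j z) y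
      = fderiv ℝ (weyl G l k i j) y w :=
  extendFrom_eq (h.mem_closure hy h0) (h.tendsto_weyl_div hy h0 hC hw l k i j)

lemma CompletionOn.continuousWithinAt_extendFrom_weyl (h : CompletionOn G U Ω T) (hy : y ∈ U)
    (h0 : Ω y = 0) (hC : ∀ᶠ z in 𝓝 y, Ω z = 0 → ∀ l k i j, weyl G l k i j z = 0) (l k i j : Fin 4) :
    ContinuousWithinAt (extendFrom {z | z ∈ U ∧ 0 < Ω z} fun z => (Ω z)⁻¹ * weyl G l k i j z)
      {z | z ∈ U ∧ 0 ≤ Ω z} y := by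
  have hO := h.metric.isOpen
  obtain ⟨V, hV, hVo, hyV⟩ := eventually_nhds_iff.1 hC
  have hcl : ∀ z ∈ U, 0 ≤ Ω z → z ∈ closure {z | z ∈ U ∧ 0 < Ω z} := by
    intro z hz hz0
    rcases hz0.eq_or_lt with e | hp
    · exact h.mem_closure hz e.symm
    · exact subset_closure ⟨hz, hp⟩
  have hcont : ContinuousOn (extendFrom {z | z ∈ U ∧ 0 < Ω z} fun z => (Ω z)⁻¹ * weyl G l k i j z)
      (V ∩ {z | z ∈ U ∧ 0 ≤ Ω z}) := by
    refine continuousOn_extendFrom (fun z hz => hcl z hz.2.1 hz.2.2) fun z hz => ?_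
    obtain ⟨hzV, hzU, hz0⟩ := hz
    rcases hz0.eq_or_lt with e | hp
    · exact ⟨_, h.tendsto_weyl_div hzU e.symm
        (by filter_upwards [hVo.mem_nhds hzV] with x hx using hV x hx)
        (fderiv_transv (h.regular z hzU e.symm)) l k i j⟩
    · refine ⟨(Ω z)⁻¹ * weyl G l k i j z, ?_⟩
      have : ContinuousAt (fun z => (Ω z)⁻¹ * weyl G l k i j z) z :=
        ((diffAt hO h.smooth hzU).continuousAt.inv₀ hp.ne').mul
          (diffAt hO (contDiffOn_weyl h.metric l k i j) hzU).continuousAt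
      exact this.tendsto.mono_left nhdsWithin_le_nhds
  exact (hcont y ⟨hyV, hy, h0.ge⟩).mono_of_mem_nhdsWithin
    (Filter.inter_mem (mem_nhdsWithin_of_mem_nhds (hVo.mem_nhds hyV)) self_mem_nhdsWithin)

lemma quadrilin_fderiv_weyl (h : MetricOn G U) (hy : y ∈ U)
    (hC : ∀ l k i j, weyl G l k i j y = 0) (w : Coord) :
    quadrilin (fun l k i j => fderiv ℝ (weyl G l k i j) y w) = covWeyL G y w := by
  have h0 : wey G y = 0 := by
    simp only [wey, hC, quadrilin]
    simp
  unfold covWeyL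
  congr 1
  funext l k i j
  rw [covWey, h0, ← fderiv_wey_eval h hy]
  simp [wey]

end

section

/-! ### Change of coordinates -/

/-- `τ` is a change of coordinates that takes the metric `G'` on `U'` to the metric `G` on `U`. -/
structure Transition (G : MatField) (U : Set Coord) (G' : MatField) (U' : Set Coord)
    (τ : Coord → Coord) : Prop where
  metric : MetricOn G U
  metric' : MetricOn G' U'
  smooth : ContDiffOn ℝ ∞ τ U'
  maps : ∀ y ∈ U', τ y ∈ U
  surj : ∀ y ∈ U', Function.Surjective (fderiv ℝ τ y)
  met_eq : ∀ y ∈ U', ∀ X Y, met G' y X Y = met G (τ y) (fderiv ℝ τ y X) (fderiv ℝ τ y Y)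

variable {G G' : MatField} {U U' : Set Coord} {τ : Coord → Coord} {y : Coord}

lemma Transition.fderiv_met' (h : Transition G U G' U' τ) (hy : y ∈ U') (V X Y : Coord) :
    fderiv ℝ (met G') y V X Y
      = fderiv ℝ (met G) (τ y) (fderiv ℝ τ y V) (fderiv ℝ τ y X) (fderiv ℝ τ y Y)
        + met G (τ y) (fderiv ℝ (fderiv ℝ τ) y V X) (fderiv ℝ τ y Y)
        + met G (τ y) (fderiv ℝ τ y X) (fderiv ℝ (fderiv ℝ τ) y V Y) := by
  have hO := h.metric'.isOpen
  have d1 := (diffAt hO h.smooth hy).hasFDerivAt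
  have d2 := (diffAt hO (contDiffOn_fderiv hO h.smooth) hy).hasFDerivAt
  have d3 : HasFDerivAt (fun z => met G (τ z)) ((fderiv ℝ (met G) (τ y)).comp (fderiv ℝ τ y)) y :=
    (diffAt h.metric.isOpen h.metric.contDiffOn_met (h.maps y hy)).hasFDerivAt.comp y d1
  have d4 : ∀ A, HasFDerivAt (fun z => fderiv ℝ τ z A) ((fderiv ℝ (fderiv ℝ τ) y).flip A) y := by
    intro A
    exact (d2.clm_apply (hasFDerivAt_const A y)).congr_fderiv (by ext W; simp)
  rw [← fderiv_clm_eval₂ (diffAt hO h.metric'.contDiffOn_met hy),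
    fderiv_congr_on hO (fun z hz => h.met_eq z hz X Y) hy,
    ((d3.clm_apply (d4 X)).clm_apply (d4 Y)).fderiv]
  simp only [add_apply, ContinuousLinearMap.comp_apply, ContinuousLinearMap.flip_apply]
  ring

/-- The transformation law of the Christoffel symbols. -/
lemma Transition.gam_eq (h : Transition G U G' U' τ) (hy : y ∈ U') (X Y : Coord) :
    fderiv ℝ τ y (gam G' y X Y)
      = gam G (τ y) (fderiv ℝ τ y X) (fderiv ℝ τ y Y) + fderiv ℝ (fderiv ℝ τ) y X Y := by
  have hm := h.maps y hy
  rw [← sub_eq_zero]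
  refine nondegenerate h.metric hm fun W => ?_
  obtain ⟨Z, rfl⟩ := h.surj y hy W
  have k' := koszul h.metric' hy X Y Z
  have k := koszul h.metric hm (fderiv ℝ τ y X) (fderiv ℝ τ y Y) (fderiv ℝ τ y Z)
  rw [h.met_eq y hy, h.fderiv_met' hy, h.fderiv_met' hy, h.fderiv_met' hy] at k'
  have c := fderiv_fderiv_comm h.metric'.isOpen h.smooth hy
  rw [c Y X, c Z X, c Z Y] at k'
  have s := met_symm h.metric hm
  rw [s (fderiv ℝ τ y X) (fderiv ℝ (fderiv ℝ τ) y Y Z),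
    s (fderiv ℝ τ y Y) (fderiv ℝ (fderiv ℝ τ) y X Z)] at k'
  rw [map_sub, map_add, sub_apply, add_apply]
  linarith

lemma Transition.fderiv_gam' (h : Transition G U G' U' τ) (hy : y ∈ U') (W X Y : Coord) :
    fderiv ℝ (fderiv ℝ τ) y W (gam G' y X Y) + fderiv ℝ τ y (fderiv ℝ (gam G') y W X Y)
      = fderiv ℝ (gam G) (τ y) (fderiv ℝ τ y W) (fderiv ℝ τ y X) (fderiv ℝ τ y Y)
        + gam G (τ y) (fderiv ℝ (fderiv ℝ τ) y W X) (fderiv ℝ τ y Y)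
        + gam G (τ y) (fderiv ℝ τ y X) (fderiv ℝ (fderiv ℝ τ) y W Y)
        + fderiv ℝ (fderiv ℝ (fderiv ℝ τ)) y W X Y := by
  have hO := h.metric'.isOpen
  have s2 := contDiffOn_fderiv hO h.smooth
  have d1 := (diffAt hO h.smooth hy).hasFDerivAt
  have d2 := (diffAt hO s2 hy).hasFDerivAt
  have d3 : HasFDerivAt (fun z => gam G (τ z)) ((fderiv ℝ (gam G) (τ y)).comp (fderiv ℝ τ y)) y :=
    (diffAt h.metric.isOpen (contDiffOn_gam h.metric) (h.maps y hy)).hasFDerivAt.comp y d1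
  have d4 : ∀ A, HasFDerivAt (fun z => fderiv ℝ τ z A) ((fderiv ℝ (fderiv ℝ τ) y).flip A) y := by
    intro A
    exact (d2.clm_apply (hasFDerivAt_const A y)).congr_fderiv (by ext W; simp)
  have d5 := hasFDerivAt_eval₂ (diffAt hO (contDiffOn_fderiv hO s2) hy) X Y
  have d6 := hasFDerivAt_eval₂ (diffAt hO (contDiffOn_gam h.metric') hy) X Y
  have e := congrArg (fun T : Coord →L[ℝ] Coord => T W)
    (fderiv_congr_on hO (fun z hz => h.gam_eq hz X Y) hy)
  rw [(d2.clm_apply d6).fderiv, (((d3.clm_apply (d4 X)).clm_apply (d4 Y)).fun_add d5).fderiv] at e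
  simp only [add_apply, ContinuousLinearMap.comp_apply, ContinuousLinearMap.flip_apply]
    at e
  rw [add_comm, e]
  abel

/-- The curvature is a tensor. -/
lemma Transition.curv_eq (h : Transition G U G' U' τ) (hy : y ∈ U') (X Y Z : Coord) :
    fderiv ℝ τ y (curv G' y X Y Z)
      = curv G (τ y) (fderiv ℝ τ y X) (fderiv ℝ τ y Y) (fderiv ℝ τ y Z) := by
  have hO := h.metric'.isOpen
  have s2 := contDiffOn_fderiv hO h.smooth
  have c := fderiv_fderiv_comm hO h.smooth hy
  have c3 : fderiv ℝ (fderiv ℝ (fderiv ℝ τ)) y X Y Z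
      = fderiv ℝ (fderiv ℝ (fderiv ℝ τ)) y Y X Z := by
    rw [fderiv_fderiv_comm hO s2 hy]
  have e1 := h.fderiv_gam' hy X Y Z
  have e2 := h.fderiv_gam' hy Y X Z
  rw [← eq_sub_iff_add_eq'] at e1 e2
  rw [curv_apply, curv_apply, map_sub, map_add, map_sub, e1, e2, h.gam_eq hy X (gam G' y Y Z),
    h.gam_eq hy Y (gam G' y X Z), h.gam_eq hy Y Z, h.gam_eq hy X Z, c3, c Y X]
  simp only [map_add]
  abel

variable {N w e₁ e₂ : Coord}

lemma Transition.nullFrame (h : Transition G U G' U' τ) (hy : y ∈ U')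
    (F : NullFrame (met G' y) N w e₁ e₂) :
    NullFrame (met G (τ y)) (fderiv ℝ τ y N) (fderiv ℝ τ y w) (fderiv ℝ τ y e₁)
      (fderiv ℝ τ y e₂) := by
  have e := h.met_eq y hy
  refine ⟨met_symm h.metric (h.maps y hy), ?_, ?_, ?_, ?_, ?_, ?_, ?_, ?_, ?_, fun v => ?_⟩
  · rw [← e, F.NN]
  · rw [← e, F.wN]
  · rw [← e, F.N1]
  · rw [← e, F.N2]
  · rw [← e, F.w1]
  · rw [← e, F.w2]
  · rw [← e, F.e11]
  · rw [← e, F.e22]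
  · rw [← e, F.e12]
  · obtain ⟨u, rfl⟩ := h.surj y hy v
    simp only [← e]
    conv_lhs => rw [F.complete u]
    simp only [map_add, map_smul]

lemma Transition.trg_eq (h : Transition G U G' U' τ) (hy : y ∈ U')
    (F : NullFrame (met G' y) N w e₁ e₂) {S : Coord → Coord → ℝ}
    (h1 : ∀ Y, IsLinearMap ℝ fun X => S X Y) (h2 : ∀ X, IsLinearMap ℝ (S X)) :
    trg (G' y) (fun X Y => S (fderiv ℝ τ y X) (fderiv ℝ τ y Y)) = trg (G (τ y)) S := by
  rw [F.trg_eq_of_isLinearMap h.metric' hy,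
    (h.nullFrame hy F).trg_eq_of_isLinearMap h.metric (h.maps y hy) h1 h2, ← h.met_eq y hy]
  · intro Y
    exact ((h1 (fderiv ℝ τ y Y)).mk' _ ∘ₗ (fderiv ℝ τ y).toLinearMap).isLinear
  · intro X
    exact ((h2 (fderiv ℝ τ y X)).mk' _ ∘ₗ (fderiv ℝ τ y).toLinearMap).isLinear

lemma Transition.ric_eq (h : Transition G U G' U' τ) (hy : y ∈ U')
    (F : NullFrame (met G' y) N w e₁ e₂) (K J : Coord) :
    ric G' y K J = ric G (τ y) (fderiv ℝ τ y K) (fderiv ℝ τ y J) := by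
  rw [← trg_curv h.metric' hy, ← trg_curv h.metric (h.maps y hy), ← h.trg_eq hy F]
  · simp only [h.met_eq y hy, h.curv_eq hy]
  · intro _; constructor <;> intros <;> simp
  · intro _; constructor <;> intros <;> simp

lemma Transition.scalarCurv_eq (h : Transition G U G' U' τ) (hy : y ∈ U')
    (F : NullFrame (met G' y) N w e₁ e₂) : scalarCurv G' y = scalarCurv G (τ y) := by
  rw [NullInfinity.scalarCurv_eq, NullInfinity.scalarCurv_eq, ← h.trg_eq hy F]
  · simp only [h.ric_eq hy F]
  · intro _; constructor <;> intros <;> simp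
  · intro _; constructor <;> intros <;> simp

/-- The Schouten tensor is a tensor. -/
lemma Transition.sch_eq (h : Transition G U G' U' τ) (hy : y ∈ U')
    (F : NullFrame (met G' y) N w e₁ e₂) (K J : Coord) :
    sch G' y K J = sch G (τ y) (fderiv ℝ τ y K) (fderiv ℝ τ y J) := by
  rw [sch_apply, sch_apply, h.ric_eq hy F, h.scalarCurv_eq hy F, h.met_eq y hy]

/-- The Weyl tensor is a tensor. -/
lemma Transition.wey_eq (h : Transition G U G' U' τ) (hy : y ∈ U')
    (F : NullFrame (met G' y) N w e₁ e₂) (L K I J : Coord) :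
    wey G' y L K I J = wey G (τ y) (fderiv ℝ τ y L) (fderiv ℝ τ y K) (fderiv ℝ τ y I)
      (fderiv ℝ τ y J) := by
  rw [wey_apply h.metric' hy, wey_apply h.metric (h.maps y hy), h.met_eq y hy, h.curv_eq hy]
  simp only [h.sch_eq hy F, h.met_eq y hy]

end

section

/-! ### Fields on the manifold in a chart -/

section Charts

variable {M : Type*} [TopologicalSpace M] [ChartedSpace Coord M]

/-- A field of bilinear forms, read in the model space. -/
def form (B : BilinField M) (x : M) : Form2 := B x

/-- The differential of the inverse of a chart. -/
def chartDiff (e : OpenPartialHomeomorph M Coord) (y : Coord) : Coord →L[ℝ] Coord :=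
  mfderiv 𝓘(ℝ, Coord) (𝓡 4) e.symm y

lemma met_comp (B : BilinField M) (e : OpenPartialHomeomorph M Coord) (y X Y : Coord) :
    met (comp B e) y X Y = form B (e.symm y) (chartDiff e y X) (chartDiff e y Y) := by
  refine bilin_eq (f := fun X Y => form B (e.symm y) (chartDiff e y X) (chartDiff e y Y)) ?_ ?_ X Y
  all_goals intro _; constructor <;> intros <;> simp

variable [IsManifold (𝓡 4) ∞ M] {e e' : OpenPartialHomeomorph M Coord} {y : Coord}

lemma mdifferentiable_of_mem_atlas' (he : e ∈ atlas Coord M) :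
    e.MDifferentiable (𝓡 4) (𝓡 4) := by
  have : IsManifold (𝓡 4) 1 M := IsManifold.of_le (n := ∞) (by simp)
  exact mdifferentiable_of_mem_atlas he

lemma chartDiff_bijective (he : e ∈ atlas Coord M) (hy : y ∈ e.target) :
    Function.Bijective (chartDiff e y) :=
  (mdifferentiable_of_mem_atlas' he).symm.mfderiv_bijective hy

/-- The differential of a chart inverse, as an equivalence. -/
def chartEquiv (he : e ∈ atlas Coord M) (hy : y ∈ e.target) : Coord ≃ₗ[ℝ] Coord :=
  LinearEquiv.ofBijective (chartDiff e y).toLinearMap (chartDiff_bijective he hy)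

lemma isLorentzForm_met {g : BilinField M} (hg : IsLorentzMetric g) (he : e ∈ atlas Coord M)
    (hy : y ∈ e.target) : IsLorentzForm (met (comp g e) y) := by
  obtain ⟨b, hb⟩ := hg.signature (e.symm y)
  let b' : Module.Basis (Fin 4) ℝ Coord := b
  refine ⟨b'.map (chartEquiv he hy).symm, fun i j => ?_⟩
  rw [met_comp]
  have : ∀ i, chartDiff e y ((b'.map (chartEquiv he hy).symm) i) = b' i := fun i => by
    rw [Module.Basis.map_apply]
    exact (chartEquiv he hy).apply_symm_apply (b' i)
  rw [this, this]
  exact hb i j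

lemma IsLorentzForm.eq_zero {B : Form2} (hB : IsLorentzForm B) {v : Coord}
    (hv : ∀ w, B w v = 0) : v = 0 := by
  obtain ⟨f, hf⟩ := hB.exists_coords
  refine f.ext_elem fun i => ?_
  have := hv (f i)
  rw [hf] at this
  fin_cases i <;> simpa [Finsupp.single_apply] using this

lemma metricOn_comp {g : BilinField M} (hg : IsLorentzMetric g) (he : e ∈ atlas Coord M) :
    MetricOn (comp g e) e.target where
  isOpen := e.open_target
  smooth := hg.smooth e he
  symm y hy i j := by
    have := (isLorentzForm_met hg he hy).symm (basisVec i) (basisVec j)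
    rwa [met_basisVec, met_basisVec] at this
  det y hy := by
    rw [isUnit_iff_ne_zero]
    intro h0
    obtain ⟨v, hv, e0⟩ := Matrix.exists_mulVec_eq_zero_iff.2 h0
    refine hv ?_
    have : WithLp.toLp 2 v = (0 : Coord) := by
      refine (isLorentzForm_met hg he hy).eq_zero fun w => ?_
      rw [met_apply]
      have : ∀ i, ∑ j, comp g e y i j * w i * v j = w i * ∑ j, comp g e y i j * v j := fun i => by
        rw [Finset.mul_sum]; exact Finset.sum_congr rfl fun _ _ => by ring
      refine Finset.sum_eq_zero fun i _ => (this i).trans ?_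
      have h1 := congrFun e0 i
      simp only [Matrix.mulVec, dotProduct, Pi.zero_apply] at h1
      rw [h1, mul_zero]
    funext i
    exact congrFun (congrArg WithLp.ofLp this) i

lemma contDiffOn_inChart {f : M → ℝ} (hf : ContMDiff (𝓡 4) 𝓘(ℝ, ℝ) ∞ f) (he : e ∈ atlas Coord M) :
    ContDiffOn ℝ ∞ (inChart f e) e.target := by
  rw [← contMDiffOn_iff_contDiffOn]
  exact hf.comp_contMDiffOn
    (contMDiffOn_symm_of_mem_maximalAtlas (IsManifold.subset_maximalAtlas he))

lemma fderiv_inChart {f : M → ℝ} (hf : ContMDiff (𝓡 4) 𝓘(ℝ, ℝ) ∞ f) (he : e ∈ atlas Coord M)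
    (hy : y ∈ e.target) (X : Coord) :
    fderiv ℝ (inChart f e) y X
      = (mfderiv (𝓡 4) 𝓘(ℝ, ℝ) f (e.symm y) : Coord →L[ℝ] ℝ) (chartDiff e y X) := by
  have h1 : MDifferentiableAt (𝓡 4) 𝓘(ℝ, ℝ) f (e.symm y) := (hf _).mdifferentiableAt (by simp)
  have h2 : MDifferentiableAt 𝓘(ℝ, Coord) (𝓡 4) e.symm y :=
    (mdifferentiable_of_mem_atlas' he).mdifferentiableAt_symm hy
  rw [← mfderiv_eq_fderiv]
  change mfderiv 𝓘(ℝ, Coord) 𝓘(ℝ, ℝ) (f ∘ e.symm) y X = _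
  rw [mfderiv_comp y h1 h2]
  rfl

lemma exists_completionOn {g : BilinField M} {Ω : M → ℝ} (hM : IsConformalCompletion 0 g Ω)
    (he : e ∈ atlas Coord M) : ∃ T, CompletionOn (comp g e) e.target (inChart Ω e) T := by
  obtain ⟨T, hT, hf⟩ := hM.field_eq e he
  refine ⟨T, metricOn_comp hM.metric he, contDiffOn_inChart hM.smooth he, hT, ?_, ?_⟩
  · intro y hy h0 hd
    refine hM.regular (e.symm y) h0 (ContinuousLinearMap.ext fun v => ?_)
    obtain ⟨X, hX⟩ := (chartDiff_bijective he hy).2 v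
    have := fderiv_inChart hM.smooth he hy X
    rw [hd, hX] at this
    exact this.symm
  · intro y hy hp i j
    have := hf y hy hp i j
    rw [zero_mul, add_zero] at this
    exact this

/-- The change of coordinates from `e'` to `e`. -/
def coordChange (e e' : OpenPartialHomeomorph M Coord) : Coord → Coord := fun y => e (e'.symm y)

lemma contDiffOn_coordChange (he : e ∈ atlas Coord M) (he' : e' ∈ atlas Coord M) :
    ContDiffOn ℝ ∞ (coordChange e e') (e'.target ∩ e'.symm ⁻¹' e.source) := by
  rw [← contMDiffOn_iff_contDiffOn]
  exact (contMDiffOn_of_mem_maximalAtlas (I := 𝓡 4) (IsManifold.subset_maximalAtlas he)).comp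
    ((contMDiffOn_symm_of_mem_maximalAtlas (IsManifold.subset_maximalAtlas he')).mono
      inter_subset_left) inter_subset_right

/-- A map into the manifold differentiated in a chart. -/
lemma mfderiv_eq_chartDiff {E H : Type*} [NormedAddCommGroup E] [NormedSpace ℝ E]
    [TopologicalSpace H] {I : ModelWithCorners ℝ E H} {N : Type*} [TopologicalSpace N]
    [ChartedSpace H N] (he : e ∈ atlas Coord M) {f : N → M} {z : N}
    (hf : MDifferentiableAt I (𝓡 4) f z) (hz : f z ∈ e.source) (v : E) :
    (mfderiv I (𝓡 4) f z : E →L[ℝ] Coord) v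
      = chartDiff e (e (f z)) ((mfderiv I 𝓘(ℝ, Coord) (fun x => e (f x)) z : E →L[ℝ] Coord) v) := by
  have h1 : MDifferentiableAt I 𝓘(ℝ, Coord) (fun x => e (f x)) z :=
    ((mdifferentiable_of_mem_atlas' he).mdifferentiableAt hz).comp z hf
  have h2 : MDifferentiableAt 𝓘(ℝ, Coord) (𝓡 4) e.symm (e (f z)) :=
    (mdifferentiable_of_mem_atlas' he).mdifferentiableAt_symm (e.map_source hz)
  have hev : f =ᶠ[𝓝 z] e.symm ∘ fun x => e (f x) := by
    filter_upwards [hf.continuousAt (e.open_source.mem_nhds hz)] with x hx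
    exact (e.left_inv hx).symm
  have h3 := mfderiv_comp z h2 h1
  have h4 := hev.mfderiv_eq (I := I) (I' := 𝓡 4)
  have h5 : (mfderiv I (𝓡 4) f z : E →L[ℝ] Coord)
      = (mfderiv I (𝓡 4) (e.symm ∘ fun x => e (f x)) z : E →L[ℝ] Coord) := h4
  rw [h5]
  exact congrArg (fun L : E →L[ℝ] Coord => L v) h3

lemma chartDiff_coordChange (he : e ∈ atlas Coord M) (he' : e' ∈ atlas Coord M)
    (hy : y ∈ e'.target ∩ e'.symm ⁻¹' e.source) (X : Coord) :
    chartDiff e (coordChange e e' y) (fderiv ℝ (coordChange e e') y X) = chartDiff e' y X := by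
  have := mfderiv_eq_chartDiff he (I := 𝓘(ℝ, Coord))
    ((mdifferentiable_of_mem_atlas' he').mdifferentiableAt_symm hy.1) hy.2 X
  rw [mfderiv_eq_fderiv] at this
  exact this.symm

/-- Fields of bilinear forms transform as tensors. -/
lemma met_comp_coordChange (B : BilinField M) (he : e ∈ atlas Coord M) (he' : e' ∈ atlas Coord M)
    (hy : y ∈ e'.target ∩ e'.symm ⁻¹' e.source) (X Y : Coord) :
    met (comp B e') y X Y = met (comp B e) (coordChange e e' y)
      (fderiv ℝ (coordChange e e') y X) (fderiv ℝ (coordChange e e') y Y) := by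
  have h : e.symm (coordChange e e' y) = e'.symm y := e.left_inv hy.2
  rw [met_comp, met_comp, chartDiff_coordChange he he' hy, chartDiff_coordChange he he' hy, h]

lemma fderiv_inChart_coordChange {f : M → ℝ} (hf : ContMDiff (𝓡 4) 𝓘(ℝ, ℝ) ∞ f)
    (he : e ∈ atlas Coord M) (he' : e' ∈ atlas Coord M)
    (hy : y ∈ e'.target ∩ e'.symm ⁻¹' e.source) (X : Coord) :
    fderiv ℝ (inChart f e) (coordChange e e' y) (fderiv ℝ (coordChange e e') y X)
      = fderiv ℝ (inChart f e') y X := by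
  have h : e.symm (coordChange e e' y) = e'.symm y := e.left_inv hy.2
  have hm : coordChange e e' y ∈ e.target := e.map_source hy.2
  rw [fderiv_inChart hf he hm, fderiv_inChart hf he' hy.1,
    chartDiff_coordChange he he' hy]
  have : ∀ x x' : M, x = x' → (mfderiv (𝓡 4) 𝓘(ℝ, ℝ) f x : Coord →L[ℝ] ℝ)
      = (mfderiv (𝓡 4) 𝓘(ℝ, ℝ) f x' : Coord →L[ℝ] ℝ) := by
    rintro x _ rfl; rfl
  rw [this _ _ h]
  rfl

lemma MetricOn.mono {G : MatField} {U V : Set Coord} (h : MetricOn G U) (hV : IsOpen V)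
    (hVU : V ⊆ U) : MetricOn G V :=
  ⟨hV, fun i j => (h.smooth i j).mono hVU, fun y hy => h.symm y (hVU hy),
    fun y hy => h.det y (hVU hy)⟩

lemma transition_comp {g : BilinField M} (hg : IsLorentzMetric g) (he : e ∈ atlas Coord M)
    (he' : e' ∈ atlas Coord M) :
    Transition (comp g e) e.target (comp g e') (e'.target ∩ e'.symm ⁻¹' e.source)
      (coordChange e e') where
  metric := metricOn_comp hg he
  metric' := (metricOn_comp hg he').mono (e'.isOpen_inter_preimage_symm e.open_source) inter_subset_left
  smooth := contDiffOn_coordChange he he'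
  maps y hy := e.map_source hy.2
  surj y hy := by
    refine LinearMap.surjective_of_injective (f := (fderiv ℝ (coordChange e e') y).toLinearMap) ?_
    intro X Y hXY
    refine (chartDiff_bijective he' hy.1).1 ?_
    rw [← chartDiff_coordChange he he' hy, ← chartDiff_coordChange he he' hy]
    exact congrArg _ hXY
  met_eq y hy := met_comp_coordChange g he he' hy

end Charts

end

section

/-! ### Conformally parametrised surfaces in infinity -/

lemma IsLorentzForm.smul_eq_of_conformal {B : Form2} (hB : IsLorentzForm B)
    {N X Y v : Coord} (hN0 : N ≠ 0) (NN : B N N = 0) (hex : ∃ w, B w N = 1) {c : ℝ} (hc : 0 < c)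
    (XN : B X N = 0) (YN : B Y N = 0) (XX : B X X = c) (YY : B Y Y = c) (XY : B X Y = 0)
    (hv : B v N = 0) : ∃ t : ℝ, c • v = t • N + B v X • X + B v Y • Y := by
  obtain ⟨w, F⟩ := hB.exists_nullFrame_of_conformal hN0 NN hex hc XN YN XX YY XY
  refine ⟨c * B v w, ?_⟩
  have q : 0 < √c := Real.sqrt_pos.2 hc
  have q2 : c * ((√c)⁻¹ * (√c)⁻¹) = 1 := by
    field_simp; rw [Real.sq_sqrt hc.le]
  conv_lhs => rw [F.tangent hv]
  simp only [map_smul, smul_eq_mul, smul_add, smul_smul]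
  congr 1
  · congr 2
    linear_combination (B v X) * q2
  · congr 1
    linear_combination (B v Y) * q2

/-- `P` is at `y` a symmetric, transverse, trace-free Codazzi tensor on the level set of `Ω`. -/
structure IsCodazziAt (G : MatField) (Ω : Coord → ℝ) (P : Coord → Form2) (y : Coord) : Prop where
  differentiable : DifferentiableAt ℝ P y
  symm : ∀ X Y, fderiv ℝ Ω y X = 0 → fderiv ℝ Ω y Y = 0 → P y X Y = P y Y X
  transverse : ∀ X, fderiv ℝ Ω y X = 0 → P y X (grad G Ω y) = 0
  trace : ∀ X Y c, 0 < c → fderiv ℝ Ω y X = 0 → fderiv ℝ Ω y Y = 0 → met G y X X = c →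
    met G y Y Y = c → met G y X Y = 0 → P y X X + P y Y Y = 0
  codazzi : ∀ X Y Z, fderiv ℝ Ω y X = 0 → fderiv ℝ Ω y Y = 0 → fderiv ℝ Ω y Z = 0 →
    covB G P y X Y Z = covB G P y Y X Z

/-- The covariant derivative along the surface `u` of its coordinate fields. -/
def covU (G : MatField) (u : ℂ → Coord) (z a b : ℂ) : Coord :=
  fderiv ℝ (fderiv ℝ u) z a b + gam G (u z) (fderiv ℝ u z a) (fderiv ℝ u z b)

variable {G T : MatField} {U : Set Coord} {Ω : Coord → ℝ} {u : ℂ → Coord} {z : ℂ}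

lemma fderiv_eval_surface {P : Coord → Form2} (hu : ContDiffAt ℝ ∞ u z)
    (hP : DifferentiableAt ℝ P (u z)) (a b : ℂ) :
    DifferentiableAt ℝ (fun x => P (u x) (fderiv ℝ u x a) (fderiv ℝ u x b)) z ∧
    ∀ c, fderiv ℝ (fun x => P (u x) (fderiv ℝ u x a) (fderiv ℝ u x b)) z c
      = covB G P (u z) (fderiv ℝ u z c) (fderiv ℝ u z a) (fderiv ℝ u z b)
        + P (u z) (covU G u z c a) (fderiv ℝ u z b)
        + P (u z) (fderiv ℝ u z a) (covU G u z c b) := by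
  have d1 := (hu.differentiableAt (by simp)).hasFDerivAt
  have d2 := ((hu.fderiv_right (m := ∞) (by simp)).differentiableAt (by simp)).hasFDerivAt
  have d3 : HasFDerivAt (fun x => P (u x)) ((fderiv ℝ P (u z)).comp (fderiv ℝ u z)) z :=
    hP.hasFDerivAt.comp z d1
  have d4 : ∀ A, HasFDerivAt (fun x => fderiv ℝ u x A) ((fderiv ℝ (fderiv ℝ u) z).flip A) z := by
    intro A
    exact (d2.clm_apply (hasFDerivAt_const A z)).congr_fderiv (by ext W; simp)
  have d5 := (d3.clm_apply (d4 a)).clm_apply (d4 b)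
  refine ⟨d5.differentiableAt, fun c => ?_⟩
  rw [d5.fderiv]
  simp only [add_apply, ContinuousLinearMap.comp_apply, ContinuousLinearMap.flip_apply, covB, covU,
    map_add]
  ring

lemma covU_symm (h : MetricOn G U) (hu : ContDiffAt ℝ ∞ u z) (hz : u z ∈ U) (a b : ℂ) :
    covU G u z a b = covU G u z b a := by
  rw [covU, covU, gam_symm h hz]
  congr 1
  exact (hu.isSymmSndFDerivAt
    (by simpa using (WithTop.coe_le_coe.2 (le_top (a := (2 : ℕ∞)))))) a b

lemma covB_met (h : MetricOn G U) {y : Coord} (hy : y ∈ U) (X Y Z : Coord) :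
    covB G (met G) y X Y Z = 0 := by
  rw [covB, fderiv_met h hy]; ring

lemma fderiv_surface (hU : IsOpen U) (hΩ : ContDiffOn ℝ ∞ Ω U) (hu : ContDiffAt ℝ ∞ u z)
    (hz : u z ∈ U) (h0 : ∀ᶠ x in 𝓝 z, Ω (u x) = 0) (a : ℂ) :
    fderiv ℝ Ω (u z) (fderiv ℝ u z a) = 0 := by
  have d1 := (hu.differentiableAt (by simp)).hasFDerivAt
  have d2 : HasFDerivAt (fun x => Ω (u x)) ((fderiv ℝ Ω (u z)).comp (fderiv ℝ u z)) z :=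
    (diffAt hU hΩ hz).hasFDerivAt.comp z d1
  have h1 : fderiv ℝ (fun x => Ω (u x)) z = fderiv ℝ (fun _ => (0 : ℝ)) z :=
    Filter.EventuallyEq.fderiv_eq h0
  rw [d2.fderiv] at h1
  have := congrArg (fun L : ℂ →L[ℝ] ℝ => L a) h1
  simpa using this

lemma fderiv_covU (hU : IsOpen U) (hΩ : ContDiffOn ℝ ∞ Ω U) (hu : ∀ᶠ x in 𝓝 z, ContDiffAt ℝ ∞ u x)
    (hz : u z ∈ U) (h0 : ∀ᶠ x in 𝓝 z, Ω (u x) = 0)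
    (hH : ∀ A B, hess G Ω (u z) A B = 0) (a b : ℂ) :
    fderiv ℝ Ω (u z) (covU G u z a b) = 0 := by
  have huz := hu.self_of_nhds
  have d1 := (huz.differentiableAt (by simp)).hasFDerivAt
  have d2 := ((huz.fderiv_right (m := ∞) (by simp)).differentiableAt (by simp)).hasFDerivAt
  have d3 : HasFDerivAt (fun x => fderiv ℝ Ω (u x))
      ((fderiv ℝ (fderiv ℝ Ω) (u z)).comp (fderiv ℝ u z)) z :=
    (diffAt hU (contDiffOn_fderiv hU hΩ) hz).hasFDerivAt.comp z d1
  have d4 := d3.clm_apply (d2.clm_apply (hasFDerivAt_const b z))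
  have hev : ∀ᶠ x in 𝓝 z, fderiv ℝ Ω (u x) (fderiv ℝ u x b) = 0 := by
    have hUz : ∀ᶠ x in 𝓝 z, u x ∈ U := huz.continuousAt (hU.mem_nhds hz)
    filter_upwards [hu, hUz, h0.eventually_nhds] with x h1 h2 h3
    exact fderiv_surface hU hΩ h1 h2 h3 b
  have h1 : fderiv ℝ (fun x => fderiv ℝ Ω (u x) (fderiv ℝ u x b)) z
      = fderiv ℝ (fun _ => (0 : ℝ)) z := Filter.EventuallyEq.fderiv_eq hev
  rw [d4.fderiv] at h1
  have h2 := congrArg (fun L : ℂ →L[ℝ] ℝ => L a) h1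
  simp only [add_apply, ContinuousLinearMap.comp_apply, ContinuousLinearMap.flip_apply,
    fderiv_fun_const, Pi.zero_apply, zero_apply, map_zero, zero_add] at h2
  have h3 := hH (fderiv ℝ u z a) (fderiv ℝ u z b)
  rw [hess] at h3
  rw [covU, map_add]
  linarith

/-- The surface `u` is, near `z`, a conformal immersion into the level set `Ω = 0`. -/
structure IsConformalNear (G : MatField) (U : Set Coord) (Ω : Coord → ℝ) (u : ℂ → Coord) (z a b : ℂ) :
    Prop where
  smooth : ∀ᶠ x in 𝓝 z, ContDiffAt ℝ ∞ u x
  mem : u z ∈ U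
  level : ∀ᶠ x in 𝓝 z, Ω (u x) = 0
  pos : 0 < met G (u z) (fderiv ℝ u z a) (fderiv ℝ u z a)
  equal : ∀ᶠ x in 𝓝 z, met G (u x) (fderiv ℝ u x a) (fderiv ℝ u x a)
    = met G (u x) (fderiv ℝ u x b) (fderiv ℝ u x b)
  orthogonal : ∀ᶠ x in 𝓝 z, met G (u x) (fderiv ℝ u x a) (fderiv ℝ u x b) = 0

/-- The components of a Codazzi tensor on a conformally parametrised surface satisfy a
Cauchy–Riemann equation. -/
lemma CompletionOn.cauchyRiemann (h : CompletionOn G U Ω T) {a b : ℂ}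
    (hu : IsConformalNear G U Ω u z a b) (hL : IsLorentzForm (met G (u z)))
    (hH : ∀ A B, hess G Ω (u z) A B = 0) {P : Coord → Form2} (hP : IsCodazziAt G Ω P (u z)) :
    fderiv ℝ (fun x => P (u x) (fderiv ℝ u x a) (fderiv ℝ u x a)) z b
      = fderiv ℝ (fun x => P (u x) (fderiv ℝ u x b) (fderiv ℝ u x a)) z a := by
  have hm := h.metric
  have hO := hm.isOpen
  have hz := hu.mem
  have huz := hu.smooth.self_of_nhds
  have h0 := hu.level.self_of_nhds
  rw [(fderiv_eval_surface (G := G) huz hP.differentiable a a).2,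
    (fderiv_eval_surface (G := G) huz hP.differentiable b a).2]
  have ta := fderiv_surface hO h.smooth huz hz hu.level a
  have tb := fderiv_surface hO h.smooth huz hz hu.level b
  have tc := fderiv_covU hO h.smooth hu.smooth hz hu.level hH
  have hd := diffAt hO hm.contDiffOn_met hz
  have eN : ∀ V, met G (u z) V (grad G Ω (u z)) = fderiv ℝ Ω (u z) V := fun V => by
    rw [met_symm hm hz, met_grad hm hz]
  have hex : ∃ w, met G (u z) w (grad G Ω (u z)) = 1 :=
    ⟨transv Ω (u z), by rw [eN, fderiv_transv (h.regular _ hz h0)]⟩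
  have eq1 := hu.equal.self_of_nhds
  have ort := hu.orthogonal.self_of_nhds
  have s := met_symm hm hz
  have cs := covU_symm hm huz hz
  have m1 : met G (u z) (covU G u z a b) (fderiv ℝ u z b)
      = met G (u z) (covU G u z a a) (fderiv ℝ u z a) := by
    have := congrArg (fun L : ℂ →L[ℝ] ℝ => L a) (Filter.EventuallyEq.fderiv_eq hu.equal)
    rw [(fderiv_eval_surface (G := G) huz hd a a).2, (fderiv_eval_surface (G := G) huz hd b b).2,
      covB_met hm hz, covB_met hm hz, s (fderiv ℝ u z a) (covU G u z a a),
      s (fderiv ℝ u z b) (covU G u z a b)] at this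
    linarith
  have m2 : met G (u z) (covU G u z a a) (fderiv ℝ u z b)
      + met G (u z) (covU G u z a b) (fderiv ℝ u z a) = 0 := by
    have h1 : fderiv ℝ (fun x => met G (u x) (fderiv ℝ u x a) (fderiv ℝ u x b)) z
      = fderiv ℝ (fun _ => (0 : ℝ)) z := Filter.EventuallyEq.fderiv_eq hu.orthogonal
    have := congrArg (fun L : ℂ →L[ℝ] ℝ => L a) h1
    rw [(fderiv_eval_surface (G := G) huz hd a b).2, covB_met hm hz,
      s (fderiv ℝ u z a) (covU G u z a b)] at this
    simpa using this
  set c := met G (u z) (fderiv ℝ u z a) (fderiv ℝ u z a) with hc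
  obtain ⟨t₁, f₁⟩ := hL.smul_eq_of_conformal (h.grad_ne_zero hz h0) (h.grad_null hz h0) hex hu.pos
    ((eN _).trans ta) ((eN _).trans tb) hc.symm eq1.symm ort ((eN _).trans (tc a b))
  obtain ⟨t₂, f₂⟩ := hL.smul_eq_of_conformal (h.grad_ne_zero hz h0) (h.grad_null hz h0) hex hu.pos
    ((eN _).trans ta) ((eN _).trans tb) hc.symm eq1.symm ort ((eN _).trans (tc a a))
  have p1 := congrArg (P (u z) (fderiv ℝ u z a)) f₁
  have p2 := congrArg (P (u z) (fderiv ℝ u z b)) f₂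
  simp only [map_add, map_smul, smul_eq_mul, hP.transverse _ ta, hP.transverse _ tb] at p1 p2
  have tr := hP.trace _ _ c hu.pos ta tb hc.symm eq1.symm ort
  have sy := hP.symm _ _ tb ta
  have cod := hP.codazzi _ _ _ tb ta ta
  have sy2 := hP.symm _ _ (tc b a) ta
  rw [cs b a] at sy2 ⊢
  rw [cod]
  have hcz : c ≠ 0 := hu.pos.ne'
  have : c * (P (u z) (fderiv ℝ u z a) (covU G u z a b)
      - P (u z) (fderiv ℝ u z b) (covU G u z a a)) = 0 := by
    rw [mul_sub, p1, p2, sy]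
    linear_combination (P (u z) (fderiv ℝ u z a) (fderiv ℝ u z b)) * m1
      - (met G (u z) (covU G u z a a) (fderiv ℝ u z b)) * tr
      + (P (u z) (fderiv ℝ u z a) (fderiv ℝ u z a)) * m2
  have := (mul_eq_zero.1 this).resolve_left hcz
  linarith

end

section

/-! ### Codazzi tensors on conformal planes -/

section Planes

variable {M : Type*} [TopologicalSpace M] [ChartedSpace Coord M]

/-- `φ` is a conformal immersion of the plane into infinity. -/
structure IsConformalPlane (g : BilinField M) (Ω : M → ℝ) (φ : ℂ → M) : Prop where
  smooth : ContMDiff 𝓘(ℝ, ℂ) (𝓡 4) ∞ φ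
  mem_scri : ∀ z, φ z ∈ scri Ω
  conformal : ∀ z, ∃ c : ℝ, 0 < c ∧ ∀ v w : ℂ,
    form g (φ z) ((mfderiv 𝓘(ℝ, ℂ) (𝓡 4) φ z : ℂ →L[ℝ] Coord) v)
      ((mfderiv 𝓘(ℝ, ℂ) (𝓡 4) φ z : ℂ →L[ℝ] Coord) w) = c * (v.re * w.re + v.im * w.im)

/-- A tensor on the portion `S` of infinity, given by its components in each chart, that is
symmetric, transverse, trace-free and Codazzi. -/
structure IsCodazziField (g : BilinField M) (Ω : M → ℝ) (S : Set M)
    (P : OpenPartialHomeomorph M Coord → Coord → Form2) : Prop where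
  codazzi : ∀ e ∈ atlas Coord M, ∀ y ∈ e.target, e.symm y ∈ S →
    IsCodazziAt (comp g e) (inChart Ω e) (P e) y
  tensor : ∀ e ∈ atlas Coord M, ∀ e' ∈ atlas Coord M, ∀ y ∈ e'.target ∩ e'.symm ⁻¹' e.source,
    e'.symm y ∈ S → ∀ X Y, fderiv ℝ (inChart Ω e') y X = 0 → fderiv ℝ (inChart Ω e') y Y = 0 →
      P e' y X Y = P e (coordChange e e' y) (fderiv ℝ (coordChange e e') y X)
        (fderiv ℝ (coordChange e e') y Y)

/-- A component of the tensor `P` in the frame of the surface `φ`. -/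
def surfaceComp (P : OpenPartialHomeomorph M Coord → Coord → Form2) (φ : ℂ → M)
    (e : OpenPartialHomeomorph M Coord) (z a b : ℂ) : ℝ :=
  P e (e (φ z)) (fderiv ℝ (fun x => e (φ x)) z a) (fderiv ℝ (fun x => e (φ x)) z b)

/-- The complex component `P(∂ₓ, ∂ₓ) - i P(∂ₓ, ∂ᵧ)` of a trace-free tensor on the surface `φ`. -/
def surfaceFun (P : OpenPartialHomeomorph M Coord → Coord → Form2) (φ : ℂ → M) (z : ℂ) : ℂ :=
  ⟨surfaceComp P φ (chartAt Coord (φ z)) z 1 1,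
    - surfaceComp P φ (chartAt Coord (φ z)) z 1 Complex.I⟩

variable {e e' : OpenPartialHomeomorph M Coord} {g : BilinField M} {Ω : M → ℝ} {S : Set M}
  {P : OpenPartialHomeomorph M Coord → Coord → Form2} {φ φ' : ℂ → M} {z : ℂ}

lemma IsConformalPlane.eventually_mem (hφ : IsConformalPlane g Ω φ) (hz : φ z ∈ e.source) :
    ∀ᶠ x in 𝓝 z, φ x ∈ e.source :=
  hφ.smooth.continuous.continuousAt (e.open_source.mem_nhds hz)

variable [IsManifold (𝓡 4) ∞ M]

lemma IsConformalPlane.contDiffAt (hφ : IsConformalPlane g Ω φ) (he : e ∈ atlas Coord M)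
    (hz : φ z ∈ e.source) : ContDiffAt ℝ ∞ (fun x => e (φ x)) z := by
  rw [← contMDiffAt_iff_contDiffAt]
  exact ((contMDiffOn_of_mem_maximalAtlas (IsManifold.subset_maximalAtlas he)).contMDiffAt
    (e.open_source.mem_nhds hz)).comp z (hφ.smooth z)

lemma IsConformalPlane.met_eq (hφ : IsConformalPlane g Ω φ) (he : e ∈ atlas Coord M)
    (hz : φ z ∈ e.source) (v w : ℂ) :
    met (comp g e) (e (φ z)) (fderiv ℝ (fun x => e (φ x)) z v) (fderiv ℝ (fun x => e (φ x)) z w)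
      = form g (φ z) ((mfderiv 𝓘(ℝ, ℂ) (𝓡 4) φ z : ℂ →L[ℝ] Coord) v)
        ((mfderiv 𝓘(ℝ, ℂ) (𝓡 4) φ z : ℂ →L[ℝ] Coord) w) := by
  have hd := (hφ.smooth z).mdifferentiableAt (by simp)
  rw [met_comp, e.left_inv hz, mfderiv_eq_chartDiff he hd hz, mfderiv_eq_chartDiff he hd hz,
    mfderiv_eq_fderiv]
  rfl

lemma IsConformalPlane.isConformalNear (hφ : IsConformalPlane g Ω φ) (he : e ∈ atlas Coord M)
    (hz : φ z ∈ e.source) :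
    IsConformalNear (comp g e) e.target (inChart Ω e) (fun x => e (φ x)) z 1 Complex.I ∧
    IsConformalNear (comp g e) e.target (inChart Ω e) (fun x => e (φ x)) z Complex.I 1 := by
  have hev := hφ.eventually_mem hz
  have h1 : ∀ᶠ x in 𝓝 z, ContDiffAt ℝ ∞ (fun x => e (φ x)) x := by
    filter_upwards [hev] with x hx using hφ.contDiffAt he hx
  have h2 : ∀ᶠ x in 𝓝 z, inChart Ω e (e (φ x)) = 0 := by
    filter_upwards [hev] with x hx
    rw [inChart, e.left_inv hx]
    exact hφ.mem_scri x
  have hp : ∀ v : ℂ, 0 < v.re * v.re + v.im * v.im → 0 < met (comp g e) (e (φ z))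
      (fderiv ℝ (fun x => e (φ x)) z v) (fderiv ℝ (fun x => e (φ x)) z v) := by
    intro v hv
    obtain ⟨c, hc, hcf⟩ := hφ.conformal z
    rw [hφ.met_eq he hz, hcf]
    positivity
  refine ⟨⟨h1, e.map_source hz, h2, hp 1 (by simp), ?_, ?_⟩,
    ⟨h1, e.map_source hz, h2, hp Complex.I (by simp), ?_, ?_⟩⟩
  all_goals
    filter_upwards [hev] with x hx
    obtain ⟨c, hc, hcf⟩ := hφ.conformal x
    simp only [hφ.met_eq he hx, hcf]
    simp

lemma IsConformalPlane.tangent (hM : IsConformalCompletion 0 g Ω) (hφ : IsConformalPlane g Ω φ)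
    (he : e ∈ atlas Coord M) (hz : φ z ∈ e.source) (v : ℂ) :
    fderiv ℝ (inChart Ω e) (e (φ z)) (fderiv ℝ (fun x => e (φ x)) z v) = 0 :=
  fderiv_surface (u := fun x => e (φ x)) e.open_target (contDiffOn_inChart hM.smooth he)
    (hφ.contDiffAt he hz) (e.map_source hz) (hφ.isConformalNear he hz).1.level v

/-- The components in the frame of a surface do not depend on the chart. -/
lemma surfaceComp_eq (hM : IsConformalCompletion 0 g Ω) (hφ : IsConformalPlane g Ω φ)
    (hP : IsCodazziField g Ω S P) (hS : φ z ∈ S) (he : e ∈ atlas Coord M)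
    (he' : e' ∈ atlas Coord M) (hz : φ z ∈ e.source) (hz' : φ z ∈ e'.source) (a b : ℂ) :
    surfaceComp P φ e' z a b = surfaceComp P φ e z a b := by
  have hl : e'.symm (e' (φ z)) = φ z := e'.left_inv hz'
  have hy : e' (φ z) ∈ e'.target ∩ e'.symm ⁻¹' e.source :=
    ⟨e'.map_source hz', by rw [mem_preimage, hl]; exact hz⟩
  have hc : ∀ v, fderiv ℝ (coordChange e e') (e' (φ z)) (fderiv ℝ (fun x => e' (φ x)) z v)
      = fderiv ℝ (fun x => e (φ x)) z v := by
    intro v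
    have d1 := (diffAt (e'.isOpen_inter_preimage_symm e.open_source)
      (contDiffOn_coordChange he he') hy).hasFDerivAt
    have d2 := ((hφ.contDiffAt he' hz').differentiableAt (by simp)).hasFDerivAt
    have hev : (fun x => e (φ x)) =ᶠ[𝓝 z] coordChange e e' ∘ fun x => e' (φ x) := by
      filter_upwards [hφ.eventually_mem hz'] with x hx
      simp only [coordChange, Function.comp_apply, e'.left_inv hx]
    rw [hev.fderiv_eq, (d1.comp z d2).fderiv]
    rfl
  have := hP.tensor e he e' he' _ hy (by rw [hl]; exact hS) _ _ (hφ.tangent hM he' hz' a)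
    (hφ.tangent hM he' hz' b)
  rw [hc, hc] at this
  rw [surfaceComp, this, surfaceComp, coordChange, hl]

lemma surfaceFun_eq (hM : IsConformalCompletion 0 g Ω) (hφ : IsConformalPlane g Ω φ)
    (hP : IsCodazziField g Ω S P) (hS : φ z ∈ S) (he : e ∈ atlas Coord M) (hz : φ z ∈ e.source) :
    surfaceFun P φ z = ⟨surfaceComp P φ e z 1 1, - surfaceComp P φ e z 1 Complex.I⟩ := by
  rw [surfaceFun, surfaceComp_eq hM hφ hP hS he (chart_mem_atlas _ _) hz (mem_chart_source _ _),
    surfaceComp_eq hM hφ hP hS he (chart_mem_atlas _ _) hz (mem_chart_source _ _)]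

lemma hess_eq_zero (hM : IsConformalCompletion 0 g Ω) (hd : IsDivergenceFree g Ω)
    (he : e ∈ atlas Coord M) {y : Coord} (hy : y ∈ e.target) (h0 : e.symm y ∈ scri Ω)
    (A B : Coord) : hess (comp g e) (inChart Ω e) y A B = 0 := by
  obtain ⟨T, hT⟩ := exists_completionOn hM he
  refine hT.hess_eq_zero hy h0 ?_ A B
  rw [← hd e he y hy h0, trg]
  simp only [hess_basisVec hT.metric hT.smooth hy]

lemma surfaceComp_trace (hM : IsConformalCompletion 0 g Ω) (hφ : IsConformalPlane g Ω φ)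
    (hP : IsCodazziField g Ω S P) (hS : φ z ∈ S) (he : e ∈ atlas Coord M) (hz : φ z ∈ e.source) :
    surfaceComp P φ e z Complex.I 1 = surfaceComp P φ e z 1 Complex.I ∧
    surfaceComp P φ e z Complex.I Complex.I = - surfaceComp P φ e z 1 1 := by
  have c := hP.codazzi e he (e (φ z)) (e.map_source hz) (by rw [e.left_inv hz]; exact hS)
  have n := (hφ.isConformalNear he hz).1
  have t := hφ.tangent hM he hz
  refine ⟨c.symm _ _ (t _) (t _), ?_⟩
  have := c.trace _ _ _ n.pos (t 1) (t Complex.I) rfl n.equal.self_of_nhds.symm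
    n.orthogonal.self_of_nhds
  rw [surfaceComp, surfaceComp]
  linarith

/-- The complex component of a Codazzi tensor on a conformal plane is holomorphic. -/
lemma differentiable_surfaceFun (hM : IsConformalCompletion 0 g Ω) (hd : IsDivergenceFree g Ω)
    (hφ : IsConformalPlane g Ω φ) (hP : IsCodazziField g Ω S P) (hS : ∀ z, φ z ∈ S) :
    Differentiable ℂ (surfaceFun P φ) := by
  intro z
  set e := chartAt Coord (φ z) with he_def
  have he : e ∈ atlas Coord M := chart_mem_atlas _ _
  have hz : φ z ∈ e.source := mem_chart_source _ _
  have hl : e.symm (e (φ z)) = φ z := e.left_inv hz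
  obtain ⟨T, hT⟩ := exists_completionOn hM he
  have hy := e.map_source hz
  have c := hP.codazzi e he (e (φ z)) hy (by rw [hl]; exact hS z)
  have hH := hess_eq_zero hM hd he hy (by rw [hl]; exact hφ.mem_scri z)
  have hL := isLorentzForm_met hM.metric he hy
  obtain ⟨n1, n2⟩ := hφ.isConformalNear he hz
  have r1 := hT.cauchyRiemann n1 hL hH c
  have r2 := hT.cauchyRiemann n2 hL hH c
  change fderiv ℝ (fun x => surfaceComp P φ e x 1 1) z Complex.I
    = fderiv ℝ (fun x => surfaceComp P φ e x Complex.I 1) z 1 at r1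
  change fderiv ℝ (fun x => surfaceComp P φ e x Complex.I Complex.I) z 1
    = fderiv ℝ (fun x => surfaceComp P φ e x 1 Complex.I) z Complex.I at r2
  have hev := hφ.eventually_mem hz
  have e1 : (fun x => surfaceComp P φ e x Complex.I 1) =ᶠ[𝓝 z]
      fun x => surfaceComp P φ e x 1 Complex.I := by
    filter_upwards [hev] with x hx using (surfaceComp_trace hM hφ hP (hS x) he hx).1
  have e2 : (fun x => surfaceComp P φ e x Complex.I Complex.I) =ᶠ[𝓝 z]
      fun x => - surfaceComp P φ e x 1 1 := by
    filter_upwards [hev] with x hx using (surfaceComp_trace hM hφ hP (hS x) he hx).2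
  rw [e1.fderiv_eq] at r1
  rw [e2.fderiv_eq, fderiv_fun_neg, neg_apply] at r2
  have dA : DifferentiableAt ℝ (fun x => surfaceComp P φ e x 1 1) z :=
    (fderiv_eval_surface (G := comp g e) n1.smooth.self_of_nhds c.differentiable 1 1).1
  have dB : DifferentiableAt ℝ (fun x => surfaceComp P φ e x 1 Complex.I) z :=
    (fderiv_eval_surface (G := comp g e) n1.smooth.self_of_nhds c.differentiable 1 Complex.I).1
  have ev : surfaceFun P φ =ᶠ[𝓝 z] fun x => (surfaceComp P φ e x 1 1 : ℂ)
      - Complex.I * (surfaceComp P φ e x 1 Complex.I : ℂ) := by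
    filter_upwards [hev] with x hx
    rw [surfaceFun_eq hM hφ hP (hS x) he hx]
    apply Complex.ext <;> simp
  rw [ev.differentiableAt_iff]
  have hA := Complex.ofRealCLM.hasFDerivAt.comp z dA.hasFDerivAt
  have hB := Complex.ofRealCLM.hasFDerivAt.comp z dB.hasFDerivAt
  have hAB : HasFDerivAt (fun x => (surfaceComp P φ e x 1 1 : ℂ)
      - Complex.I * (surfaceComp P φ e x 1 Complex.I : ℂ)) _ z := hA.fun_sub (hB.const_mul Complex.I)
  rw [differentiableAt_complex_iff_differentiableAt_real]
  refine ⟨hAB.differentiableAt, ?_⟩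
  rw [hAB.fderiv]
  simp only [sub_apply, smul_apply, ContinuousLinearMap.comp_apply, Complex.ofRealCLM_apply,
    smul_eq_mul]
  rw [r1, ← r2]
  apply Complex.ext <;> simp

/-- The effect of the inversion of the plane on the complex component of a Codazzi tensor. -/
lemma surfaceFun_inv (hM : IsConformalCompletion 0 g Ω)
    (hφ : IsConformalPlane g Ω φ) (hφ' : IsConformalPlane g Ω φ') (hP : IsCodazziField g Ω S P)
    (hS : ∀ z, φ z ∈ S) (hinv : ∀ z, z ≠ 0 → φ z = φ' z⁻¹) (hz0 : z ≠ 0) :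
    surfaceFun P φ z = (-(z ^ 2)⁻¹) ^ 2 * surfaceFun P φ' z⁻¹ := by
  set e := chartAt Coord (φ z) with he_def
  have he : e ∈ atlas Coord M := chart_mem_atlas _ _
  have hz : φ z ∈ e.source := mem_chart_source _ _
  have hz' : φ' z⁻¹ ∈ e.source := by rw [← hinv z hz0]; exact hz
  have hS' : φ' z⁻¹ ∈ S := by rw [← hinv z hz0]; exact hS z
  rw [surfaceFun_eq hM hφ hP (hS z) he hz, surfaceFun_eq hM hφ' hP hS' he hz']
  obtain ⟨t1, t2⟩ := surfaceComp_trace hM hφ' hP hS' he hz'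
  set ζ : ℂ := -(z ^ 2)⁻¹ with hζ
  have hd : ∀ v, fderiv ℝ (fun x => e (φ x)) z v = fderiv ℝ (fun x => e (φ' x)) z⁻¹ (ζ * v) := by
    intro v
    have hev : (fun x => e (φ x)) =ᶠ[𝓝 z] (fun x => e (φ' x)) ∘ fun x : ℂ => x⁻¹ := by
      filter_upwards [isOpen_ne.mem_nhds hz0] with x hx
      simp only [Function.comp_apply, hinv x hx]
    have d1 := ((hφ'.contDiffAt he hz').differentiableAt (by simp)).hasFDerivAt
    have d2 : HasFDerivAt (fun x : ℂ => x⁻¹) _ z :=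
      (hasDerivAt_inv hz0).hasFDerivAt.restrictScalars ℝ
    rw [hev.fderiv_eq, (d1.comp z d2).fderiv]
    simp [mul_comm, hζ]
  have hlin : ∀ v, fderiv ℝ (fun x => e (φ' x)) z⁻¹ v
      = v.re • fderiv ℝ (fun x => e (φ' x)) z⁻¹ 1
        + v.im • fderiv ℝ (fun x => e (φ' x)) z⁻¹ Complex.I := by
    intro v
    rw [← map_smul, ← map_smul, ← map_add]
    congr 1
    apply Complex.ext <;> simp
  have hc : ∀ a b, surfaceComp P φ e z a b
      = (ζ * a).re * (ζ * b).re * surfaceComp P φ' e z⁻¹ 1 1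
        + (ζ * a).re * (ζ * b).im * surfaceComp P φ' e z⁻¹ 1 Complex.I
        + (ζ * a).im * (ζ * b).re * surfaceComp P φ' e z⁻¹ Complex.I 1
        + (ζ * a).im * (ζ * b).im * surfaceComp P φ' e z⁻¹ Complex.I Complex.I := by
    intro a b
    rw [surfaceComp, hd, hd, hlin (ζ * a), hlin (ζ * b), hinv z hz0]
    simp only [map_add, map_smul, add_apply, smul_apply, smul_eq_mul, surfaceComp]
    ring
  rw [hc, hc, t1, t2]
  apply Complex.ext <;> simp [pow_two] <;> ring

/-- A Codazzi tensor vanishes along a conformal plane that closes up to a sphere. -/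
lemma surfaceFun_eq_zero (hM : IsConformalCompletion 0 g Ω) (hd : IsDivergenceFree g Ω)
    (hφ : IsConformalPlane g Ω φ) (hφ' : IsConformalPlane g Ω φ') (hP : IsCodazziField g Ω S P)
    (hS : ∀ z, φ z ∈ S) (hS' : ∀ z, φ' z ∈ S) (hinv : ∀ z, z ≠ 0 → φ z = φ' z⁻¹) (z : ℂ) :
    surfaceFun P φ z = 0 := by
  refine (differentiable_surfaceFun hM hd hφ hP hS).apply_eq_of_tendsto_cocompact z ?_
  have hinv0 : Tendsto (fun z : ℂ => z⁻¹) (cocompact ℂ) (𝓝 0) := by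
    rw [← Metric.cobounded_eq_cocompact]
    exact tendsto_inv₀_cobounded
  have hc := (differentiable_surfaceFun hM hd hφ' hP hS').continuous.continuousAt (x := 0)
  have h1 := (((hinv0.pow 2).neg).pow 2).mul (hc.tendsto.comp hinv0)
  have h2 : (-(0 : ℂ) ^ 2) ^ 2 * surfaceFun P φ' 0 = 0 := by simp
  rw [h2] at h1
  refine h1.congr' ?_
  have : ∀ᶠ x : ℂ in cocompact ℂ, x ≠ 0 := by
    rw [← Metric.cobounded_eq_cocompact]
    exact Bornology.eventually_ne_cobounded 0
  filter_upwards [this] with x hx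
  rw [surfaceFun_inv hM hφ hφ' hP hS hinv hx, inv_pow]
  rfl

/-- Vanishing of the complex component means vanishing of the tensor on all tangent vectors. -/
lemma IsCodazziField.eq_zero (hM : IsConformalCompletion 0 g Ω) (hφ : IsConformalPlane g Ω φ)
    (hP : IsCodazziField g Ω S P) (hS : φ z ∈ S) (h0 : surfaceFun P φ z = 0)
    (he : e ∈ atlas Coord M) (hz : φ z ∈ e.source) {X Y : Coord}
    (hX : fderiv ℝ (inChart Ω e) (e (φ z)) X = 0) (hY : fderiv ℝ (inChart Ω e) (e (φ z)) Y = 0) :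
    P e (e (φ z)) X Y = 0 := by
  rw [surfaceFun_eq hM hφ hP hS he hz] at h0
  have h1 : surfaceComp P φ e z 1 1 = 0 := congrArg Complex.re h0
  have h2 : surfaceComp P φ e z 1 Complex.I = 0 := neg_eq_zero.1 (congrArg Complex.im h0)
  obtain ⟨t1, t2⟩ := surfaceComp_trace hM hφ hP hS he hz
  rw [h2] at t1
  rw [h1, neg_zero] at t2
  obtain ⟨T, hT⟩ := exists_completionOn hM he
  have hy := e.map_source hz
  have hl : e.symm (e (φ z)) = φ z := e.left_inv hz
  have hs : inChart Ω e (e (φ z)) = 0 := by rw [inChart, hl]; exact hφ.mem_scri z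
  have c := hP.codazzi e he _ hy (by rw [hl]; exact hS)
  have n := (hφ.isConformalNear he hz).1
  have t := hφ.tangent hM he hz
  have hm := hT.metric
  have eN : ∀ V, met (comp g e) (e (φ z)) V (grad (comp g e) (inChart Ω e) (e (φ z)))
      = fderiv ℝ (inChart Ω e) (e (φ z)) V := fun V => by
    rw [met_symm hm hy, met_grad hm hy]
  have tN : fderiv ℝ (inChart Ω e) (e (φ z)) (grad (comp g e) (inChart Ω e) (e (φ z))) = 0 := by
    rw [← eN, hT.grad_null hy hs]
  obtain ⟨w, F⟩ := (isLorentzForm_met hM.metric he hy).exists_nullFrame_of_conformal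
    (hT.grad_ne_zero hy hs) (hT.grad_null hy hs)
    ⟨transv (inChart Ω e) (e (φ z)), by rw [eN, fderiv_transv (hT.regular _ hy hs)]⟩ n.pos
    ((eN _).trans (t 1)) ((eN _).trans (t Complex.I)) rfl n.equal.self_of_nhds.symm
    n.orthogonal.self_of_nhds
  rw [F.tangent ((eN _).trans hX), F.tangent ((eN _).trans hY)]
  have k : ∀ V, fderiv ℝ (inChart Ω e) (e (φ z)) V = 0 →
      P e (e (φ z)) (grad (comp g e) (inChart Ω e) (e (φ z))) V = 0 := fun V hV => by
    rw [c.symm _ _ tN hV, c.transverse V hV]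
  simp only [surfaceComp] at h1 h2 t1 t2
  simp only [map_add, map_smul, add_apply, smul_apply, c.transverse _ (t _), k _ (t _), k _ tN, h1,
    h2, t1, t2]
  simp

end Planes

end

section

/-! ### Stereographic coordinates of the two-sphere -/

/-- The inverse stereographic projections, from the two poles `(0, 0, ±1)`. -/
def stereoVec (ε : ℝ) (z : ℂ) : EuclideanSpace ℝ (Fin 3) :=
  !₂[2 * z.re / (z.re * z.re + z.im * z.im + 1), ε * (2 * z.im) / (z.re * z.re + z.im * z.im + 1),
    ε * (z.re * z.re + z.im * z.im - 1) / (z.re * z.re + z.im * z.im + 1)]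

lemma stereo_den_pos (z : ℂ) : 0 < z.re * z.re + z.im * z.im + 1 :=
  add_pos_of_nonneg_of_pos (add_nonneg (mul_self_nonneg _) (mul_self_nonneg _)) one_pos

lemma stereoVec_mem {ε : ℝ} (hε : ε * ε = 1) (z : ℂ) :
    stereoVec ε z ∈ Metric.sphere (0 : EuclideanSpace ℝ (Fin 3)) 1 := by
  have hD := (stereo_den_pos z).ne'
  rw [mem_sphere_zero_iff_norm, EuclideanSpace.norm_eq, Real.sqrt_eq_one, Fin.sum_univ_three]
  simp only [stereoVec, Real.norm_eq_abs, sq_abs]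
  change (2 * z.re / (z.re * z.re + z.im * z.im + 1)) ^ 2
    + (ε * (2 * z.im) / (z.re * z.re + z.im * z.im + 1)) ^ 2
    + (ε * (z.re * z.re + z.im * z.im - 1) / (z.re * z.re + z.im * z.im + 1)) ^ 2 = 1
  field_simp
  linear_combination (4 * z.im ^ 2 + (z.re ^ 2 + z.im ^ 2 - 1) ^ 2) * hε

lemma contDiff_re : ContDiff ℝ ∞ Complex.re := Complex.reCLM.contDiff

lemma contDiff_im : ContDiff ℝ ∞ Complex.im := Complex.imCLM.contDiff

lemma contDiff_stereoVec (ε : ℝ) : ContDiff ℝ ∞ (stereoVec ε) := by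
  have hD : ContDiff ℝ ∞ fun z : ℂ => z.re * z.re + z.im * z.im + 1 :=
    ((contDiff_re.mul contDiff_re).add (contDiff_im.mul contDiff_im)).add contDiff_const
  have h0 := fun z => (stereo_den_pos z).ne'
  rw [contDiff_euclidean]
  intro i
  fin_cases i
  · exact (contDiff_const.mul contDiff_re).div hD h0
  · exact (contDiff_const.mul (contDiff_const.mul contDiff_im)).div hD h0
  · exact (contDiff_const.mul (((contDiff_re.mul contDiff_re).add
      (contDiff_im.mul contDiff_im)).sub contDiff_const)).div hD h0

lemma fderiv_stereoVec (ε : ℝ) (z v : ℂ) :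
    fderiv ℝ (stereoVec ε) z v 0 * (z.re * z.re + z.im * z.im + 1)
        + stereoVec ε z 0 * (2 * (z.re * v.re + z.im * v.im)) = 2 * v.re ∧
    fderiv ℝ (stereoVec ε) z v 1 * (z.re * z.re + z.im * z.im + 1)
        + stereoVec ε z 1 * (2 * (z.re * v.re + z.im * v.im)) = ε * (2 * v.im) ∧
    fderiv ℝ (stereoVec ε) z v 2 * (z.re * z.re + z.im * z.im + 1)
        + stereoVec ε z 2 * (2 * (z.re * v.re + z.im * v.im))
      = ε * (2 * (z.re * v.re + z.im * v.im)) := by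
  have hr : HasFDerivAt (fun z : ℂ => z.re) Complex.reCLM z := Complex.reCLM.hasFDerivAt
  have hi : HasFDerivAt (fun z : ℂ => z.im) Complex.imCLM z := Complex.imCLM.hasFDerivAt
  have hQ := (hr.fun_mul hr).fun_add (hi.fun_mul hi)
  have hD := hQ.add_const 1
  have hF := ((contDiff_stereoVec ε).differentiable (by simp) z).hasFDerivAt
  have hFi : ∀ i, HasFDerivAt (fun x => stereoVec ε x i)
      ((EuclideanSpace.proj i : EuclideanSpace ℝ (Fin 3) →L[ℝ] ℝ).comp
        (fderiv ℝ (stereoVec ε) z)) z := fun i =>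
    (EuclideanSpace.proj i : EuclideanSpace ℝ (Fin 3) →L[ℝ] ℝ).hasFDerivAt.comp z hF
  have key : ∀ i (p : ℂ → ℝ) (p' : ℂ →L[ℝ] ℝ), HasFDerivAt p p' z →
      (∀ x, stereoVec ε x i = p x / (x.re * x.re + x.im * x.im + 1)) →
      fderiv ℝ (stereoVec ε) z v i * (z.re * z.re + z.im * z.im + 1)
        + stereoVec ε z i * (2 * (z.re * v.re + z.im * v.im)) = p' v := by
    intro i p p' hp he
    have h1 : (fun x => stereoVec ε x i * (x.re * x.re + x.im * x.im + 1)) = p := by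
      funext x
      rw [he, div_mul_cancel₀ _ (stereo_den_pos x).ne']
    have h2 := (hFi i).fun_mul hD
    rw [h1] at h2
    have h3 := congrArg (fun L : ℂ →L[ℝ] ℝ => L v) (h2.unique hp)
    simp only [add_apply, smul_apply, smul_eq_mul, ContinuousLinearMap.comp_apply,
      Complex.reCLM_apply, Complex.imCLM_apply] at h3
    rw [← h3]
    change _ = _ + (z.re * z.re + z.im * z.im + 1) * (fderiv ℝ (stereoVec ε) z v i)
    ring
  refine ⟨?_, ?_, ?_⟩
  · rw [key 0 _ _ (hr.const_mul 2) fun x => rfl]; simp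
  · rw [key 1 _ _ ((hi.const_mul 2).const_mul ε) fun x => rfl]; simp
  · rw [key 2 _ _ ((hQ.sub_const 1).const_mul ε) fun x => rfl]; simp; ring

/-- Stereographic projection is conformal. -/
lemma inner_fderiv_stereoVec {ε : ℝ} (hε : ε * ε = 1) (z v w : ℂ) :
    inner ℝ (fderiv ℝ (stereoVec ε) z v) (fderiv ℝ (stereoVec ε) z w)
      = 4 / (z.re * z.re + z.im * z.im + 1) ^ 2 * (v.re * w.re + v.im * w.im) := by
  obtain ⟨v0, v1, v2⟩ := fderiv_stereoVec ε z v
  obtain ⟨w0, w1, w2⟩ := fderiv_stereoVec ε z w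
  have hD := (stereo_den_pos z).ne'
  rw [PiLp.inner_apply, Fin.sum_univ_three]
  simp only [RCLike.inner_apply, conj_trivial]
  have s0 : stereoVec ε z 0 = 2 * z.re / (z.re * z.re + z.im * z.im + 1) := rfl
  have s1 : stereoVec ε z 1 = ε * (2 * z.im) / (z.re * z.re + z.im * z.im + 1) := rfl
  have s2 : stereoVec ε z 2
    = ε * (z.re * z.re + z.im * z.im - 1) / (z.re * z.re + z.im * z.im + 1) := rfl
  have g0 : ∀ {a b c : ℝ}, a * (z.re * z.re + z.im * z.im + 1) + b = c →
      a = (c - b) / (z.re * z.re + z.im * z.im + 1) := by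
    intro a b c h
    field_simp
    linarith
  rw [g0 v0, g0 v1, g0 v2, g0 w0, g0 w1, g0 w2, s0, s1, s2]
  generalize z.re = x at *
  generalize z.im = y at *
  have hE : ε ^ 2 = 1 := by rw [pow_two, hε]
  field_simp
  ring_nf
  simp only [hE]
  ring

/-- The two stereographic parametrisations of the sphere. -/
def stereo {ε : ℝ} (hε : ε * ε = 1) : ℂ → S2 :=
  Set.codRestrict (stereoVec ε) _ (stereoVec_mem hε)

lemma contMDiff_stereo {ε : ℝ} (hε : ε * ε = 1) :
    ContMDiff 𝓘(ℝ, ℂ) (𝓡 2) ∞ (stereo hε) :=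
  have := Fact.mk (@finrank_euclideanSpace_fin ℝ _ 3)
  ContMDiff.codRestrict_sphere (contDiff_stereoVec ε).contMDiff (stereoVec_mem hε)

lemma stereo_inv {ε ε' : ℝ} (hε : ε * ε = 1) (hε' : ε' * ε' = 1) (h : ε' = -ε) {z : ℂ}
    (hz : z ≠ 0) : stereo hε z = stereo hε' z⁻¹ := by
  apply Subtype.ext
  change stereoVec ε z = stereoVec ε' z⁻¹
  subst h
  have hn : z.re * z.re + z.im * z.im ≠ 0 := by
    rw [← Complex.normSq_apply]; exact (Complex.normSq_pos.2 hz).ne'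
  have hD := (stereo_den_pos z).ne'
  ext i
  have e : (z⁻¹).re * (z⁻¹).re + (z⁻¹).im * (z⁻¹).im = (z.re * z.re + z.im * z.im)⁻¹ := by
    rw [Complex.inv_re, Complex.inv_im, Complex.normSq_apply]
    field_simp
  have er : (z⁻¹).re = z.re / (z.re * z.re + z.im * z.im) := by
    rw [Complex.inv_re, Complex.normSq_apply]
  have ei : (z⁻¹).im = -z.im / (z.re * z.re + z.im * z.im) := by
    rw [Complex.inv_im, Complex.normSq_apply]
  fin_cases i
  · change 2 * z.re / (z.re * z.re + z.im * z.im + 1)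
      = 2 * (z⁻¹).re / ((z⁻¹).re * (z⁻¹).re + (z⁻¹).im * (z⁻¹).im + 1)
    rw [e, er]
    generalize z.re * z.re + z.im * z.im = q at *
    have : 1 + q ≠ 0 := by rwa [add_comm]
    field_simp
    ring
  · change ε * (2 * z.im) / (z.re * z.re + z.im * z.im + 1)
      = -ε * (2 * (z⁻¹).im) / ((z⁻¹).re * (z⁻¹).re + (z⁻¹).im * (z⁻¹).im + 1)
    rw [e, ei]
    generalize z.re * z.re + z.im * z.im = q at *
    have : 1 + q ≠ 0 := by rwa [add_comm]
    field_simp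
    ring
  · change ε * (z.re * z.re + z.im * z.im - 1) / (z.re * z.re + z.im * z.im + 1)
      = -ε * ((z⁻¹).re * (z⁻¹).re + (z⁻¹).im * (z⁻¹).im - 1)
        / ((z⁻¹).re * (z⁻¹).re + (z⁻¹).im * (z⁻¹).im + 1)
    rw [e]
    generalize z.re * z.re + z.im * z.im = q at *
    have : 1 + q ≠ 0 := by rwa [add_comm]
    field_simp
    ring

lemma exists_stereo {ε : ℝ} (hε : ε * ε = 1) (h1 : ε = 1) {ε' : ℝ} (hε' : ε' * ε' = 1)
    (h2 : ε' = -1) (p : S2) : (∃ z, stereo hε z = p) ∨ ∃ z, stereo hε' z = p := by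
  subst h1 h2
  obtain ⟨p, hp⟩ := p
  have hs : p 0 ^ 2 + p 1 ^ 2 + p 2 ^ 2 = 1 := by
    have := hp
    rw [mem_sphere_zero_iff_norm, EuclideanSpace.norm_eq, Real.sqrt_eq_one,
      Fin.sum_univ_three] at this
    simpa using this
  by_cases hc : p 2 = 1
  · refine Or.inr ⟨0, Subtype.ext ?_⟩
    change stereoVec (-1) 0 = p
    have a0 : p 0 = 0 := by nlinarith [sq_nonneg (p 0), sq_nonneg (p 1)]
    have a1 : p 1 = 0 := by nlinarith [sq_nonneg (p 0), sq_nonneg (p 1)]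
    ext i
    fin_cases i
    · change 2 * (0 : ℂ).re / _ = p 0
      simp [a0]
    · change -1 * (2 * (0 : ℂ).im) / _ = p 1
      simp [a1]
    · change -1 * ((0 : ℂ).re * (0 : ℂ).re + (0 : ℂ).im * (0 : ℂ).im - 1)
        / ((0 : ℂ).re * (0 : ℂ).re + (0 : ℂ).im * (0 : ℂ).im + 1) = p 2
      simp [hc]
  · have hd : 1 - p 2 ≠ 0 := fun h => hc (by linarith)
    refine Or.inl ⟨⟨p 0 / (1 - p 2), p 1 / (1 - p 2)⟩, Subtype.ext ?_⟩
    have e : p 0 / (1 - p 2) * (p 0 / (1 - p 2)) + p 1 / (1 - p 2) * (p 1 / (1 - p 2))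
        = (1 + p 2) / (1 - p 2) := by
      field_simp
      linarith
    have e' : (1 + p 2) / (1 - p 2) + 1 = 2 / (1 - p 2) := by field_simp; ring
    change stereoVec 1 _ = p
    ext i
    fin_cases i
    · change 2 * (p 0 / (1 - p 2)) / (p 0 / (1 - p 2) * (p 0 / (1 - p 2))
        + p 1 / (1 - p 2) * (p 1 / (1 - p 2)) + 1) = p 0
      rw [e, e']
      field_simp
    · change 1 * (2 * (p 1 / (1 - p 2))) / (p 0 / (1 - p 2) * (p 0 / (1 - p 2))
        + p 1 / (1 - p 2) * (p 1 / (1 - p 2)) + 1) = p 1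
      rw [e, e']
      field_simp
    · change 1 * (p 0 / (1 - p 2) * (p 0 / (1 - p 2))
        + p 1 / (1 - p 2) * (p 1 / (1 - p 2)) - 1) / (p 0 / (1 - p 2) * (p 0 / (1 - p 2))
        + p 1 / (1 - p 2) * (p 1 / (1 - p 2)) + 1) = p 2
      rw [e, e']
      field_simp
      ring

/-! ### Codazzi tensors vanish on cuts -/

variable {M : Type*} [TopologicalSpace M] [ChartedSpace Coord M] {g : BilinField M} {Ω : M → ℝ}
  {s : S2 → M}

lemma sphereDiff_stereo {ε : ℝ} (hε : ε * ε = 1) (z v : ℂ) :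
    sphereDiff (stereo hε z) (mfderiv 𝓘(ℝ, ℂ) (𝓡 2) (stereo hε) z v) = fderiv ℝ (stereoVec ε) z v := by
  have h1 : MDifferentiableAt (𝓡 2) 𝓘(ℝ, EuclideanSpace ℝ (Fin 3))
      (fun q : S2 => (q : EuclideanSpace ℝ (Fin 3))) (stereo hε z) :=
    have := Fact.mk (@finrank_euclideanSpace_fin ℝ _ 3)
    (contMDiff_coe_sphere (m := ∞) _).mdifferentiableAt (by simp)
  have h2 : MDifferentiableAt 𝓘(ℝ, ℂ) (𝓡 2) (stereo hε) z :=
    (contMDiff_stereo hε z).mdifferentiableAt (by simp)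
  have h3 := mfderiv_comp z h1 h2
  rw [← mfderiv_eq_fderiv]
  exact (congrArg (fun L : ℂ →L[ℝ] EuclideanSpace ℝ (Fin 3) => L v) h3).symm

lemma IsCut.isConformalPlane (hs : IsCut g Ω s) {ε : ℝ} (hε : ε * ε = 1) :
    IsConformalPlane g Ω (s ∘ stereo hε) where
  smooth := hs.smooth.comp (contMDiff_stereo hε)
  mem_scri z := hs.mem_scri _
  conformal z := by
    obtain ⟨c, hc, hcf⟩ := hs.conformal (stereo hε z)
    have hD := stereo_den_pos z
    refine ⟨c * (4 / (z.re * z.re + z.im * z.im + 1) ^ 2), by positivity, fun v w => ?_⟩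
    have h1 : MDifferentiableAt (𝓡 2) (𝓡 4) s (stereo hε z) :=
      (hs.smooth _).mdifferentiableAt (by simp)
    have h2 : MDifferentiableAt 𝓘(ℝ, ℂ) (𝓡 2) (stereo hε) z :=
      (contMDiff_stereo hε z).mdifferentiableAt (by simp)
    rw [mfderiv_comp z h1 h2, mul_assoc, ← inner_fderiv_stereoVec hε, ← sphereDiff_stereo hε,
      ← sphereDiff_stereo hε, ← hcf]
    rfl

/-- A symmetric, transverse, trace-free Codazzi tensor vanishes on every cut. -/
theorem IsCodazziField.eq_zero_of_cut [IsManifold (𝓡 4) ∞ M] (hM : IsConformalCompletion 0 g Ω)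
    (hd : IsDivergenceFree g Ω) {S : Set M} {P : OpenPartialHomeomorph M Coord → Coord → Form2}
    (hP : IsCodazziField g Ω S P) (hs : IsCut g Ω s) (hS : range s ⊆ S)
    {e : OpenPartialHomeomorph M Coord} (he : e ∈ atlas Coord M) {y : Coord} (hy : y ∈ e.target)
    (hmem : e.symm y ∈ range s) {X Y : Coord} (hX : fderiv ℝ (inChart Ω e) y X = 0)
    (hY : fderiv ℝ (inChart Ω e) y Y = 0) : P e y X Y = 0 := by
  have h1 : (1 : ℝ) * 1 = 1 := one_mul 1
  have h2 : (-1 : ℝ) * -1 = 1 := by norm_num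
  have main : ∀ {ε ε' : ℝ} (hε : ε * ε = 1) (hε' : ε' * ε' = 1), ε' = -ε → ∀ z,
      s (stereo hε z) = e.symm y → P e y X Y = 0 := by
    intro ε ε' hε hε' hεε' z hz
    have c1 := hs.isConformalPlane hε
    have c2 := hs.isConformalPlane hε'
    have h0 := surfaceFun_eq_zero hM hd c1 c2 hP (fun z => hS ⟨_, rfl⟩) (fun z => hS ⟨_, rfl⟩)
      (fun z hz => congrArg s (stereo_inv hε hε' hεε' hz)) z
    have hsrc : (s ∘ stereo hε) z ∈ e.source := by
      rw [Function.comp_apply, hz]; exact e.map_target hy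
    have hye : e ((s ∘ stereo hε) z) = y := by
      rw [Function.comp_apply, hz]; exact e.right_inv hy
    have := hP.eq_zero hM c1 (hS ⟨_, rfl⟩) h0 he hsrc (X := X) (Y := Y)
      (by rw [hye]; exact hX) (by rw [hye]; exact hY)
    rwa [hye] at this
  obtain ⟨p, hp⟩ := hmem
  rcases exists_stereo h1 rfl h2 rfl p with ⟨z, hz⟩ | ⟨z, hz⟩
  · exact main h1 h2 rfl z (by rw [hz, hp])
  · exact main h2 h1 (by norm_num) z (by rw [hz, hp])

end

section

/-! ### Change of conformal gauge -/

section Gauge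

variable {M : Type*} [TopologicalSpace M] [ChartedSpace Coord M] {g : BilinField M} {Ω θ : M → ℝ}

lemma comp_rescale (θ : M → ℝ) (g : BilinField M) (e : OpenPartialHomeomorph M Coord) (y : Coord)
    (i j : Fin 4) : comp (rescale θ g) e y i j = inChart θ e y ^ 2 * comp g e y i j := rfl

lemma scri_rescale {M : Type*} {Ω θ : M → ℝ} (hpos : ∀ x, 0 < θ x) :
    scri (fun x => θ x * Ω x) = scri Ω := by
  ext x
  simp [scri, (hpos x).ne']

lemma IsCut.rescale {s : S2 → M} (hs : IsCut g Ω s) (hpos : ∀ x, 0 < θ x) :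
    IsCut (rescale θ g) (fun x => θ x * Ω x) s where
  smooth := hs.smooth
  injective := hs.injective
  mem_scri p := by rw [scri_rescale hpos]; exact hs.mem_scri p
  conformal p := by
    obtain ⟨c, hc, hcf⟩ := hs.conformal p
    have := hpos (s p)
    refine ⟨θ (s p) ^ 2 * c, by positivity, fun v w => ?_⟩
    rw [mul_assoc, ← hcf]
    rfl

lemma physMetric_rescale (hpos : ∀ x, 0 < θ x) (e : OpenPartialHomeomorph M Coord) :
    physMetric (rescale θ g) (fun x => θ x * Ω x) e = physMetric g Ω e := by
  funext y
  ext i j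
  have h0 := (hpos (e.symm y)).ne'
  change ((θ (e.symm y) * Ω (e.symm y)) ^ 2)⁻¹ * (θ (e.symm y) ^ 2 * comp g e y i j)
    = ((Ω (e.symm y)) ^ 2)⁻¹ * comp g e y i j
  rw [mul_pow, mul_inv]
  field_simp

variable [IsManifold (𝓡 4) ∞ M]

lemma IsLorentzMetric.rescale (hg : IsLorentzMetric g) (hθ : ContMDiff (𝓡 4) 𝓘(ℝ, ℝ) ∞ θ)
    (hpos : ∀ x, 0 < θ x) : IsLorentzMetric (rescale θ g) where
  smooth e he i j := ((contDiffOn_inChart hθ he).pow 2).mul (hg.smooth e he i j)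
  signature x := by
    obtain ⟨b, hb⟩ := hg.signature x
    have h0 := (hpos x).ne'
    refine ⟨b.isUnitSMul (w := fun _ => (θ x)⁻¹) fun _ => (inv_ne_zero h0).isUnit, fun i j => ?_⟩
    rw [← hb, Module.Basis.isUnitSMul_apply, Module.Basis.isUnitSMul_apply]
    change θ x ^ 2 * g x ((θ x)⁻¹ • b i) ((θ x)⁻¹ • b j) = _
    rw [map_smul, map_smul, smul_apply, smul_eq_mul, smul_eq_mul]
    field_simp

/-- A conformal completion remains one after a change of gauge. -/
lemma IsConformalCompletion.rescale (hM : IsConformalCompletion 0 g Ω)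
    (hθ : ContMDiff (𝓡 4) 𝓘(ℝ, ℝ) ∞ θ) (hpos : ∀ x, 0 < θ x) :
    IsConformalCompletion 0 (rescale θ g) (fun x => θ x * Ω x) where
  metric := hM.metric.rescale hθ hpos
  smooth := hθ.mul hM.smooth
  regular x hx hd := by
    rw [scri_rescale hpos] at hx
    have hx0 : Ω x = 0 := hx
    have h1 := ((hθ x).mdifferentiableAt (by simp)).hasMFDerivAt
    have h2 := ((hM.smooth x).mdifferentiableAt (by simp)).hasMFDerivAt
    have h3 := (h1.mul h2).mfderiv
    have h4 : mfderiv (𝓡 4) 𝓘(ℝ, ℝ) (θ * Ω) x = 0 := hd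
    let L : Coord →L[ℝ] ℝ := mfderiv (𝓡 4) 𝓘(ℝ, ℝ) Ω x
    let L' : Coord →L[ℝ] ℝ := mfderiv (𝓡 4) 𝓘(ℝ, ℝ) θ x
    have h5 : (0 : Coord →L[ℝ] ℝ) = θ x • L + Ω x • L' := h4.symm.trans h3
    rw [hx0, zero_smul, add_zero] at h5
    exact hM.regular x hx ((smul_eq_zero.1 h5.symm).resolve_left (hpos x).ne')
  field_eq e he := by
    obtain ⟨T, hT, hf⟩ := hM.field_eq e he
    refine ⟨fun y => ((inChart θ e y) ^ 2)⁻¹ • T y, fun i j => ?_, fun y hy hp i j => ?_⟩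
    · exact (((contDiffOn_inChart hθ he).pow 2).inv fun y _ =>
        pow_ne_zero 2 (hpos (e.symm y)).ne').mul (hT i j)
    · rw [physMetric_rescale hpos]
      have h0 := (hpos (e.symm y)).ne'
      rw [hf y hy ((mul_pos_iff_of_pos_left (hpos _)).1 hp) i j]
      change _ = (θ (e.symm y) * Ω (e.symm y)) ^ 2 * (((θ (e.symm y)) ^ 2)⁻¹ * T y i j)
      field_simp

end Gauge

/-! ### The Cotton tensor and the rescaled Weyl tensor -/

variable {G G' T T' : MatField} {U : Set Coord} {y w : Coord} {Ω θ : Coord → ℝ}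

lemma fderiv_mul_level (hU : IsOpen U) (hΩ : ContDiffOn ℝ ∞ Ω U) (hθ : ContDiffOn ℝ ∞ θ U)
    (hy : y ∈ U) (h0 : Ω y = 0) (X : Coord) :
    fderiv ℝ (fun z => θ z * Ω z) y X = θ y * fderiv ℝ Ω y X := by
  rw [((diffAt hU hθ hy).hasFDerivAt.fun_mul (diffAt hU hΩ hy).hasFDerivAt).fderiv]
  simp [h0]

/-- Where the Weyl tensor vanishes on infinity, the Cotton tensor of a divergence-free gauge is the
contraction of the rescaled Weyl tensor with the normal. -/
lemma cotton_eq_covWey (h : CompletionOn G U Ω T)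
    (h' : CompletionOn G' U (fun z => θ z * Ω z) T') (hθ : ContDiffOn ℝ ∞ θ U)
    (hθ0 : ∀ z ∈ U, θ z ≠ 0) (hG : ∀ z ∈ U, ∀ i j, G' z i j = θ z ^ 2 * G z i j)
    (hy : y ∈ U) (h0 : Ω y = 0) (hC : wey G y = 0)
    (hH : ∀ A B, hess G' (fun z => θ z * Ω z) y A B = 0) (hw : fderiv ℝ Ω y w = 1)
    (X Y Z : Coord) : cotton G' y X Y Z = 2 * covWeyL G y w (grad G Ω y) Z X Y := by
  have hm := h.metric
  have hm' := h'.metric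
  have ht := hθ0 y hy
  have hO := hm.isOpen
  have h0' : (fun z => θ z * Ω z) y = 0 := by simp [h0]
  have hC' : wey G' y = 0 := by
    ext L K I J
    rw [wey_rescale hm hm' hθ hθ0 hG hy, hC]
    simp
  have hgr : grad G' (fun z => θ z * Ω z) y = (θ y)⁻¹ • grad G Ω y := by
    rw [← sub_eq_zero]
    refine nondegenerate hm' hy fun V => ?_
    rw [map_sub, sub_apply, met_grad hm' hy, map_smul, smul_apply, met_rescale (hG y hy),
      met_grad hm hy, fderiv_mul_level hO h.smooth hθ hy h0, smul_eq_mul]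
    field_simp
    ring
  have hD : ∀ L K I J, fderiv ℝ (wey G') y w L K I J = θ y ^ 2 * fderiv ℝ (wey G) y w L K I J := by
    intro L K I J
    have d1 := ((diffAt hO hθ hy).hasFDerivAt.pow 2).fun_mul
      (diffAt hO (contDiffOn_wey_eval hm (contDiffOn_const (c := L)) K I J) hy).hasFDerivAt
    rw [← fderiv_wey_eval hm' hy, ← fderiv_wey_eval hm hy,
      fderiv_congr_on hO (fun z hz => wey_rescale hm hm' hθ hθ0 hG hz L K I J) hy, d1.fderiv]
    simp [hC]
  have key := h'.covWey_grad_scri hy h0' hH w Z X Y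
  rw [fderiv_mul_level hO h.smooth hθ hy h0, hw, covWey, hC', hgr, hD] at key
  rw [covWeyL_apply, covWey, hC]
  simp only [zero_apply, sub_zero, map_smul, smul_apply, smul_eq_mul, mul_one] at key ⊢
  have : θ y * cotton G' y X Y Z
      = θ y * (2 * fderiv ℝ (wey G) y w (grad G Ω y) Z X Y) := by
    rw [← key]
    field_simp
    ring
  exact mul_left_cancel₀ ht this

end

section

/-! ### Components and vectors -/

lemma isTangent_iff (f : Coord → ℝ) (y : Coord) (X : Fin 4 → ℝ) :
    IsTangent f y X ↔ fderiv ℝ f y (WithLp.toLp 2 X) = 0 := by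
  rw [clm_eq_sum]
  rfl

lemma bil_eq_met (G : MatField) (y : Coord) (X Y : Fin 4 → ℝ) :
    bil (G y) X Y = met G y (WithLp.toLp 2 X) (WithLp.toLp 2 Y) :=
  (bilin_eq_bil _ _ _).symm

lemma covB_basisVec {G P : MatField} {U : Set Coord} {y : Coord} (hU : IsOpen U)
    (hP : ∀ i j, ContDiffOn ℝ ∞ (fun y => P y i j) U) (hy : y ∈ U) (i j k : Fin 4) :
    covB G (met P) y (basisVec i) (basisVec j) (basisVec k) = covDeriv G P i j k y := by
  have hd : DifferentiableAt ℝ (met P) y := diffAt hU (contDiffOn_bilin hP) hy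
  rw [covB, covDeriv, ← fderiv_clm_eval₂ hd, clm_eq_sum (met P y) (gam G y _ _),
    clm_eq_sum (met P y (basisVec j)) (gam G y _ _), Finset.sum_add_distrib]
  simp only [met_basisVec, sum_apply, smul_apply, smul_eq_mul, gam_basisVec, pd]
  ring

lemma sum_covDeriv_eq {G P : MatField} {U : Set Coord} {y : Coord} (hU : IsOpen U)
    (hP : ∀ i j, ContDiffOn ℝ ∞ (fun y => P y i j) U) (hy : y ∈ U) (X Y Z : Coord) :
    ∑ i, ∑ j, ∑ k, (covDeriv G P i j k y - covDeriv G P j i k y) * X i * Y j * Z k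
      = covB G (met P) y X Y Z - covB G (met P) y Y X Z := by
  refine trilinear_ext
    (f := fun X Y Z => ∑ i, ∑ j, ∑ k,
      (covDeriv G P i j k y - covDeriv G P j i k y) * X i * Y j * Z k)
    (f' := fun X Y Z => covB G (met P) y X Y Z - covB G (met P) y Y X Z) ?_ ?_ ?_ ?_ ?_ ?_ ?_ X Y Z
  iterate 3
    intro _ _
    constructor <;> intros <;> simp only [PiLp.add_apply, PiLp.smul_apply, smul_eq_mul,
      Finset.mul_sum, ← Finset.sum_add_distrib] <;>
    exact Finset.sum_congr rfl fun _ _ => Finset.sum_congr rfl fun _ _ =>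
      Finset.sum_congr rfl fun _ _ => by ring
  iterate 3
    intro _ _
    constructor <;> intros <;> simp [covB] <;> ring
  intro a b c
  simp only [covB_basisVec hU hP hy, basisVec_apply]
  simp

lemma sum_riemann_eq {G : MatField} {U : Set Coord} {y : Coord} (h : MetricOn G U) (hy : y ∈ U)
    (X Y : Coord) : ∑ l, ∑ k, ∑ i, ∑ j, riemann G l k i j y * X l * Y k * X i * Y j
      = met G y X (curv G y X Y Y) := by
  rw [← quadrilin_apply (fun l k i j => riemann G l k i j y)]
  simp only [← met_curv_basisVec h hy]
  refine quadrilin_eq (f := fun L K I J => met G y L (curv G y I J K)) ?_ ?_ ?_ ?_ X Y X Y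
  all_goals intro _ _ _; constructor <;> intros <;> simp

lemma CompletionOn.isCodazziAt_weyK {G T : MatField} {U : Set Coord} {Ω : Coord → ℝ} {y : Coord}
    (h : CompletionOn G U Ω T) (hy : y ∈ U) (h0 : Ω y = 0) (hL : IsLorentzForm (met G y))
    (hH : ∀ A B, hess G Ω y A B = 0) : IsCodazziAt G Ω (weyK G Ω) y := by
  have hm := h.metric
  have hW := wey_weylType hm hy
  have hw := fderiv_transv (h.regular y hy h0)
  have eN : ∀ V, met G y V (grad G Ω y) = fderiv ℝ Ω y V := fun V => by
    rw [met_symm hm hy, met_grad hm hy]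
  have hN := h.wey_grad_scri hy h0
  refine ⟨differentiableAt_weyK hm h.smooth hy (h.regular y hy h0), fun X Y _ _ => ?_,
    fun X _ => ?_, fun X Y c hc hX hY XX YY XY => ?_, fun X Y Z hX hY hZ => ?_⟩
  · rw [weyK_apply, weyK_apply, hW.pair]
  · rw [weyK_apply, hW.pair, hW.antisymm_left, hN, neg_zero]
  · rw [weyK_apply, weyK_apply]
    exact hW.trace_free hm hy hL (h.grad_ne_zero hy h0) (h.grad_null hy h0) ((eN _).trans hw)
      hN hc ((eN X).trans hX) ((eN Y).trans hY) XX YY XY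
  · exact sub_eq_zero.1 (h.weyK_codazzi hy h0 hL hH hX hY hZ)

section Fields

variable {M : Type*} [TopologicalSpace M] [ChartedSpace Coord M]

/-- The News tensor as a field of bilinear forms in a chart. -/
def newsForm (g ρ : BilinField M) (e : OpenPartialHomeomorph M Coord) (y : Coord) : Form2 :=
  sch (comp g e) y - met (comp ρ e) y

lemma news_eq (g ρ : BilinField M) (e : OpenPartialHomeomorph M Coord) (y : Coord)
    (X Y : Fin 4 → ℝ) :
    news g ρ e y X Y = newsForm g ρ e y (WithLp.toLp 2 X) (WithLp.toLp 2 Y) := by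
  have h : ∀ i j, newsForm g ρ e y (basisVec i) (basisVec j)
      = schouten (comp g e) i j y - comp ρ e y i j := fun i j => by
    rw [newsForm, sub_apply, sub_apply, met_basisVec, sch, bilin_basisVec]
  rw [news, ← bilin_eq (f := fun X Y => newsForm g ρ e y X Y)]
  · simp only [h]
    exact (bilin_eq_bil _ _ _).symm
  all_goals intro _; constructor <;> intros <;> simp

variable [IsManifold (𝓡 4) ∞ M]
  {e e' : OpenPartialHomeomorph M Coord} {g : BilinField M} {Ω : M → ℝ} {y : Coord}

/-- At infinity there is a null frame adapted to the normal. -/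
lemma exists_nullFrame_scri (hM : IsConformalCompletion 0 g Ω) (he : e ∈ atlas Coord M)
    (hy : y ∈ e.target) (h0 : e.symm y ∈ scri Ω) {w : Coord}
    (hw : fderiv ℝ (inChart Ω e) y w = 1) : ∃ e₁ e₂,
    NullFrame (met (comp g e) y) (grad (comp g e) (inChart Ω e) y) w e₁ e₂ := by
  obtain ⟨T, hT⟩ := exists_completionOn hM he
  refine (isLorentzForm_met hM.metric he hy).exists_nullFrame (hT.grad_ne_zero hy h0)
    (hT.grad_null hy h0) ?_
  rw [met_symm hT.metric hy, met_grad hT.metric hy, hw]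

lemma fderiv_transv_scri (hM : IsConformalCompletion 0 g Ω) (he : e ∈ atlas Coord M)
    (hy : y ∈ e.target) (h0 : e.symm y ∈ scri Ω) :
    fderiv ℝ (inChart Ω e) y (transv (inChart Ω e) y) = 1 := by
  obtain ⟨T, hT⟩ := exists_completionOn hM he
  exact fderiv_transv (hT.regular y hy h0)

/-- The transverse part of the Weyl tensor does not depend on the choice of transverse vector. -/
lemma wey_transverse_eq (hM : IsConformalCompletion 0 g Ω) (he : e ∈ atlas Coord M)
    (hy : y ∈ e.target) (h0 : e.symm y ∈ scri Ω) {w w' X Y : Coord}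
    (hw : fderiv ℝ (inChart Ω e) y w = 1) (hw' : fderiv ℝ (inChart Ω e) y w' = 1)
    (hX : fderiv ℝ (inChart Ω e) y X = 0) (hY : fderiv ℝ (inChart Ω e) y Y = 0) :
    wey (comp g e) y w X w Y = wey (comp g e) y w' X w' Y := by
  obtain ⟨T, hT⟩ := exists_completionOn hM he
  obtain ⟨e₁, e₂, F⟩ := exists_nullFrame_scri hM he hy h0 hw
  have hm := hT.metric
  have eN : ∀ V, met (comp g e) y V (grad (comp g e) (inChart Ω e) y)
      = fderiv ℝ (inChart Ω e) y V := fun V => by rw [met_symm hm hy, met_grad hm hy]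
  have hW := wey_weylType hm hy
  have t : ∀ A B I J, fderiv ℝ (inChart Ω e) y A = 0 → fderiv ℝ (inChart Ω e) y B = 0 →
      wey (comp g e) y A B I J = 0 := fun A B I J hA hB =>
    hW.tangent_eq_zero hm hy F (hT.wey_grad_scri hy h0) ((eN A).trans hA) ((eN B).trans hB) I J
  have hd : fderiv ℝ (inChart Ω e) y (w - w') = 0 := by rw [map_sub, hw, hw', sub_self]
  have t1 := t (w - w') X w Y hd hX
  have t2 := t (w - w') Y w' X hd hY
  rw [map_sub, sub_apply, sub_apply, sub_apply] at t1 t2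
  rw [hW.pair w Y, hW.pair w' Y] at t2
  linarith

lemma weyK_coordChange (hM : IsConformalCompletion 0 g Ω) (he : e ∈ atlas Coord M)
    (he' : e' ∈ atlas Coord M) (hy : y ∈ e'.target ∩ e'.symm ⁻¹' e.source)
    (h0 : e'.symm y ∈ scri Ω) {X Y : Coord} (hX : fderiv ℝ (inChart Ω e') y X = 0)
    (hY : fderiv ℝ (inChart Ω e') y Y = 0) :
    weyK (comp g e') (inChart Ω e') y X Y
      = weyK (comp g e) (inChart Ω e) (coordChange e e' y) (fderiv ℝ (coordChange e e') y X)
        (fderiv ℝ (coordChange e e') y Y) := by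
  have hw' := fderiv_transv_scri hM he' hy.1 h0
  obtain ⟨e₁, e₂, F⟩ := exists_nullFrame_scri hM he' hy.1 h0 hw'
  have hτ := transition_comp hM.metric he he'
  have hs : e.symm (coordChange e e' y) ∈ scri Ω := by
    rw [coordChange, e.left_inv hy.2]; exact h0
  have hyt : coordChange e e' y ∈ e.target := e.map_source hy.2
  have c := fderiv_inChart_coordChange hM.smooth he he' hy
  rw [weyK_apply, weyK_apply, hτ.wey_eq hy F]
  exact wey_transverse_eq hM he hyt hs ((c _).trans hw') (fderiv_transv_scri hM he hyt hs)
    ((c X).trans hX) ((c Y).trans hY)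

/-- The transverse part of the Weyl tensor is a Codazzi tensor on infinity. -/
lemma isCodazziField_weyK (hM : IsConformalCompletion 0 g Ω) (hd : IsDivergenceFree g Ω) :
    IsCodazziField g Ω (scri Ω) fun e => weyK (comp g e) (inChart Ω e) where
  codazzi e he y hy h0 := by
    obtain ⟨T, hT⟩ := exists_completionOn hM he
    exact hT.isCodazziAt_weyK hy h0 (isLorentzForm_met hM.metric he hy)
      (hess_eq_zero hM hd he hy h0)
  tensor e he e' he' y hy h0 X Y hX hY := weyK_coordChange hM he he' hy h0 hX hY

/-- In a divergence-free gauge the Weyl tensor vanishes on every cut. -/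
lemma wey_eq_zero_of_cut (hM : IsConformalCompletion 0 g Ω) (hd : IsDivergenceFree g Ω)
    {s : S2 → M} (hs : IsCut g Ω s) (he : e ∈ atlas Coord M) (hy : y ∈ e.target) (hmem : e.symm y ∈ range s) :
    wey (comp g e) y = 0 := by
  have h0 : e.symm y ∈ scri Ω := by
    obtain ⟨p, hp⟩ := hmem
    rw [← hp]; exact hs.mem_scri p
  obtain ⟨T, hT⟩ := exists_completionOn hM he
  obtain ⟨e₁, e₂, F⟩ := exists_nullFrame_scri hM he hy h0 (fderiv_transv_scri hM he hy h0)
  have hm := hT.metric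
  have eN : ∀ V, met (comp g e) y V (grad (comp g e) (inChart Ω e) y)
      = fderiv ℝ (inChart Ω e) y V := fun V => by rw [met_symm hm hy, met_grad hm hy]
  have hsub : range s ⊆ scri Ω := by
    rintro _ ⟨p, rfl⟩
    exact hs.mem_scri p
  ext L K I J
  refine (wey_weylType hm hy).eq_zero hm hy F (hT.wey_grad_scri hy h0) (fun X Y hX hY => ?_) L K I J
  exact (isCodazziField_weyK hM hd).eq_zero_of_cut hM hd hs hsub he hy hmem ((eN X).symm.trans hX)
    ((eN Y).symm.trans hY)

variable {ρ : BilinField M}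

lemma contDiffOn_newsForm (hM : IsConformalCompletion 0 g Ω) (hρ : IsGerochTensor g Ω ρ)
    (he : e ∈ atlas Coord M) : ContDiffOn ℝ ∞ (newsForm g ρ e) e.target :=
  (contDiffOn_sch (metricOn_comp hM.metric he)).sub (contDiffOn_bilin (hρ.smooth e he))

/-- The curl of the News tensor is the Cotton tensor. -/
lemma curl_newsForm (hM : IsConformalCompletion 0 g Ω) (hρ : IsGerochTensor g Ω ρ)
    (he : e ∈ atlas Coord M) (hy : y ∈ e.target) (h0 : e.symm y ∈ scri Ω) {X Y Z : Coord}
    (hX : fderiv ℝ (inChart Ω e) y X = 0) (hY : fderiv ℝ (inChart Ω e) y Y = 0)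
    (hZ : fderiv ℝ (inChart Ω e) y Z = 0) :
    covB (comp g e) (newsForm g ρ e) y X Y Z - covB (comp g e) (newsForm g ρ e) y Y X Z
      = cotton (comp g e) y X Y Z := by
  have hm := metricOn_comp hM.metric he
  have d1 := diffAt hm.isOpen (contDiffOn_sch hm) hy
  have d2 := diffAt hm.isOpen (contDiffOn_bilin (hρ.smooth e he)) hy
  have hc := hρ.curlFree e he y hy h0 X Y Z ((isTangent_iff _ _ _).2 hX)
    ((isTangent_iff _ _ _).2 hY) ((isTangent_iff _ _ _).2 hZ)
  rw [sum_covDeriv_eq hm.isOpen (hρ.smooth e he) hy] at hc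
  have hs : ∀ A B D, covB (comp g e) (newsForm g ρ e) y A B D
      = covSch (comp g e) y A B D - covB (comp g e) (met (comp ρ e)) y A B D := by
    intro A B D
    have hf : fderiv ℝ (newsForm g ρ e) y
        = fderiv ℝ (sch (comp g e)) y - fderiv ℝ (met (comp ρ e)) y := fderiv_sub d1 d2
    rw [covB, covB, covSch, hf, newsForm]
    simp only [sub_apply]
    ring
  rw [hs, hs, cotton]
  linarith

/-- Where the Weyl tensor and the tangential Cotton tensor vanish, News is a Codazzi tensor. -/
lemma isCodazziField_newsForm (hM : IsConformalCompletion 0 g Ω) (hd : IsDivergenceFree g Ω)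
    (hρ : IsGerochTensor g Ω ρ) {S : Set M} (hS : S ⊆ scri Ω)
    (hC : ∀ e ∈ atlas Coord M, ∀ y ∈ e.target, e.symm y ∈ S → wey (comp g e) y = 0)
    (hA : ∀ e ∈ atlas Coord M, ∀ y ∈ e.target, e.symm y ∈ S → ∀ X Y Z,
      fderiv ℝ (inChart Ω e) y X = 0 → fderiv ℝ (inChart Ω e) y Y = 0 →
      fderiv ℝ (inChart Ω e) y Z = 0 → cotton (comp g e) y X Y Z = 0) :
    IsCodazziField g Ω S (newsForm g ρ) where
  codazzi e he y hy hyS := by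
    obtain ⟨T, hT⟩ := exists_completionOn hM he
    have hm := hT.metric
    have h0 := hS hyS
    have tan : ∀ {X}, fderiv ℝ (inChart Ω e) y X = 0 → IsTangent (inChart Ω e) y X :=
      fun hX => (isTangent_iff _ _ _).2 hX
    constructor
    · exact diffAt e.open_target (contDiffOn_newsForm hM hρ he) hy
    · intro X Y hX hY
      have := hρ.symm e he y hy h0 X Y (tan hX) (tan hY)
      rw [bil_eq_met, bil_eq_met] at this
      rw [newsForm, sub_apply, sub_apply, sub_apply, sub_apply, sch_symm hm hy]
      exact congrArg _ this
    · intro X hX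
      have h1 := hρ.transverse e he y hy h0 X (tan hX)
      rw [bil_eq_met] at h1
      have h2 := hT.sch_grad hy h0 (fun z hz hz0 => by
        rw [← hd e he z hz hz0, trg]
        simp only [hess_basisVec hT.metric hT.smooth hz]) hX
      rw [newsForm, sub_apply, sub_apply, h2, zero_sub, neg_eq_zero]
      exact h1
    · intro X Y c hc hX hY XX YY XY
      have q : 0 < √c := Real.sqrt_pos.2 hc
      have q2 : (√c)⁻¹ * ((√c)⁻¹ * c) = 1 := by
        field_simp; rw [Real.sq_sqrt hc.le]
      have tX : fderiv ℝ (inChart Ω e) y ((√c)⁻¹ • X) = 0 := by rw [map_smul, hX, smul_zero]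
      have tY : fderiv ℝ (inChart Ω e) y ((√c)⁻¹ • Y) = 0 := by rw [map_smul, hY, smul_zero]
      have h1 := hρ.trace e he y hy h0 _ _ (tan tX) (tan tY)
      rw [bil_eq_met, bil_eq_met, bil_eq_met, bil_eq_met, bil_eq_met, sum_riemann_eq hm hy] at h1
      change met (comp g e) y ((√c)⁻¹ • X) ((√c)⁻¹ • X) = 1 →
        met (comp g e) y ((√c)⁻¹ • Y) ((√c)⁻¹ • Y) = 1 →
        met (comp g e) y ((√c)⁻¹ • X) ((√c)⁻¹ • Y) = 0 →
        met (comp ρ e) y ((√c)⁻¹ • X) ((√c)⁻¹ • X) + met (comp ρ e) y ((√c)⁻¹ • Y) ((√c)⁻¹ • Y)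
          = 2 * met (comp g e) y ((√c)⁻¹ • X) (curv (comp g e) y ((√c)⁻¹ • X) ((√c)⁻¹ • Y)
            ((√c)⁻¹ • Y)) at h1
      simp only [map_smul, smul_apply, smul_eq_mul, XX, YY, XY, mul_zero, q2] at h1
      have h2 := h1 trivial trivial trivial
      have h3 := wey_apply hm hy X Y X Y
      rw [hC e he y hy hyS, XX, YY, XY, met_symm hm hy Y X, XY] at h3
      simp only [zero_apply] at h3
      have r : (√c)⁻¹ * (√c)⁻¹ ≠ 0 := (mul_pos (inv_pos.2 q) (inv_pos.2 q)).ne'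
      have h4 : (√c)⁻¹ * (√c)⁻¹ * (met (comp ρ e) y X X + met (comp ρ e) y Y Y
          - (sch (comp g e) y X X + sch (comp g e) y Y Y)) = 0 := by
        linear_combination h2 - 2 * (√c)⁻¹ ^ 4 * h3
          + (√c)⁻¹ ^ 2 * (sch (comp g e) y X X + sch (comp g e) y Y Y) * q2
      have h5 := (mul_eq_zero.1 h4).resolve_left r
      simp only [newsForm, sub_apply]
      linarith
    · intro X Y Z hX hY hZ
      rw [← sub_eq_zero, curl_newsForm hM hρ he hy h0 hX hY hZ]
      exact hA e he y hy hyS X Y Z hX hY hZ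
  tensor e he e' he' y hy hyS X Y hX hY := by
    have h0 := hS hyS
    obtain ⟨e₁, e₂, F⟩ := exists_nullFrame_scri hM he' hy.1 h0 (fderiv_transv_scri hM he' hy.1 h0)
    simp only [newsForm, sub_apply]
    rw [(transition_comp hM.metric he he').sch_eq hy F, met_comp_coordChange ρ he he' hy]

end Fields

end

section

/-! ### Infinity and the radiation condition -/

lemma inChart_mul {M : Type*} [TopologicalSpace M] (θ Ω : M → ℝ)
    (e : OpenPartialHomeomorph M Coord) :
    inChart (fun x => θ x * Ω x) e = fun z => inChart θ e z * inChart Ω e z := rfl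

variable {M : Type*} [TopologicalSpace M] [ChartedSpace Coord M]
  {e : OpenPartialHomeomorph M Coord} {g ρ : BilinField M} {Ω θ : M → ℝ} {Δ : Set M} {y : Coord}

lemma IsOpenPortion.subset_scri (hΔ : IsOpenPortion g Ω Δ) : Δ ⊆ scri Ω := by
  obtain ⟨U, -, rfl⟩ := hΔ.isOpen
  exact inter_subset_right

lemma IsOpenPortion.eventually_mem (hΔ : IsOpenPortion g Ω Δ) (hy : y ∈ e.target)
    (hyΔ : e.symm y ∈ Δ) : ∀ᶠ z in 𝓝 y, z ∈ e.target ∧ (e.symm z ∈ scri Ω → e.symm z ∈ Δ) := by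
  obtain ⟨U, hU, rfl⟩ := hΔ.isOpen
  filter_upwards [e.open_target.mem_nhds hy,
    (e.continuousAt_symm hy).eventually (hU.mem_nhds hyΔ.1)] with z h1 h2
  exact ⟨h1, fun h3 => ⟨h2, h3⟩⟩

variable [IsManifold (𝓡 4) ∞ M]

/-- Infinity is null, and its causal tangent vectors are the multiples of the normal. -/
lemma normal_null (hM : IsConformalCompletion 0 g Ω) (he : e ∈ atlas Coord M)
    (hy : y ∈ e.target) (h0 : e.symm y ∈ scri Ω) :
    normal g Ω e y ≠ 0 ∧ IsTangent (inChart Ω e) y (normal g Ω e y) ∧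
      bil (comp g e y) (normal g Ω e y) (normal g Ω e y) = 0 ∧
      ∀ v : Fin 4 → ℝ, IsTangent (inChart Ω e) y v → bil (comp g e y) v v ≤ 0 →
        ∃ c : ℝ, v = c • normal g Ω e y := by
  obtain ⟨T, hT⟩ := exists_completionOn hM he
  have hm := hT.metric
  have hn := hT.grad_null hy h0
  have h1 := hT.grad_ne_zero hy h0
  have eN : WithLp.toLp 2 (normal g Ω e y) = grad (comp g e) (inChart Ω e) y := rfl
  refine ⟨fun h => h1 ?_, ?_, ?_, fun v hv hvv => ?_⟩
  · rw [← eN, h]; rfl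
  · rw [isTangent_iff, eN, ← met_grad hm hy, hn]
  · rw [bil_eq_met, eN, hn]
  · rw [isTangent_iff, ← met_grad hm hy, met_symm hm hy] at hv
    rw [bil_eq_met] at hvv
    obtain ⟨c, hc⟩ := ((isLorentzForm_met hM.metric he hy).null_orthogonal h1 hn hv).2 hvv
    exact ⟨c, congrArg WithLp.ofLp hc⟩

/-- The Weyl tensor of the divergence-free gauge vanishes on the portion. -/
lemma wey_rescale_eq_zero (hM : IsConformalCompletion 0 g Ω) (hθ : IsDivergenceFreeGauge g Ω θ)
    (hΔ : IsOpenPortion g Ω Δ) (he : e ∈ atlas Coord M) (hy : y ∈ e.target)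
    (hyΔ : e.symm y ∈ Δ) : wey (comp (rescale θ g) e) y = 0 := by
  obtain ⟨s, hs, hmem, -⟩ := hΔ.cuts _ hyΔ
  exact wey_eq_zero_of_cut (hM.rescale hθ.smooth hθ.pos) hθ.divFree (hs.rescale hθ.pos) he hy hmem

/-- The Weyl tensor vanishes on the portion. -/
lemma wey_eq_zero (hM : IsConformalCompletion 0 g Ω) (hθ : IsDivergenceFreeGauge g Ω θ)
    (hΔ : IsOpenPortion g Ω Δ) (he : e ∈ atlas Coord M) (hy : y ∈ e.target)
    (hyΔ : e.symm y ∈ Δ) : wey (comp g e) y = 0 := by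
  have hpos : ∀ z, inChart θ e z ≠ 0 := fun z => (hθ.pos _).ne'
  have hw := wey_rescale_eq_zero hM hθ hΔ he hy hyΔ
  ext L K I J
  have := wey_rescale (metricOn_comp hM.metric he)
    (metricOn_comp (hM.rescale hθ.smooth hθ.pos).metric he) (contDiffOn_inChart hθ.smooth he)
    (fun z _ => hpos z) (fun z _ i j => comp_rescale θ g e z i j) hy L K I J
  rw [hw] at this
  exact (mul_eq_zero.1 this.symm).resolve_left (pow_ne_zero 2 (hpos y))

lemma weyl_eventually_eq_zero (hM : IsConformalCompletion 0 g Ω)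
    (hθ : IsDivergenceFreeGauge g Ω θ) (hΔ : IsOpenPortion g Ω Δ) (he : e ∈ atlas Coord M)
    (hy : y ∈ e.target) (hyΔ : e.symm y ∈ Δ) :
    ∀ᶠ z in 𝓝 y, inChart Ω e z = 0 → ∀ l k i j, weyl (comp g e) l k i j z = 0 := by
  filter_upwards [hΔ.eventually_mem hy hyΔ] with z hz hz0 l k i j
  have hw := wey_eq_zero hM hθ hΔ he hz.1 (hz.2 hz0)
  have := quadrilin_basisVec (fun l k i j => weyl (comp g e) l k i j z) l k i j
  change wey (comp g e) z _ _ _ _ = _ at this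
  rw [← this, hw]
  rfl

/-- A vector is tangent to infinity in one gauge if and only if it is in the other. -/
lemma fderiv_rescale_eq_zero_iff (hM : IsConformalCompletion 0 g Ω)
    (hθ : IsDivergenceFreeGauge g Ω θ) (he : e ∈ atlas Coord M) (hy : y ∈ e.target)
    (h0 : e.symm y ∈ scri Ω) (X : Coord) :
    fderiv ℝ (inChart (fun x => θ x * Ω x) e) y X = 0 ↔ fderiv ℝ (inChart Ω e) y X = 0 := by
  rw [inChart_mul, fderiv_mul_level e.open_target (contDiffOn_inChart hM.smooth he)
    (contDiffOn_inChart hθ.smooth he) hy h0]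
  have h1 : inChart θ e y ≠ 0 := (hθ.pos _).ne'
  simp [h1]

/-- The radiant supermomentum vanishes if and only if the Cotton tensor of the divergence-free
gauge vanishes on vectors tangent to infinity. -/
lemma radiantSuperMomentum_eq_zero_iff (hM : IsConformalCompletion 0 g Ω)
    (hθ : IsDivergenceFreeGauge g Ω θ) (hΔ : IsOpenPortion g Ω Δ) (he : e ∈ atlas Coord M)
    (hy : y ∈ e.target) (hyΔ : e.symm y ∈ Δ) :
    (∀ α, radiantSuperMomentum g Ω e y α = 0) ↔
      ∀ X Y Z, fderiv ℝ (inChart Ω e) y X = 0 → fderiv ℝ (inChart Ω e) y Y = 0 →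
        fderiv ℝ (inChart Ω e) y Z = 0 → cotton (comp (rescale θ g) e) y X Y Z = 0 := by
  have hM' := hM.rescale hθ.smooth hθ.pos
  have h0 := hΔ.subset_scri hyΔ
  have h0' : e.symm y ∈ scri fun x => θ x * Ω x := by rw [scri_rescale hθ.pos]; exact h0
  obtain ⟨T, hT⟩ := exists_completionOn hM he
  obtain ⟨T', hT'⟩ := exists_completionOn hM' he
  have hm := hT.metric
  have hw := fderiv_transv_scri hM he hy h0
  obtain ⟨e₁, e₂, F⟩ := exists_nullFrame_scri hM he hy h0 hw
  have hev := weyl_eventually_eq_zero hM hθ hΔ he hy hyΔ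
  have hd : rescaledWeyl g Ω e y = fun l k i j =>
      fderiv ℝ (weyl (comp g e) l k i j) y (transv (inChart Ω e) y) := by
    funext l k i j
    exact hT.extendFrom_weyl hy h0 hev hw l k i j
  have hq := quadrilin_fderiv_weyl hm hy (hev.self_of_nhds h0) (transv (inChart Ω e) y)
  have hc := cotton_eq_covWey hT hT' (contDiffOn_inChart hθ.smooth he)
    (fun z _ => (hθ.pos _).ne') (fun z _ i j => comp_rescale θ g e z i j) hy h0
    (wey_eq_zero hM hθ hΔ he hy hyΔ) (hess_eq_zero hM' hθ.divFree he hy h0') hw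
  have h1 := superMomentum_eq_zero_iff hm hy (rescaledWeyl g Ω e y) (hT.grad_null hy h0)
  rw [hd, hq, (covWeyL_weylType hm hy _).superContraction_eq_zero_iff hm hy F, ← hd] at h1
  have eN : ∀ V, met (comp g e) y V (grad (comp g e) (inChart Ω e) y)
      = fderiv ℝ (inChart Ω e) y V := fun V => by rw [met_symm hm hy, met_grad hm hy]
  refine Iff.trans h1 ?_
  simp only [eN, hc, mul_eq_zero, two_ne_zero, false_or]

lemma newsVanishesOn_iff (hM : IsConformalCompletion 0 g Ω) (hθ : IsDivergenceFreeGauge g Ω θ)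
    (hΔ : IsOpenPortion g Ω Δ) : NewsVanishesOn (rescale θ g) (fun x => θ x * Ω x) ρ Δ ↔
      ∀ e ∈ atlas Coord M, ∀ y ∈ e.target, e.symm y ∈ Δ → ∀ X Y,
        fderiv ℝ (inChart Ω e) y X = 0 → fderiv ℝ (inChart Ω e) y Y = 0 →
          newsForm (rescale θ g) ρ e y X Y = 0 := by
  have t : ∀ e ∈ atlas Coord M, ∀ y ∈ e.target, e.symm y ∈ Δ → ∀ X : Fin 4 → ℝ,
      IsTangent (inChart (fun x => θ x * Ω x) e) y X
        ↔ fderiv ℝ (inChart Ω e) y (WithLp.toLp 2 X) = 0 := fun e he y hy hyΔ X => by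
    rw [isTangent_iff, fderiv_rescale_eq_zero_iff hM hθ he hy (hΔ.subset_scri hyΔ)]
  constructor
  · intro h e he y hy hyΔ X Y hX hY
    have := h e he y hy hyΔ X Y ((t e he y hy hyΔ X).2 hX) ((t e he y hy hyΔ Y).2 hY)
    rwa [news_eq] at this
  · intro h e he y hy hyΔ X Y hX hY
    rw [news_eq]
    exact h e he y hy hyΔ _ _ ((t e he y hy hyΔ X).1 hX) ((t e he y hy hyΔ Y).1 hY)

/-- If News vanishes on the portion, so does the tangential Cotton tensor. -/
lemma cotton_eq_zero_of_news (hM : IsConformalCompletion 0 g Ω)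
    (hθ : IsDivergenceFreeGauge g Ω θ)
    (hρ : IsGerochTensor (rescale θ g) (fun x => θ x * Ω x) ρ) (hΔ : IsOpenPortion g Ω Δ)
    (hn : ∀ e ∈ atlas Coord M, ∀ y ∈ e.target, e.symm y ∈ Δ → ∀ X Y,
      fderiv ℝ (inChart Ω e) y X = 0 → fderiv ℝ (inChart Ω e) y Y = 0 →
        newsForm (rescale θ g) ρ e y X Y = 0)
    (he : e ∈ atlas Coord M) (hy : y ∈ e.target) (hyΔ : e.symm y ∈ Δ) {X Y Z : Coord}
    (hX : fderiv ℝ (inChart Ω e) y X = 0) (hY : fderiv ℝ (inChart Ω e) y Y = 0)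
    (hZ : fderiv ℝ (inChart Ω e) y Z = 0) : cotton (comp (rescale θ g) e) y X Y Z = 0 := by
  have hM' := hM.rescale hθ.smooth hθ.pos
  have h0 := hΔ.subset_scri hyΔ
  have h0' : e.symm y ∈ scri fun x => θ x * Ω x := by rw [scri_rescale hθ.pos]; exact h0
  obtain ⟨T', hT'⟩ := exists_completionOn hM' he
  have t := fderiv_rescale_eq_zero_iff hM hθ he hy h0
  have hz : ∀ᶠ z in 𝓝 y, inChart (fun x => θ x * Ω x) e z = 0 → ∀ Y Z,
      fderiv ℝ (inChart (fun x => θ x * Ω x) e) z Y = 0 →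
      fderiv ℝ (inChart (fun x => θ x * Ω x) e) z Z = 0 → newsForm (rescale θ g) ρ e z Y Z = 0 := by
    filter_upwards [hΔ.eventually_mem hy hyΔ] with z hz hz0 A B hA hB
    have hs : e.symm z ∈ scri Ω := by rw [← scri_rescale hθ.pos]; exact hz0
    have t' := fderiv_rescale_eq_zero_iff hM hθ he hz.1 hs
    exact hn e he z hz.1 (hz.2 hs) A B ((t' A).1 hA) ((t' B).1 hB)
  have c : ∀ {A B D}, fderiv ℝ (inChart Ω e) y A = 0 → fderiv ℝ (inChart Ω e) y B = 0 →
      fderiv ℝ (inChart Ω e) y D = 0 →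
      covB (comp (rescale θ g) e) (newsForm (rescale θ g) ρ e) y A B D = 0 :=
    fun {A B D} hA hB hD => covB_eq_zero_of_level e.open_target hT'.smooth
      (contDiffOn_newsForm hM' hρ he) hy h0' (hT'.regular y hy h0')
      (hess_eq_zero hM' hθ.divFree he hy h0') hz ((t A).2 hA) ((t B).2 hB) ((t D).2 hD)
  rw [← curl_newsForm hM' hρ he hy h0' ((t X).2 hX) ((t Y).2 hY) ((t Z).2 hZ), c hX hY hZ,
    c hY hX hZ, sub_zero]

/-- If the tangential Cotton tensor vanishes on the portion, so does News. -/
lemma newsForm_eq_zero_of_cotton (hM : IsConformalCompletion 0 g Ω)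
    (hθ : IsDivergenceFreeGauge g Ω θ)
    (hρ : IsGerochTensor (rescale θ g) (fun x => θ x * Ω x) ρ) (hΔ : IsOpenPortion g Ω Δ)
    (hc : ∀ e ∈ atlas Coord M, ∀ y ∈ e.target, e.symm y ∈ Δ → ∀ X Y Z,
      fderiv ℝ (inChart Ω e) y X = 0 → fderiv ℝ (inChart Ω e) y Y = 0 →
      fderiv ℝ (inChart Ω e) y Z = 0 → cotton (comp (rescale θ g) e) y X Y Z = 0)
    (he : e ∈ atlas Coord M) (hy : y ∈ e.target) (hyΔ : e.symm y ∈ Δ) {X Y : Coord}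
    (hX : fderiv ℝ (inChart Ω e) y X = 0) (hY : fderiv ℝ (inChart Ω e) y Y = 0) :
    newsForm (rescale θ g) ρ e y X Y = 0 := by
  have hM' := hM.rescale hθ.smooth hθ.pos
  have hS : Δ ⊆ scri fun x => θ x * Ω x := by rw [scri_rescale hθ.pos]; exact hΔ.subset_scri
  have hF := isCodazziField_newsForm hM' hθ.divFree hρ hS
    (fun e he y hy hyΔ => wey_rescale_eq_zero hM hθ hΔ he hy hyΔ)
    (fun e he y hy hyΔ X Y Z hX hY hZ => by
      have t := fderiv_rescale_eq_zero_iff hM hθ he hy (hΔ.subset_scri hyΔ)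
      exact hc e he y hy hyΔ X Y Z ((t X).1 hX) ((t Y).1 hY) ((t Z).1 hZ))
  obtain ⟨s, hs, hmem, hsub⟩ := hΔ.cuts _ hyΔ
  have t := fderiv_rescale_eq_zero_iff hM hθ he hy (hΔ.subset_scri hyΔ)
  exact hF.eq_zero_of_cut hM' hθ.divFree (hs.rescale hθ.pos) hsub he hy hmem ((t X).2 hX)
    ((t Y).2 hY)

end

end NullInfinity

end

open NullInfinity in
theorem mainTheorem1 {M : Type*} [TopologicalSpace M] [ChartedSpace Coord M]
    [IsManifold (𝓡 4) ∞ M] (g : BilinField M) (Ω : M → ℝ)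
    (hM : IsConformalCompletion 0 g Ω)
    (θ : M → ℝ) (hθ : IsDivergenceFreeGauge g Ω θ)
    (ρ : BilinField M) (hρ : IsGerochTensor (rescale θ g) (fun x => θ x * Ω x) ρ)
    (Δ : Set M) (hΔ : IsOpenPortion g Ω Δ) :
    -- infinity is null, and its normal is, up to scale, its only causal tangent vector
    (∀ e ∈ atlas Coord M, ∀ y ∈ e.target, e.symm y ∈ scri Ω →
      normal g Ω e y ≠ 0 ∧
      IsTangent (inChart Ω e) y (normal g Ω e y) ∧
      bil (comp g e y) (normal g Ω e y) (normal g Ω e y) = 0 ∧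
      ∀ v : Fin 4 → ℝ, IsTangent (inChart Ω e) y v → bil (comp g e y) v v ≤ 0 →
        ∃ c : ℝ, v = c • normal g Ω e y) ∧
    -- the rescaled Weyl tensor is regular on the portion
    (∀ e ∈ atlas Coord M, ∀ y ∈ e.target, e.symm y ∈ Δ → ∀ α β γ δ : Fin 4,
      ContinuousWithinAt (fun z => rescaledWeyl g Ω e z α β γ δ)
        {z | z ∈ e.target ∧ 0 ≤ Ω (e.symm z)} y) ∧
    -- News vanishes iff the asymptotic radiant supermomentum vanishes
    (NewsVanishesOn (rescale θ g) (fun x => θ x * Ω x) ρ Δ ↔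
      ∀ e ∈ atlas Coord M, ∀ y ∈ e.target, e.symm y ∈ Δ → ∀ α : Fin 4,
        radiantSuperMomentum g Ω e y α = 0) := by
  refine ⟨fun e he y hy h0 => normal_null hM he hy h0, fun e he y hy hyΔ α β γ δ => ?_, ?_⟩
  · obtain ⟨T, hT⟩ := exists_completionOn hM he
    exact hT.continuousWithinAt_extendFrom_weyl hy (hΔ.subset_scri hyΔ)
      (weyl_eventually_eq_zero hM hθ hΔ he hy hyΔ) α β γ δ
  · rw [newsVanishesOn_iff hM hθ hΔ]
    constructor
    · intro hn e he y hy hyΔ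
      rw [radiantSuperMomentum_eq_zero_iff hM hθ hΔ he hy hyΔ]
      intro X Y Z hX hY hZ
      exact cotton_eq_zero_of_news hM hθ hρ hΔ hn he hy hyΔ hX hY hZ
    · intro hr e he y hy hyΔ X Y hX hY
      exact newsForm_eq_zero_of_cotton hM hθ hρ hΔ
        (fun e he y hy hyΔ => (radiantSuperMomentum_eq_zero_iff hM hθ hΔ he hy hyΔ).1
          (hr e he y hy hyΔ)) he hy hyΔ hX hY
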